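/- Let $\mathbb{A}$ be $\mathbb{C}$, $\mathbb{H}$ (with $n\ge 1$) or the octonions $\mathbb{O}$ (with $n=1$), where $\mathbb{O}=\mathbb{H}\oplus\mathbb{H}$ with $(a,b)(c,d)=(ac-d\bar b,\ \bar a d+cb)$. Give $\mathbb{A}^n$ its standard Euclidean inner product and let $\mathbb{A}$ act by right multiplication; $\operatorname{Im}\mathbb{A}$ is the orthogonal complement of $\mathbb{R}\cdot 1$. Let $G_{\mathbb{A}}(n)$ be the group (with the operator norm topology) of real linear isometries $\phi$ of $\mathbb{A}^n$ for which there is $\theta\in SO(\mathbb{A})$ with $\phi(vx)=\phi(v)\theta(x)$ for all $v\in\mathbb{A}^n$, $x\in\mathbb{A}$. A real linear subspace $C\subset\mathbb{A}^n$ with $\dim_{\mathbb R} C=\frac12\dim_{\mathbb R}\mathbb{A}^n$ is called $\frac12\mathbb{A}$-Lagrangian if there is a real subspace $L\subset\operatorname{Im}\mathbb{A}$ with $\dim L=\frac12\dim\mathbb{A}$ such that $Cu\perp C$ for every unit vector $u\in L$. Let $\mathcal{L}_{\mathbb{A}}(n)$ be the set of these subspaces, topologized as a subset of the Grassmannian (through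 orthogonal projections), and let $C_0=\mathbb{R}^n\subset\mathbb{C}^n$, $C_0=\mathbb{C}^n\subset\mathbb{H}^n$, $C_0=\mathbb{H}\oplus 0\subset\mathbb{O}$ respectively. **Proposition.** $\mathcal{L}_{\mathbb{A}}(n)$ is a homogeneous space of $G_{\mathbb{A}}(n)$: the group maps $\mathcal{L}_{\mathbb{A}}(n)$ to itself and acts transitively on it, and $gK\mapsto gC_0$ is a homeomorphism $G_{\mathbb{A}}(n)/K\cong\mathcal{L}_{\mathbb{A}}(n)$ for the following subgroup $K$ (which is therefore the stabilizer of $C_0$). 1. $\mathbb{A}=\mathbb{C}$, $n\ge1$. $G_{\mathbb{C}}(n)=U(n)$ as topological groups, acting by matrix multiplication, and $K=O(n)$, so $\mathcal{L}_{\mathbb{C}}(n)\cong U(n)/O(n)$. The subgroup $SO(n)$ has index two in $O(n)$, and $U(n)/SO(n)$ is the space of oriented Lagrangian subspaces: for each orientation $o$ of $\mathbb{R}^n$, $g\,SO(n)\mapsto g(\mathbb{R}^n,o)$ is a homeomorphism from $U(n)/SO(n)$ onto the space of pairs (Lagrangian subspace, orientation of it), whose topology is given by orthogonal projections and volume forms.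 2. $\mathbb{A}=\mathbb{H}$, $n\ge1$. $G_{\mathbb{H}}(n)=Sp(n)Sp(1)$, that is, $(\alpha,\beta)\mapsto(v\mapsto\alpha v\bar\beta)$ is a continuous surjective homomorphism $Sp(n)\times Sp(1)\to G_{\mathbb{H}}(n)$ with kernel $\{\pm(1,1)\}$. Let $U(n)U(1)$ be the image of $U(n)\times U(1)$ (entries in $\mathbb{C}=\mathbb{R}+\mathbb{R}i$). Then $K$ is the subgroup generated by $U(n)U(1)$ and the image of $(j\cdot 1,j)$, in which $U(n)U(1)$ has index two. The quotient $Sp(n)Sp(1)/U(n)U(1)$ is the space of pairs $(C,v)$ with $C\in\mathcal{L}_{\mathbb{H}}(n)$ and $v\in\operatorname{Im}\mathbb{H}$, $|v|=1$, $Cv\subset C$: the map $g\mapsto(g\,\mathbb{C}^n,w)$, where $w$ is given by $g(xi)=g(x)w$ for all $x\in\mathbb{H}^n$, induces a homeomorphism onto it. 3. $\mathbb{A}=\mathbb{O}$, $n=1$. $G_{\mathbb{O}}(1)=Spin(7)$: the spin representation on $\mathbb{O}$, that is, the action of the Clifford algebra of $(\operatorname{Im}\mathbb{O},-|u|^2)$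 in which $u$ acts as $y\mapsto yu$, restricts to a group isomorphism $Spin(7)\cong G_{\mathbb{O}}(1)$. The subgroup $K$ is the image of $Sp(1)^3$ under the continuous homomorphism $(p,q,r)\mapsto\big((a,b)\mapsto(pa\bar q,\ qb\bar r)\big)$ into $G_{\mathbb{O}}(1)$, whose kernel is $\{\pm(1,1,1)\}$. Thus $\mathcal{L}_{\mathbb{O}}(1)\cong Spin(7)/Sp(1)^3$, with $Sp(1)^3$ read as this image. -/

import Mathlib

open scoped Quaternion

/-! ### The octonions, by the Cayley-Dickson process from the quaternions -/

/-- The underlying Euclidean space `ℍ ⊕ ℍ` of the octonions. -/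
abbrev Octonion : Type := WithLp 2 (ℍ[ℝ] × ℍ[ℝ])

/-- `(a, b)(c, d) = (ac - d b*, a* d + c b)`. -/
noncomputable instance : Mul Octonion where
  mul x y := WithLp.toLp 2
    (x.fst * y.fst - y.snd * star x.snd, star x.fst * y.snd + y.fst * x.snd)

noncomputable instance : One Octonion where
  one := WithLp.toLp 2 (1, 0)

theorem Octonion.mul_fst (x y : Octonion) :
    (x * y).fst = x.fst * y.fst - y.snd * star x.snd := rfl

theorem Octonion.mul_snd (x y : Octonion) :
    (x * y).snd = star x.fst * y.snd + y.fst * x.snd := rfl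

theorem Octonion.one_fst : (1 : Octonion).fst = 1 := rfl

theorem Octonion.one_snd : (1 : Octonion).snd = 0 := rfl

/-! ### Normed linear spaces over a normed algebra, twisted isomorphisms, Lagrangian subspaces -/

section General

variable (A : Type) [NormedAddCommGroup A] [InnerProductSpace ℝ A] [Mul A] [One A] (n : ℕ)

/-- `𝔸ⁿ` with its standard inner product. -/
abbrev LinSpace : Type := PiLp 2 (fun _ : Fin n => A)

variable {A n} in
/-- Right multiplication of a vector `v` of `𝔸ⁿ` by `x ∈ 𝔸`; for a unit imaginary `u` the complex
structure `J_u` is `v ↦ rightMul v u`. -/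
noncomputable def rightMul (v : LinSpace A n) (x : A) : LinSpace A n := WithLp.toLp 2 (fun i => v i * x)

/-- `Im 𝔸`, the orthogonal complement of `ℝ ⋅ 1`. -/
noncomputable def imPart : Submodule ℝ A := (Submodule.span ℝ {(1 : A)})ᗮ

/-- The group `G_𝔸(n)` of twisted isomorphisms of `𝔸ⁿ`: the real linear isometries `φ` for which
there is `θ ∈ SO(𝔸)` with `φ(v x) = φ(v) θ(x)`. -/
noncomputable def twistedGroup : Subgroup (LinSpace A n ≃ₗᵢ[ℝ] LinSpace A n) where
  carrier := {φ | ∃ θ : A ≃ₗᵢ[ℝ] A, LinearMap.det (θ.toLinearEquiv : A →ₗ[ℝ] A) = 1 ∧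
    ∀ (v : LinSpace A n) (x : A), φ (rightMul v x) = rightMul (φ v) (θ x)}
  mul_mem' := by
    rintro φ ψ ⟨θ, hθ, h⟩ ⟨η, hη, k⟩
    refine ⟨θ * η, ?_, fun v x => ?_⟩
    · have : (((θ * η : A ≃ₗᵢ[ℝ] A).toLinearEquiv : A →ₗ[ℝ] A))
          = (θ.toLinearEquiv : A →ₗ[ℝ] A) * (η.toLinearEquiv : A →ₗ[ℝ] A) := rfl
      rw [this, map_mul, hθ, hη, one_mul]
    · change φ (ψ _) = rightMul (φ (ψ v)) (θ (η x))
      rw [k, h]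
  one_mem' := by
    refine ⟨1, ?_, fun v x => rfl⟩
    have : (((1 : A ≃ₗᵢ[ℝ] A).toLinearEquiv : A →ₗ[ℝ] A)) = 1 := rfl
    rw [this, map_one]
  inv_mem' := by
    rintro φ ⟨θ, hθ, h⟩
    refine ⟨θ⁻¹, ?_, fun v x => ?_⟩
    · have : (((θ⁻¹ : A ≃ₗᵢ[ℝ] A).toLinearEquiv : A →ₗ[ℝ] A))
          * (θ.toLinearEquiv : A →ₗ[ℝ] A) = 1 := by
        ext x
        exact θ.symm_apply_apply x
      have h2 := congrArg LinearMap.det this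
      rwa [map_mul, hθ, map_one, mul_one] at h2
    · change φ.symm _ = rightMul (φ.symm v) (θ.symm x)
      rw [LinearIsometryEquiv.symm_apply_eq, h]
      simp

/-- `G_𝔸(n)` carries the topology of a matrix group: the operator norm topology. -/
noncomputable instance : TopologicalSpace (twistedGroup A n) :=
  TopologicalSpace.induced
    (fun g => ((g : LinSpace A n ≃ₗᵢ[ℝ] LinSpace A n).toContinuousLinearEquiv :
      LinSpace A n →L[ℝ] LinSpace A n)) inferInstance

variable {A n}

/-- The image `g C` of a real linear subspace `C` of `𝔸ⁿ` under `g ∈ G_𝔸(n)`. -/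
noncomputable def imageUnder (g : twistedGroup A n) (C : Submodule ℝ (LinSpace A n)) :
    Submodule ℝ (LinSpace A n) :=
  C.map ((g : LinSpace A n ≃ₗᵢ[ℝ] LinSpace A n).toLinearEquiv : LinSpace A n →ₗ[ℝ] LinSpace A n)

/-- `½𝔸`-Lagrangian subspaces: real subspaces `C` of `𝔸ⁿ` of half the dimension such that
`J_u C ⟂ C` for all unit vectors `u` of some real subspace `L` of `Im 𝔸` with
`dim L = ½ dim 𝔸`. -/
def IsHalfLagrangian (C : Submodule ℝ (LinSpace A n)) : Prop :=
  2 * Module.finrank ℝ C = Module.finrank ℝ (LinSpace A n) ∧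
  ∃ L : Submodule ℝ A, L ≤ imPart A ∧ 2 * Module.finrank ℝ L = Module.finrank ℝ A ∧
    ∀ u ∈ L, ‖u‖ = 1 → ∀ c ∈ C, ∀ c' ∈ C, inner ℝ (rightMul c u) c' = 0

variable (A n)

/-- The space of `½𝔸`-Lagrangian subspaces of `𝔸ⁿ`. -/
def HalfLagrangian : Type := {C : Submodule ℝ (LinSpace A n) // IsHalfLagrangian C}

/-- The topology of the Grassmannian: subspaces are close when the orthogonal projections onto
them are. -/
noncomputable instance [FiniteDimensional ℝ A] : TopologicalSpace (HalfLagrangian A n) :=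
  TopologicalSpace.induced (fun C => C.1.starProjection) inferInstance

variable {A n}

/-- `G_𝔸(n)` maps `½𝔸`-Lagrangian subspaces to `½𝔸`-Lagrangian subspaces, acts transitively on
them, and `g K ↦ g C₀` is a well-defined homeomorphism from `G_𝔸(n)/K` onto the space of
`½𝔸`-Lagrangian subspaces. -/
def IsHomogeneousSpace [FiniteDimensional ℝ A] (K : Subgroup (twistedGroup A n))
    (C₀ : Submodule ℝ (LinSpace A n)) : Prop :=
  (∀ (g : twistedGroup A n) (C : Submodule ℝ (LinSpace A n)),
    IsHalfLagrangian C → IsHalfLagrangian (imageUnder g C)) ∧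
  (∀ C C' : Submodule ℝ (LinSpace A n), IsHalfLagrangian C → IsHalfLagrangian C' →
    ∃ g : twistedGroup A n, imageUnder g C = C') ∧
  ∃ h : (twistedGroup A n ⧸ K) ≃ₜ HalfLagrangian A n,
    ∀ g : twistedGroup A n, (h (g : twistedGroup A n ⧸ K)).1 = imageUnder g C₀

end General

/-! ### The complex case -/

/-- `ℝⁿ ⊂ ℂⁿ`. -/
def realSubspace (n : ℕ) : Submodule ℝ (LinSpace ℂ n) where
  carrier := {v | ∀ i, (v i).im = 0}
  add_mem' := by intro a b ha hb i; simp [ha i, hb i]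
  zero_mem' := by intro i; simp
  smul_mem' := by intro c v hv i; simp [hv i]

/-- `O(n) ⊂ U(n)`: the unitary matrices with real entries. -/
def orthogonalInUnitary (n : ℕ) : Subgroup (Matrix.unitaryGroup (Fin n) ℂ) where
  carrier := {M | ∀ i j, ((M : Matrix (Fin n) (Fin n) ℂ) i j).im = 0}
  mul_mem' := by
    intro a b ha hb i j
    simp only [Submonoid.coe_mul, Matrix.mul_apply, Complex.im_sum]
    refine Finset.sum_eq_zero fun k _ => ?_
    simp [Complex.mul_im, ha i k, hb k j]
  one_mem' := by
    intro i j
    simp only [OneMemClass.coe_one, Matrix.one_apply]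
    split_ifs <;> simp
  inv_mem' := by
    intro a ha i j
    change ((star (a : Matrix (Fin n) (Fin n) ℂ)) i j).im = 0
    simp [Matrix.star_apply, ha j i]

/-- `SO(n) ⊂ U(n)`: the unitary matrices with real entries and determinant one. -/
def specialOrthogonalInUnitary (n : ℕ) : Subgroup (Matrix.unitaryGroup (Fin n) ℂ) where
  carrier := {M | M ∈ orthogonalInUnitary n ∧ (M : Matrix (Fin n) (Fin n) ℂ).det = 1}
  mul_mem' := by
    rintro a b ⟨ha, ha'⟩ ⟨hb, hb'⟩
    exact ⟨mul_mem ha hb, by simp [ha', hb']⟩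
  one_mem' := ⟨one_mem _, by simp⟩
  inv_mem' := by
    rintro a ⟨ha, ha'⟩
    refine ⟨inv_mem ha, ?_⟩
    change (star (a : Matrix (Fin n) (Fin n) ℂ)).det = 1
    rw [Matrix.star_eq_conjTranspose, Matrix.det_conjTranspose, ha', star_one]

/-- Lagrangian subspaces of `ℂⁿ` with an orientation. -/
structure OrientedLagrangian (n : ℕ) where
  /-- the Lagrangian subspace -/
  C : Submodule ℝ (LinSpace ℂ n)
  lagrangian : IsHalfLagrangian C
  /-- the orientation -/
  o : Orientation ℝ C (Fin n)

theorem OrientedLagrangian.finrank_eq {n : ℕ} (X : OrientedLagrangian n) :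
    Module.finrank ℝ X.C = n := by
  have h := X.lagrangian.1
  have h2 : Module.finrank ℝ (LinSpace ℂ n) = n * 2 := by
    rw [(WithLp.linearEquiv 2 ℝ (Fin n → ℂ)).finrank_eq]
    simp [Module.finrank_pi_fintype]
  omega

/-- The volume form of an oriented Lagrangian subspace, extended to `ℂⁿ` by orthogonal
projection. -/
noncomputable def OrientedLagrangian.form {n : ℕ} (X : OrientedLagrangian n) :
    (Fin n → LinSpace ℂ n) → ℝ :=
  haveI : Fact (Module.finrank ℝ X.C = n) := ⟨X.finrank_eq⟩
  fun w => X.o.volumeForm fun i => X.C.orthogonalProjectionOnto (w i)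

/-- Oriented subspaces are close when the orthogonal projections onto them and their volume forms
are (the topology of the oriented Grassmannian). -/
noncomputable instance (n : ℕ) : TopologicalSpace (OrientedLagrangian n) :=
  TopologicalSpace.induced (fun X => (X.C.starProjection, X.form)) inferInstance

/-! ### The quaternionic case -/

/-- `Sp(n)`, the group of quaternionic matrices `M` with `M* M = M M* = 1`. -/
abbrev SpGroup (n : ℕ) : Type := unitary (Matrix (Fin n) (Fin n) ℍ[ℝ])

/-- `Sp(1)`, the group of unit quaternions. -/
abbrev UnitQuaternions : Type := unitary ℍ[ℝ]

/-- `ℂⁿ ⊂ ℍⁿ`, where `ℂ = ℝ + ℝ i ⊂ ℍ`. -/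
def complexSubspace (n : ℕ) : Submodule ℝ (LinSpace ℍ[ℝ] n) where
  carrier := {v | ∀ k, (v k).imJ = 0 ∧ (v k).imK = 0}
  add_mem' := by
    intro a b ha hb k
    simp [(ha k).1, (ha k).2, (hb k).1, (hb k).2]
  zero_mem' := by intro k; simp
  smul_mem' := by
    intro c v hv k
    simp [(hv k).1, (hv k).2]

/-- `U(n) × U(1) ⊂ Sp(n) × Sp(1)`: the pairs whose entries lie in `ℂ = ℝ + ℝ i ⊂ ℍ`. -/
def unitaryPairs (n : ℕ) : Subgroup (SpGroup n × UnitQuaternions) where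
  carrier := {p | (∀ k l, (p.1 : Matrix (Fin n) (Fin n) ℍ[ℝ]) k l ∈ Quaternion.ofComplex.range) ∧
    (p.2 : ℍ[ℝ]) ∈ Quaternion.ofComplex.range}
  mul_mem' := by
    rintro a b ⟨ha, ha'⟩ ⟨hb, hb'⟩
    refine ⟨fun k l => ?_, mul_mem ha' hb'⟩
    change ((a.1 : Matrix (Fin n) (Fin n) ℍ[ℝ]) * (b.1 : Matrix (Fin n) (Fin n) ℍ[ℝ])) k l ∈ _
    rw [Matrix.mul_apply]
    exact sum_mem fun m _ => mul_mem (ha k m) (hb m l)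
  one_mem' := by
    refine ⟨fun k l => ?_, one_mem _⟩
    change (1 : Matrix (Fin n) (Fin n) ℍ[ℝ]) k l ∈ _
    rw [Matrix.one_apply]
    split_ifs
    · exact one_mem _
    · exact zero_mem _
  inv_mem' := by
    have key : ∀ x : ℍ[ℝ], x ∈ Quaternion.ofComplex.range →
        star x ∈ Quaternion.ofComplex.range := by
      rintro _ ⟨z, rfl⟩
      refine ⟨star z, ?_⟩
      change ((star z : ℂ) : ℍ[ℝ]) = star ((z : ℂ) : ℍ[ℝ])
      ext <;> simp
    rintro a ⟨ha, ha'⟩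
    exact ⟨fun k l => key _ (ha l k), key _ ha'⟩

/-- The quaternion `j`. -/
def quatJ : ℍ[ℝ] := ⟨0, 0, 1, 0⟩

theorem quatJ_mem : quatJ ∈ unitary ℍ[ℝ] := by
  have h0 : quatJ.re = 0 := rfl
  have h1 : quatJ.imI = 0 := rfl
  have h2 : quatJ.imJ = 1 := rfl
  have h3 : quatJ.imK = 0 := rfl
  rw [Unitary.mem_iff]
  constructor <;> ext <;> simp [h0, h1, h2, h3]

/-- `j` as an element of `Sp(1)`. -/
def quaternionJ : UnitQuaternions := ⟨quatJ, quatJ_mem⟩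

/-- The scalar matrix `j ⋅ 1` in `Sp(n)`. -/
noncomputable def scalarJ (n : ℕ) : SpGroup n :=
  ⟨Matrix.diagonal fun _ => (quaternionJ : ℍ[ℝ]), by
    rw [Unitary.mem_iff, Matrix.star_eq_conjTranspose, Matrix.diagonal_conjTranspose,
      Matrix.diagonal_mul_diagonal, Matrix.diagonal_mul_diagonal]
    constructor
    · rw [← Matrix.diagonal_one]
      congr 1
      funext i
      exact Unitary.coe_star_mul_self quaternionJ
    · rw [← Matrix.diagonal_one]
      congr 1
      funext i
      exact Unitary.coe_mul_star_self quaternionJ⟩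

/-- The subgroup of `Sp(n) × Sp(1)` generated by `U(n) × U(1)` and `(j, j)`. -/
noncomputable def extendedUnitaryPairs (n : ℕ) : Subgroup (SpGroup n × UnitQuaternions) :=
  unitaryPairs n ⊔ Subgroup.zpowers (scalarJ n, quaternionJ)

/-- Pairs `(C, v)` of a `ℂ`-Lagrangian subspace `C` of `ℍⁿ` and a unit imaginary quaternion `v` for
which `C` is a `J_v`-complex subspace. -/
def PolarizedLagrangian (n : ℕ) : Type :=
  {p : Submodule ℝ (LinSpace ℍ[ℝ] n) × ℍ[ℝ] // IsHalfLagrangian p.1 ∧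
    p.2 ∈ imPart ℍ[ℝ] ∧ ‖p.2‖ = 1 ∧ ∀ c ∈ p.1, rightMul c p.2 ∈ p.1}

noncomputable instance (n : ℕ) : TopologicalSpace (PolarizedLagrangian n) :=
  TopologicalSpace.induced (fun p => (p.1.1.starProjection, p.1.2)) inferInstance

/-! ### The octonionic case -/

/-- `ℍ ⊕ 0 ⊂ ℍ ⊕ ℍ = 𝕆`, as a subspace of `𝕆¹`. -/
def quaternionSubspace : Submodule ℝ (LinSpace Octonion 1) where
  carrier := {v | ∀ k, (v k).snd = 0}
  add_mem' := by intro a b ha hb k; simp [ha k, hb k]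
  zero_mem' := by intro k; simp
  smul_mem' := by intro c v hv k; simp [hv k]

/-- The quadratic form `u ↦ -|u|²` on `Im 𝕆 ≅ ℝ⁷`. -/
noncomputable def imForm : QuadraticForm ℝ (imPart Octonion) :=
  -(LinearMap.BilinMap.toQuadraticMap (innerₗ (imPart Octonion)))

theorem imForm_apply (u : imPart Octonion) : imForm u = -‖(u : Octonion)‖ ^ 2 := by
  simp [imForm]

theorem re_fst_of_mem_imPart {u : Octonion} (hu : u ∈ imPart Octonion) : u.fst.re = 0 := by
  rw [imPart, Submodule.mem_orthogonal_singleton_iff_inner_right] at hu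
  simpa [WithLp.prod_inner_apply, Octonion.one_fst, Octonion.one_snd, Quaternion.inner_def]
    using hu

/-- Right multiplication `R_u : y ↦ y u` of octonions by an imaginary octonion. -/
noncomputable def rightMulHom : imPart Octonion →ₗ[ℝ] Module.End ℝ Octonion :=
  LinearMap.mk₂ ℝ (fun (u : imPart Octonion) (y : Octonion) => y * (u : Octonion))
    (fun u v y => by
      apply WithLp.ofLp_injective
      ext1
      · change (y * ((u : Octonion) + v)).fst = (y * (u : Octonion) + y * v).fst
        simp only [Octonion.mul_fst, WithLp.add_fst, WithLp.add_snd]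
        noncomm_ring
      · change (y * ((u : Octonion) + v)).snd = (y * (u : Octonion) + y * v).snd
        simp only [Octonion.mul_snd, WithLp.add_fst, WithLp.add_snd]
        noncomm_ring)
    (fun c u y => by
      apply WithLp.ofLp_injective
      ext1
      · change (y * (c • (u : Octonion))).fst = (c • (y * (u : Octonion))).fst
        simp only [Octonion.mul_fst, WithLp.smul_fst, WithLp.smul_snd]
        simp [smul_sub]
      · change (y * (c • (u : Octonion))).snd = (c • (y * (u : Octonion))).snd
        simp only [Octonion.mul_snd, WithLp.smul_fst, WithLp.smul_snd]
        simp [smul_add])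
    (fun u y z => by
      apply WithLp.ofLp_injective
      ext1
      · change ((y + z) * (u : Octonion)).fst = (y * (u : Octonion) + z * u).fst
        simp only [Octonion.mul_fst, WithLp.add_fst, WithLp.add_snd, star_add]
        noncomm_ring
      · change ((y + z) * (u : Octonion)).snd = (y * (u : Octonion) + z * u).snd
        simp only [Octonion.mul_snd, WithLp.add_fst, WithLp.add_snd, star_add]
        noncomm_ring)
    (fun c u y => by
      apply WithLp.ofLp_injective
      ext1
      · change ((c • y) * (u : Octonion)).fst = (c • (y * (u : Octonion))).fst
        simp only [Octonion.mul_fst, WithLp.smul_fst, WithLp.smul_snd]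
        simp [smul_sub]
      · change ((c • y) * (u : Octonion)).snd = (c • (y * (u : Octonion))).snd
        simp only [Octonion.mul_snd, WithLp.smul_fst, WithLp.smul_snd]
        simp [smul_add])

theorem rightMulHom_apply (u : imPart Octonion) (y : Octonion) :
    rightMulHom u y = y * (u : Octonion) := rfl

theorem rightMulHom_sq (u : imPart Octonion) :
    rightMulHom u * rightMulHom u = algebraMap ℝ (Module.End ℝ Octonion) (imForm u) := by
  have hre := re_fst_of_mem_imPart u.2
  have hn : ‖(u : Octonion)‖ ^ 2 = (u : Octonion).fst.re ^ 2 + (u : Octonion).fst.imI ^ 2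
      + (u : Octonion).fst.imJ ^ 2 + (u : Octonion).fst.imK ^ 2
      + ((u : Octonion).snd.re ^ 2 + (u : Octonion).snd.imI ^ 2
      + (u : Octonion).snd.imJ ^ 2 + (u : Octonion).snd.imK ^ 2) := by
    rw [WithLp.prod_norm_sq_eq_of_L2, sq, sq, ← Quaternion.normSq_eq_norm_mul_self,
      ← Quaternion.normSq_eq_norm_mul_self, Quaternion.normSq_def', Quaternion.normSq_def']
  refine LinearMap.ext fun y => WithLp.ofLp_injective 2 ?_
  change ((y * (u : Octonion)) * (u : Octonion)).ofLp = ((imForm u) • y).ofLp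
  rw [imForm_apply, hn]
  ext1
  · change ((y * (u : Octonion)) * (u : Octonion)).fst = _ • y.fst
    simp only [Octonion.mul_fst, Octonion.mul_snd]
    ext <;> simp [hre] <;> ring
  · change ((y * (u : Octonion)) * (u : Octonion)).snd = _ • y.snd
    simp only [Octonion.mul_fst, Octonion.mul_snd]
    ext <;> simp [hre] <;> ring

/-- The group `Spin(7)` of `Im 𝕆 ≅ ℝ⁷`, inside the Clifford algebra. -/
abbrev SpinSeven : Type := spinGroup imForm

/-- The spin representation on `𝕆`: the action of the Clifford algebra of `Im 𝕆` in which
`u ∈ Im 𝕆` acts as `y ↦ y u`. -/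
noncomputable def spinRep : CliffordAlgebra imForm →ₐ[ℝ] Module.End ℝ Octonion :=
  CliffordAlgebra.lift imForm ⟨rightMulHom, rightMulHom_sq⟩

/-! The topology is the same for the three algebras. The group is compact: the pairs (φ, θ) of
isometries satisfying the closed conditions det θ = 1 and φ(vx) = φ(v)θ(x) form a compact set, and
the group is its projection. The space of subspaces is Hausdorff because a subspace is determined by
its orthogonal projection, and the projection onto gC is the conjugate by g of the one onto C. Hence
a transitive orbit map descends to a homeomorphism from the quotient by the stabilizer
(`exists_quotient_homeomorph`, `isHomogeneousSpace_of_stabilizer`). What is left is algebra: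
identify the group, prove transitivity, compute the stabilizer.

Over ℂ, θ fixes 1 and has determinant 1, so it is the identity and φ is unitary. Here L must be ℝi,
and Ci ⟂ C says that the hermitian product is real on C, so a real orthonormal basis of C is a
unitary basis of ℂⁿ. Elements of O(n) multiply the volume form of ℝⁿ by their determinant; this
gives the oriented version.

Over ℍ, associativity makes θ an algebra automorphism, hence conjugation by a unit quaternion β
(`exists_conj_of_mul_hom`); removing β leaves a matrix in Sp(n). The product w of an orthonormal
basis of L preserves C. After conjugating w to i, C is a complex subspace with Cj ⟂ C, and
Gram-Schmidt along complex lines gives a quaternionic orthonormal basis inside C. The stabilizer of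
ℂⁿ sends i to ±i under the twist: the sign + singles out U(n)U(1), and (j, j) changes the sign.

Over 𝕆, right multiplication R_u by a unit imaginary u belongs to the group, and its twist on Im 𝕆
is minus the reflection in the hyperplane orthogonal to u. By Cartan-Dieudonné every isometry of Im
𝕆 is, up to the sign (-1)^k, the twist of a product of k such maps (`exists_pin_of_isometry`). For
the twist of a group element k is even, since -1 has determinant -1 in dimension 7; and an element
with trivial twist is ±1. So Spin(7) maps onto the group. The map is injective because an even
Clifford element commuting with all vectors is a scalar. For transitivity, a twist moves L to 0 ⊕ ℍ;
then C is stable under all (a, b) ↦ (ea, be), and noncommutativity of ℍ forces C to be ℍ ⊕ 0 or 0 ⊕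
ℍ, which R_u with u = (0, 1) interchanges. Comparing products on ℍ ⊕ 0 and 0 ⊕ ℍ shows that the
stabilizer comes from Sp(1)³. -/

set_option linter.unusedSectionVars false

/-! ### Composition algebras and their twisted isomorphism groups -/

section General

/-- A real algebra with unit, not necessarily associative, with a multiplicative Euclidean norm. -/
class IsCompositionAlgebra (A : Type) [NormedAddCommGroup A] [InnerProductSpace ℝ A] [Mul A]
    [One A] : Prop where
  protected mul_add : ∀ x y z : A, x * (y + z) = x * y + x * z
  protected add_mul : ∀ x y z : A, (x + y) * z = x * z + y * z
  protected mul_smul : ∀ (c : ℝ) (x y : A), x * (c • y) = c • (x * y)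
  protected smul_mul : ∀ (c : ℝ) (x y : A), (c • x) * y = c • (x * y)
  protected mul_one : ∀ x : A, x * 1 = x
  protected norm_mul : ∀ x y : A, ‖x * y‖ = ‖x‖ * ‖y‖
  protected norm_one : ‖(1 : A)‖ = 1

variable {A : Type} [NormedAddCommGroup A] [InnerProductSpace ℝ A] [Mul A] [One A]
  [IsCompositionAlgebra A] {n : ℕ}

@[simp] theorem rightMul_apply (v : LinSpace A n) (x : A) (i : Fin n) :
    rightMul v x i = v i * x := rfl

theorem rightMul_add (v : LinSpace A n) (x y : A) :
    rightMul v (x + y) = rightMul v x + rightMul v y := by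
  ext i; exact IsCompositionAlgebra.mul_add _ _ _

theorem add_rightMul (v w : LinSpace A n) (x : A) :
    rightMul (v + w) x = rightMul v x + rightMul w x := by
  ext i; exact IsCompositionAlgebra.add_mul _ _ _

theorem rightMul_smul (c : ℝ) (v : LinSpace A n) (x : A) :
    rightMul v (c • x) = c • rightMul v x := by
  ext i; exact IsCompositionAlgebra.mul_smul _ _ _

theorem smul_rightMul (c : ℝ) (v : LinSpace A n) (x : A) :
    rightMul (c • v) x = c • rightMul v x := by
  ext i; exact IsCompositionAlgebra.smul_mul _ _ _

theorem rightMul_one (v : LinSpace A n) : rightMul v (1 : A) = v := by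
  ext i; exact IsCompositionAlgebra.mul_one _

theorem norm_rightMul (v : LinSpace A n) (x : A) : ‖rightMul v x‖ = ‖v‖ * ‖x‖ := by
  rw [← sq_eq_sq₀ (norm_nonneg _) (by positivity), mul_pow, PiLp.norm_sq_eq_of_L2,
    PiLp.norm_sq_eq_of_L2, Finset.sum_mul]
  refine Finset.sum_congr rfl fun i _ => ?_
  rw [rightMul_apply, IsCompositionAlgebra.norm_mul, mul_pow]

/-- Right multiplication as a bilinear map. -/
noncomputable def rightMulₗ : LinSpace A n →ₗ[ℝ] A →ₗ[ℝ] LinSpace A n :=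
  LinearMap.mk₂ ℝ rightMul add_rightMul smul_rightMul rightMul_add rightMul_smul

theorem rightMul_zero (v : LinSpace A n) : rightMul v (0 : A) = 0 := map_zero (rightMulₗ v)

theorem rightMul_neg (v : LinSpace A n) (x : A) : rightMul v (-x) = -rightMul v x :=
  map_neg (rightMulₗ v) x

theorem rightMul_sub (v : LinSpace A n) (x y : A) :
    rightMul v (x - y) = rightMul v x - rightMul v y := map_sub (rightMulₗ v) x y

theorem rightMul_left_cancel {v : LinSpace A n} (hv : v ≠ 0) {x y : A}
    (h : rightMul v x = rightMul v y) : x = y := by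
  have := norm_rightMul v (x - y)
  rw [rightMul_sub, h, sub_self, norm_zero, zero_eq_mul] at this
  rcases this with h | h
  · exact absurd (norm_eq_zero.1 h) hv
  · exact sub_eq_zero.1 (norm_eq_zero.1 h)

/-- Polarization of the multiplicative norm in the left factor; the next lemma polarizes in the
right factor. -/
theorem inner_rightMul_rightMul (v w : LinSpace A n) (x : A) :
    inner ℝ (rightMul v x) (rightMul w x) = ‖x‖ ^ 2 * inner ℝ v w := by
  have h := norm_rightMul (v + w) x
  rw [add_rightMul, ← sq_eq_sq₀ (norm_nonneg _) (by positivity), mul_pow, norm_add_sq_real,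
    norm_add_sq_real, norm_rightMul, norm_rightMul] at h
  linarith

theorem inner_rightMul_same (v : LinSpace A n) (x y : A) :
    inner ℝ (rightMul v x) (rightMul v y) = ‖v‖ ^ 2 * inner ℝ x y := by
  have h := norm_rightMul v (x + y)
  rw [rightMul_add, ← sq_eq_sq₀ (norm_nonneg _) (by positivity), mul_pow, norm_add_sq_real,
    norm_add_sq_real, norm_rightMul, norm_rightMul] at h
  linarith

/-- Right multiplication by an imaginary element is skew adjoint. -/
theorem inner_rightMul_left_add (v w : LinSpace A n) (x : A) :
    inner ℝ (rightMul v x) w + inner ℝ v (rightMul w x) = 2 * inner ℝ x 1 * inner ℝ v w := by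
  -- Replacing `x` by `x + 1` makes the cross terms with 1 appear; the quadratic terms cancel.
  have h := inner_rightMul_rightMul v w (x + 1)
  rw [rightMul_add, rightMul_add, rightMul_one, rightMul_one, inner_add_left, inner_add_right,
    inner_add_right, inner_rightMul_rightMul, norm_add_sq_real,
    IsCompositionAlgebra.norm_one] at h
  linarith

theorem mem_imPart {x : A} : x ∈ imPart A ↔ inner ℝ (1 : A) x = 0 := by
  rw [imPart, Submodule.mem_orthogonal_singleton_iff_inner_right]

theorem inner_rightMul_left_of_imPart {x : A} (hx : x ∈ imPart A) (v w : LinSpace A n) :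
    inner ℝ (rightMul v x) w = -inner ℝ v (rightMul w x) := by
  have := inner_rightMul_left_add v w x
  rw [real_inner_comm 1 x, mem_imPart.1 hx] at this
  linarith

theorem nontrivial_of_isCompositionAlgebra : Nontrivial A :=
  ⟨1, 0, fun h => by simpa [h] using IsCompositionAlgebra.norm_one (A := A)⟩

theorem nontrivial_linSpace (hn : 1 ≤ n) : Nontrivial (LinSpace A n) := by
  have : Nontrivial A := nontrivial_of_isCompositionAlgebra
  have : Nonempty (Fin n) := ⟨⟨0, hn⟩⟩
  infer_instance

/-- The twist of an element of the twisted group fixes `1`. -/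
theorem twist_one (hn : 1 ≤ n) {φ : LinSpace A n ≃ₗᵢ[ℝ] LinSpace A n} {θ : A ≃ₗᵢ[ℝ] A}
    (h : ∀ v x, φ (rightMul v x) = rightMul (φ v) (θ x)) : θ 1 = 1 := by
  have : Nontrivial (LinSpace A n) := nontrivial_linSpace hn
  obtain ⟨v, hv⟩ := exists_ne (0 : LinSpace A n)
  refine rightMul_left_cancel (v := φ v) (by simpa using hv) ?_
  rw [← h, rightMul_one, rightMul_one]

theorem twist_mem_imPart {θ : A ≃ₗᵢ[ℝ] A} (h1 : θ 1 = 1) {x : A} (hx : x ∈ imPart A) :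
    θ x ∈ imPart A := by
  rw [mem_imPart] at *
  rw [← h1, LinearIsometryEquiv.inner_map_map, hx]

/-- The twisted group maps Lagrangian subspaces to Lagrangian subspaces. -/
theorem IsHalfLagrangian.imageUnder (hn : 1 ≤ n) (g : twistedGroup A n)
    {C : Submodule ℝ (LinSpace A n)} (hC : IsHalfLagrangian C) :
    IsHalfLagrangian (imageUnder g C) := by
  obtain ⟨hd, L, hL, hLd, hu⟩ := hC
  obtain ⟨θ, hθ, h⟩ := g.2
  refine ⟨?_, L.map (θ.toLinearEquiv : A →ₗ[ℝ] A), ?_, ?_, ?_⟩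
  · rw [← hd]
    exact congrArg _ (LinearEquiv.finrank_map_eq g.1.toLinearEquiv C)
  · rintro _ ⟨x, hx, rfl⟩
    exact twist_mem_imPart (twist_one hn h) (hL hx)
  · rw [← hLd]
    exact congrArg _ (LinearEquiv.finrank_map_eq θ.toLinearEquiv L)
  · rintro _ ⟨u, hu', rfl⟩ hn' _ ⟨c, hc, rfl⟩ _ ⟨c', hc', rfl⟩
    have h1 : ‖u‖ = 1 := by rw [← hn']; exact (θ.norm_map u).symm
    have h2 := h c u
    change inner ℝ (rightMul (g.1 c) (θ u)) (g.1 c') = 0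
    rw [← h2, LinearIsometryEquiv.inner_map_map]
    exact hu u hu' h1 c hc c' hc'

/-- The orthogonality condition is linear in `u`, so rescaling frees it from the restriction to unit
vectors. -/
theorem IsHalfLagrangian.exists_orthogonal {C : Submodule ℝ (LinSpace A n)}
    (hC : IsHalfLagrangian C) :
    ∃ L : Submodule ℝ A, L ≤ imPart A ∧ 2 * Module.finrank ℝ L = Module.finrank ℝ A ∧
      ∀ u ∈ L, ∀ c ∈ C, ∀ c' ∈ C, inner ℝ (rightMul c u) c' = 0 := by
  obtain ⟨hd, L, hL, hLd, hu⟩ := hC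
  refine ⟨L, hL, hLd, fun u hu' c hc c' hc' => ?_⟩
  rcases eq_or_ne u 0 with rfl | h0
  · rw [rightMul_zero, inner_zero_left]
  · have h1 : ‖u‖ ≠ 0 := norm_ne_zero_iff.2 h0
    have := hu (‖u‖⁻¹ • u) (L.smul_mem _ hu') (by rw [norm_smul]; simp [h1]) c hc c' hc'
    rw [rightMul_smul, inner_smul_left] at this
    simpa [h1, h0] using this

theorem imageUnder_mul (g h : twistedGroup A n) (C : Submodule ℝ (LinSpace A n)) :
    imageUnder (g * h) C = imageUnder g (imageUnder h C) := by
  ext x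
  constructor
  · rintro ⟨c, hc, rfl⟩
    exact ⟨h.1 c, ⟨c, hc, rfl⟩, rfl⟩
  · rintro ⟨_, ⟨c, hc, rfl⟩, rfl⟩
    exact ⟨c, hc, rfl⟩

theorem imageUnder_one (C : Submodule ℝ (LinSpace A n)) :
    imageUnder (1 : twistedGroup A n) C = C := Submodule.map_id C

theorem apply_mem_imageUnder {g : twistedGroup A n} {C : Submodule ℝ (LinSpace A n)}
    {x : LinSpace A n} (hx : x ∈ C) : g.1 x ∈ imageUnder g C := ⟨x, hx, rfl⟩

theorem imageUnder_inv_of_eq {g : twistedGroup A n} {C D : Submodule ℝ (LinSpace A n)}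
    (h : imageUnder g C = D) : imageUnder g⁻¹ D = C := by
  rw [← h, ← imageUnder_mul, inv_mul_cancel, imageUnder_one]

theorem imageUnder_eq_imageUnder_iff {g h : twistedGroup A n} {C : Submodule ℝ (LinSpace A n)} :
    imageUnder g C = imageUnder h C ↔ imageUnder (g⁻¹ * h) C = C := by
  rw [imageUnder_mul]
  constructor
  · intro e
    rw [← e, ← imageUnder_mul, inv_mul_cancel, imageUnder_one]
  · intro e
    conv_lhs => rw [← e]
    rw [← imageUnder_mul, mul_inv_cancel, imageUnder_one]

/-- A map between subspaces of the same dimension that sends one into the other is onto. -/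
theorem imageUnder_eq_of_le [FiniteDimensional ℝ A] {g : twistedGroup A n}
    {C D : Submodule ℝ (LinSpace A n)}
    (hd : Module.finrank ℝ D ≤ Module.finrank ℝ C) (h : ∀ x ∈ C, g.1 x ∈ D) :
    imageUnder g C = D := by
  refine Submodule.eq_of_le_of_finrank_le ?_ ?_
  · rintro _ ⟨x, hx, rfl⟩
    exact h x hx
  · exact hd.trans (LinearEquiv.finrank_map_eq g.1.toLinearEquiv C).ge

end General

/-! ### Topology -/

section Topology

variable {A : Type} [NormedAddCommGroup A] [InnerProductSpace ℝ A] [Mul A] [One A] {n : ℕ}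

/-- An element of the twisted group as a continuous linear map. -/
noncomputable def twistedCLM (g : twistedGroup A n) : LinSpace A n →L[ℝ] LinSpace A n :=
  ((g : LinSpace A n ≃ₗᵢ[ℝ] LinSpace A n).toContinuousLinearEquiv :
      LinSpace A n →L[ℝ] LinSpace A n)

theorem isInducing_twistedCLM :
    Topology.IsInducing (twistedCLM : twistedGroup A n → _) := ⟨rfl⟩

theorem twistedGroup.continuous_apply (v : LinSpace A n) :
    Continuous fun g : twistedGroup A n => g.1 v :=
  (ContinuousLinearMap.apply ℝ (LinSpace A n) v).continuous.comp
    isInducing_twistedCLM.continuous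

variable [FiniteDimensional ℝ A]

/-- In finite dimension the operator norm topology is that of pointwise convergence. -/
theorem twistedGroup.continuous_iff {X : Type*} [TopologicalSpace X] {f : X → twistedGroup A n} :
    Continuous f ↔ ∀ v, Continuous fun x => (f x).1 v := by
  rw [isInducing_twistedCLM.continuous_iff, continuous_clm_apply]
  rfl

/-- The inverse of an isometry is its adjoint, which depends continuously on it. This is what makes
the projection onto `g C` continuous in `g`. -/
theorem twistedCLM_inv (g : twistedGroup A n) :
    twistedCLM g⁻¹ = ContinuousLinearMap.adjoint (twistedCLM g) := by
  rw [ContinuousLinearMap.eq_adjoint_iff]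
  intro x y
  change inner ℝ (g.1.symm x) y = inner ℝ x (g.1 y)
  rw [← g.1.inner_map_map, LinearIsometryEquiv.apply_symm_apply]

theorem continuous_twistedCLM_inv :
    Continuous fun g : twistedGroup A n => twistedCLM g⁻¹ := by
  simp_rw [twistedCLM_inv]
  exact (ContinuousLinearMap.adjoint (𝕜 := ℝ)).continuous.comp
    isInducing_twistedCLM.continuous

theorem starProjection_imageUnder (g : twistedGroup A n) (C : Submodule ℝ (LinSpace A n)) :
    (imageUnder g C).starProjection = twistedCLM g ∘L C.starProjection ∘L twistedCLM g⁻¹ := by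
  ext1 x
  exact Submodule.starProjection_map_apply g.1 C x

theorem continuous_starProjection_imageUnder (C : Submodule ℝ (LinSpace A n)) :
    Continuous fun g : twistedGroup A n => (imageUnder g C).starProjection := by
  simp_rw [starProjection_imageUnder]
  exact isInducing_twistedCLM.continuous.clm_comp
    (continuous_const.clm_comp continuous_twistedCLM_inv)

theorem starProjection_injective :
    Function.Injective fun C : Submodule ℝ (LinSpace A n) => C.starProjection := by
  intro C D h
  have := congrArg (fun f : LinSpace A n →L[ℝ] LinSpace A n => f.range) h
  simpa using this

theorem HalfLagrangian.ext_iff {C D : HalfLagrangian A n} : C = D ↔ C.1 = D.1 :=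
  Subtype.ext_iff

instance : T2Space (HalfLagrangian A n) :=
  T2Space.of_injective_continuous (f := fun C : HalfLagrangian A n => C.1.starProjection)
    (fun _ _ h => Subtype.ext (starProjection_injective h)) continuous_induced_dom

theorem isCompact_isometries (E : Type*) [NormedAddCommGroup E] [NormedSpace ℝ E]
    [FiniteDimensional ℝ E] : IsCompact {f : E →L[ℝ] E | ∀ v, ‖f v‖ = ‖v‖} := by
  have : ProperSpace (E →L[ℝ] E) := FiniteDimensional.proper_real _
  refine (isCompact_closedBall (0 : E →L[ℝ] E) 1).of_isClosed_subset ?_ ?_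
  · simp only [Set.ofPred_forall]
    refine isClosed_iInter fun v => isClosed_eq ?_ continuous_const
    exact ((ContinuousLinearMap.apply ℝ E v).continuous).norm
  · intro f hf
    rw [mem_closedBall_zero_iff]
    exact f.opNorm_le_bound zero_le_one fun v => by rw [hf v, one_mul]

variable [IsCompositionAlgebra A]

/-- The twist is only asserted to exist, so closedness is not visible on `φ` alone. It is visible on
the set `S` of pairs (φ, θ), which is compact, and the group is the image of `S` under the first
projection. -/
instance twistedGroup.compactSpace : CompactSpace (twistedGroup A n) := by
  rw [← isCompact_univ_iff, isInducing_twistedCLM.isCompact_iff, Set.image_univ]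
  let S : Set ((LinSpace A n →L[ℝ] LinSpace A n) × (A →L[ℝ] A)) :=
    ({f | ∀ v, ‖f v‖ = ‖v‖} ×ˢ {f | ∀ v, ‖f v‖ = ‖v‖}) ∩
      ({p | p.2.det = 1} ∩ {p | ∀ v x, p.1 (rightMul v x) = rightMul (p.1 v) (p.2 x)})
  have hS : IsCompact S := by
    refine ((isCompact_isometries _).prod (isCompact_isometries _)).inter_right
      (IsClosed.inter ?_ ?_)
    · exact isClosed_eq (ContinuousLinearMap.continuous_det.comp continuous_snd) continuous_const
    · simp only [Set.ofPred_forall]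
      refine isClosed_iInter fun v => isClosed_iInter fun x => isClosed_eq ?_ ?_
      · exact (ContinuousLinearMap.apply ℝ _ _).continuous.comp continuous_fst
      · have h2 : Continuous fun q : LinSpace A n × A => rightMul q.1 q.2 :=
          ((LinearMap.toContinuousLinearMap : (A →ₗ[ℝ] LinSpace A n) ≃ₗ[ℝ] _).toLinearMap ∘ₗ
            (rightMulₗ : LinSpace A n →ₗ[ℝ] A →ₗ[ℝ] LinSpace A n)).toContinuousLinearMap.isBoundedBilinearMap.continuous
        exact h2.comp (((ContinuousLinearMap.apply ℝ _ v).continuous.comp continuous_fst).prodMk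
          ((ContinuousLinearMap.apply ℝ _ x).continuous.comp continuous_snd))
  convert hS.image continuous_fst using 1
  ext f
  constructor
  · rintro ⟨g, rfl⟩
    obtain ⟨θ, hθ, h⟩ := g.2
    exact ⟨(twistedCLM g, (θ.toContinuousLinearEquiv : A →L[ℝ] A)),
      ⟨⟨g.1.norm_map, θ.norm_map⟩, hθ, h⟩, rfl⟩
  · rintro ⟨⟨f, t⟩, ⟨⟨hf, ht⟩, hd, h⟩, rfl⟩
    let F : LinSpace A n ≃ₗᵢ[ℝ] LinSpace A n :=
      (⟨f.toLinearMap, hf⟩ : LinSpace A n →ₗᵢ[ℝ] LinSpace A n).toLinearIsometryEquiv rfl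
    let T : A ≃ₗᵢ[ℝ] A := (⟨t.toLinearMap, ht⟩ : A →ₗᵢ[ℝ] A).toLinearIsometryEquiv rfl
    exact ⟨⟨F, T, hd, h⟩, rfl⟩

/-- The orbit map of a compact group onto a Hausdorff space induces a homeomorphism. -/
theorem exists_quotient_homeomorph {G X : Type*} [Group G] [TopologicalSpace G] [CompactSpace G]
    [TopologicalSpace X] [T2Space X] (K : Subgroup G) (f : G → X) (hf : Continuous f)
    (hs : Function.Surjective f) (hK : ∀ g h, f g = f h ↔ g⁻¹ * h ∈ K) :
    ∃ e : (G ⧸ K) ≃ₜ X, ∀ g : G, e (g : G ⧸ K) = f g := by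
  let F : G ⧸ K → X := Quotient.lift f fun a b hab =>
    (hK a b).2 (QuotientGroup.leftRel_apply.1 hab)
  have hF : Function.Bijective F := by
    constructor
    · intro a b
      induction a using QuotientGroup.induction_on
      induction b using QuotientGroup.induction_on
      intro h
      exact QuotientGroup.eq.2 ((hK _ _).1 h)
    · intro x
      obtain ⟨g, rfl⟩ := hs x
      exact ⟨g, rfl⟩
  have hc : Continuous (Equiv.ofBijective F hF) := hf.quotient_lift _
  have : CompactSpace (G ⧸ K) := Quotient.compactSpace
  -- A continuous bijection from a compact space to a Hausdorff space is a homeomorphism.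
  exact ⟨hc.homeoOfEquivCompactToT2, fun g => rfl⟩

/-- Reduces each of the three cases to three algebraic facts: the base point is Lagrangian, its
orbit is everything, and its stabilizer is `K`. -/
theorem isHomogeneousSpace_of_stabilizer (hn : 1 ≤ n) {K : Subgroup (twistedGroup A n)}
    {C₀ : Submodule ℝ (LinSpace A n)} (h₀ : IsHalfLagrangian C₀)
    (ht : ∀ C, IsHalfLagrangian C → ∃ g : twistedGroup A n, imageUnder g C₀ = C)
    (hK : ∀ g, imageUnder g C₀ = C₀ ↔ g ∈ K) : IsHomogeneousSpace K C₀ := by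
  refine ⟨fun g C hC => hC.imageUnder hn g, fun C C' hC hC' => ?_, ?_⟩
  · obtain ⟨g, hg⟩ := ht C hC
    obtain ⟨g', hg'⟩ := ht C' hC'
    refine ⟨g' * g⁻¹, ?_⟩
    rw [imageUnder_mul, imageUnder_inv_of_eq hg, hg']
  · obtain ⟨e, he⟩ := exists_quotient_homeomorph (X := HalfLagrangian A n) K
      (fun g => (⟨imageUnder g C₀, h₀.imageUnder hn g⟩ : HalfLagrangian A n))
      (continuous_induced_rng (f := fun C : HalfLagrangian A n => C.1.starProjection).2
        (continuous_starProjection_imageUnder C₀))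
      (fun C => (ht C.1 C.2).imp fun g hg => Subtype.ext hg)
      (fun g h => by
        rw [← hK, ← imageUnder_eq_imageUnder_iff]
        exact HalfLagrangian.ext_iff)
    exact ⟨e, fun g => by rw [he]⟩

end Topology

/-! ### Associative composition algebras: unitary matrices -/

section Star

open Matrix

/-- A composition algebra that is an associative star ring with `⟨x, y⟩ = Re (x* y)`. -/
class IsStarCompositionAlgebra (F : Type) [NormedRing F] [InnerProductSpace ℝ F]
    [StarRing F] : Prop extends IsCompositionAlgebra F where
  inner_eq : ∀ x y : F, inner ℝ x y = inner ℝ 1 (star x * y)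

instance : IsStarCompositionAlgebra ℂ where
  mul_add := mul_add
  add_mul := add_mul
  mul_smul c x y := mul_smul_comm c x y
  smul_mul c x y := smul_mul_assoc c x y
  mul_one := mul_one
  norm_mul := norm_mul
  norm_one := norm_one
  inner_eq x y := by simp [Complex.inner]; ring

instance : IsStarCompositionAlgebra ℍ[ℝ] where
  mul_add := mul_add
  add_mul := add_mul
  mul_smul c x y := mul_smul_comm c x y
  smul_mul c x y := smul_mul_assoc c x y
  mul_one := mul_one
  norm_mul := norm_mul
  norm_one := norm_one
  inner_eq x y := by simp [Quaternion.inner_def]; ring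

variable {F : Type} [NormedRing F] [InnerProductSpace ℝ F] [StarRing F]
  [IsStarCompositionAlgebra F] {n : ℕ}

/-- The sesquilinear product `∑ k, v k* w k`. -/
def herm (v w : LinSpace F n) : F := star v.ofLp ⬝ᵥ w.ofLp

theorem herm_def (v w : LinSpace F n) : herm v w = ∑ k, star (v k) * w k := rfl

theorem herm_rightMul_right (v w : LinSpace F n) (x : F) :
    herm v (rightMul w x) = herm v w * x := by
  simp [herm_def, Finset.sum_mul, mul_assoc]

theorem star_herm (v w : LinSpace F n) : star (herm v w) = herm w v := by
  simp [herm_def, star_sum, star_mul]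

theorem herm_rightMul_left (v w : LinSpace F n) (x : F) :
    herm (rightMul v x) w = star x * herm v w := by
  rw [← star_herm, herm_rightMul_right, star_mul, star_herm]

theorem inner_eq_inner_one_herm (v w : LinSpace F n) :
    inner ℝ v w = inner ℝ (1 : F) (herm v w) := by
  rw [herm_def, inner_sum, PiLp.inner_apply]
  exact Finset.sum_congr rfl fun k _ => IsStarCompositionAlgebra.inner_eq _ _

theorem inner_rightMul_eq (v w : LinSpace F n) (x : F) :
    inner ℝ v (rightMul w x) = inner ℝ (star (herm v w)) x := by
  rw [inner_eq_inner_one_herm, herm_rightMul_right, IsStarCompositionAlgebra.inner_eq (star _),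
    star_star]

/-- The sesquilinear product is determined by the real inner product. -/
theorem herm_eq_of_inner {v w v' w' : LinSpace F n}
    (h : ∀ x : F, inner ℝ v (rightMul w x) = inner ℝ v' (rightMul w' x)) :
    herm v w = herm v' w' := by
  refine star_injective (ext_inner_right ℝ fun x => ?_)
  rw [← inner_rightMul_eq, h, inner_rightMul_eq]

/-- Multiplication of column vectors by a unitary matrix. -/
noncomputable def unitaryHom :
    unitary (Matrix (Fin n) (Fin n) F) →* (LinSpace F n ≃ₗᵢ[ℝ] LinSpace F n) where
  toFun M :=
    { toFun := fun v => WithLp.toLp 2 (M.1 *ᵥ v.ofLp)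
      invFun := fun v => WithLp.toLp 2 (star M.1 *ᵥ v.ofLp)
      map_add' := fun v w => by ext k; simp [mulVec_add]
      map_smul' := fun c v => by
        ext k
        simp [mulVec, dotProduct, Finset.smul_sum, IsCompositionAlgebra.mul_smul]
      left_inv := fun v => by simp [mulVec_mulVec]
      right_inv := fun v => by simp [mulVec_mulVec]
      norm_map' := fun v => by
        change ‖WithLp.toLp 2 (M.1 *ᵥ v.ofLp)‖ = ‖v‖
        rw [← sq_eq_sq₀ (norm_nonneg _) (norm_nonneg _), ← real_inner_self_eq_norm_sq,
          ← real_inner_self_eq_norm_sq, inner_eq_inner_one_herm, inner_eq_inner_one_herm v]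
        congr 1
        simp only [herm]
        rw [star_mulVec, dotProduct_mulVec, vecMul_vecMul, ← star_eq_conjTranspose,
          Unitary.coe_star_mul_self, vecMul_one] }
  map_one' := by ext v k; simp
  map_mul' M N := by
    ext v k
    exact congrFun (mulVec_mulVec v.ofLp M.1 N.1).symm k

theorem unitaryHom_apply (M : unitary (Matrix (Fin n) (Fin n) F)) (v : LinSpace F n) (k : Fin n) :
    unitaryHom M v k = ∑ l, M.1 k l * v l := rfl

theorem unitaryHom_rightMul (M : unitary (Matrix (Fin n) (Fin n) F)) (v : LinSpace F n) (x : F) :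
    unitaryHom M (rightMul v x) = rightMul (unitaryHom M v) x := by
  ext k
  simp [unitaryHom_apply, Finset.sum_mul, mul_assoc]

/-- The standard basis vector of `Fⁿ`. -/
noncomputable def stdVec (F : Type) [NormedRing F] {n : ℕ} (l : Fin n) : LinSpace F n :=
  WithLp.toLp 2 (Pi.single l 1)

theorem stdVec_apply (l k : Fin n) : stdVec F l k = if k = l then 1 else 0 :=
  Pi.single_apply _ _ _

theorem unitaryHom_stdVec (M : unitary (Matrix (Fin n) (Fin n) F)) (k l : Fin n) :
    unitaryHom M (stdVec F l) k = M.1 k l := by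
  simp [unitaryHom_apply, stdVec_apply]

theorem sum_rightMul_stdVec (v : LinSpace F n) : ∑ l, rightMul (stdVec F l) (v l) = v := by
  ext k
  simp [stdVec_apply, WithLp.ofLp_sum]

theorem herm_stdVec (k l : Fin n) : herm (stdVec F k) (stdVec F l) = if k = l then 1 else 0 := by
  rw [herm_def, Finset.sum_eq_single k (by simp +contextual [stdVec_apply]) (by simp)]
  simp [stdVec_apply]

theorem unitaryHom_injective :
    Function.Injective (unitaryHom : unitary (Matrix (Fin n) (Fin n) F) → _) := by
  intro M N h
  refine Subtype.ext (Matrix.ext fun k l => ?_)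
  rw [← unitaryHom_stdVec M, ← unitaryHom_stdVec N, h]

variable [IsStablyFiniteRing F]

/-- An orthonormal family is the image of the standard basis under a unitary matrix. -/
theorem exists_unitaryHom_stdVec {c : Fin n → LinSpace F n}
    (hc : ∀ k l, herm (c k) (c l) = if k = l then 1 else 0) :
    ∃ M : unitary (Matrix (Fin n) (Fin n) F), ∀ l, unitaryHom M (stdVec F l) = c l := by
  let M : Matrix (Fin n) (Fin n) F := Matrix.of fun k l => c l k
  have h1 : star M * M = 1 := by
    ext k l
    rw [Matrix.one_apply, ← hc k l, Matrix.mul_apply, herm_def]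
    rfl
  -- Orthonormal columns only give a left inverse; stable finiteness of the ring makes it two-sided.
  refine ⟨⟨M, Unitary.mem_iff.2 ⟨h1, mul_eq_one_comm.1 h1⟩⟩, fun l => ?_⟩
  ext k
  rw [unitaryHom_stdVec]
  rfl

/-- A real isometry that commutes with right multiplication is given by a unitary matrix. -/
theorem exists_unitaryHom_eq {φ : LinSpace F n ≃ₗᵢ[ℝ] LinSpace F n}
    (h : ∀ v x, φ (rightMul v x) = rightMul (φ v) x) :
    ∃ M : unitary (Matrix (Fin n) (Fin n) F), unitaryHom M = φ := by
  -- The columns of the matrix are the images of the standard basis. They are orthonormal for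
  -- `herm`, since `herm` is recovered from the real inner product and right multiplication, both of
  -- which `φ` respects.
  obtain ⟨M, hM⟩ := exists_unitaryHom_stdVec (c := fun l => φ (stdVec F l)) fun k l => by
    rw [← herm_stdVec]
    refine herm_eq_of_inner fun x => ?_
    rw [← h, LinearIsometryEquiv.inner_map_map]
  refine ⟨M, LinearIsometryEquiv.ext fun v => ?_⟩
  rw [← sum_rightMul_stdVec v, map_sum, map_sum]
  refine Finset.sum_congr rfl fun l _ => ?_
  rw [unitaryHom_rightMul, hM, h]

theorem continuous_unitaryHom_apply {X : Type*} [TopologicalSpace X]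
    {f : X → unitary (Matrix (Fin n) (Fin n) F)} (hf : ∀ k l, Continuous fun x => (f x).1 k l)
    (v : LinSpace F n) : Continuous fun x => unitaryHom (f x) v := by
  refine (PiLp.continuous_toLp 2 _).comp (continuous_pi fun k => ?_)
  change Continuous fun x => ∑ l, (f x).1 k l * v l
  exact continuous_finsetSum _ fun l _ => (hf k l).mul continuous_const

end Star

/-! ### The complex case -/

section ComplexCase

open Matrix

variable {n : ℕ}

/-- The only other isometry of the plane fixing 1 is conjugation, of determinant -1. -/
theorem complex_isometry_eq_refl {θ : ℂ ≃ₗᵢ[ℝ] ℂ} (h1 : θ 1 = 1)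
    (hd : LinearMap.det (θ.toLinearEquiv : ℂ →ₗ[ℝ] ℂ) = 1) : θ = LinearIsometryEquiv.refl ℝ ℂ := by
  refine (linear_isometry_complex_aux h1).resolve_right fun h => ?_
  have h2 : LinearMap.det (θ.toLinearEquiv : ℂ →ₗ[ℝ] ℂ) = -1 := by
    rw [h]
    exact Complex.det_conjAe
  linarith

theorem unitaryHom_mem_twistedGroup (M : Matrix.unitaryGroup (Fin n) ℂ) :
    unitaryHom M ∈ twistedGroup ℂ n :=
  ⟨LinearIsometryEquiv.refl ℝ ℂ, LinearMap.det_id, unitaryHom_rightMul M⟩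

theorem twistedGroup_complex_rightMul (hn : 1 ≤ n) (g : twistedGroup ℂ n) (v : LinSpace ℂ n)
    (x : ℂ) : g.1 (rightMul v x) = rightMul (g.1 v) x := by
  obtain ⟨θ, hd, h⟩ := g.2
  rw [h, complex_isometry_eq_refl (twist_one hn h) hd]
  rfl

/-- `U(n)` is the group of twisted isomorphisms of `ℂⁿ`. -/
noncomputable def unitaryEquiv (hn : 1 ≤ n) :
    Matrix.unitaryGroup (Fin n) ℂ ≃ₜ* twistedGroup ℂ n :=
  let E : Matrix.unitaryGroup (Fin n) ℂ ≃* twistedGroup ℂ n :=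
    MulEquiv.ofBijective (unitaryHom.codRestrict _ unitaryHom_mem_twistedGroup)
      ⟨fun M N h => unitaryHom_injective (congrArg Subtype.val h), fun g => by
        obtain ⟨M, hM⟩ := exists_unitaryHom_eq (twistedGroup_complex_rightMul hn g)
        exact ⟨M, Subtype.ext hM⟩⟩
  { E with
    continuous_toFun := twistedGroup.continuous_iff.2 fun v =>
      continuous_unitaryHom_apply (X := Matrix.unitaryGroup (Fin n) ℂ) (f := fun M => M)
        (fun k l => (continuous_apply_apply k l).comp continuous_subtype_val) v
    continuous_invFun := by
      refine continuous_induced_rng.2 (continuous_pi fun k => continuous_pi fun l => ?_)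
      -- The inverse is continuous because each matrix entry is a coordinate of the image of a basis
      -- vector.
      have h : ∀ g : twistedGroup ℂ n, (E.symm g).1 k l = g.1 (stdVec ℂ l) k := fun g => by
        rw [← unitaryHom_stdVec]
        conv_rhs => rw [← E.apply_symm_apply g]
        rfl
      change Continuous fun g => (E.symm g).1 k l
      simp_rw [h]
      exact (PiLp.continuous_apply 2 _ k).comp (twistedGroup.continuous_apply _) }

theorem unitaryEquiv_val (hn : 1 ≤ n) (M : Matrix.unitaryGroup (Fin n) ℂ) :
    (unitaryEquiv hn M).1 = unitaryHom M := rfl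

theorem stdVec_mem_realSubspace (l : Fin n) : stdVec ℂ l ∈ realSubspace n := by
  intro k
  rw [stdVec_apply]
  split_ifs <;> simp

/-- The coordinates of `ℝⁿ ⊂ ℂⁿ`. -/
noncomputable def realSubspaceEquiv (n : ℕ) : realSubspace n ≃ₗ[ℝ] (Fin n → ℝ) where
  toFun v i := (v.1 i).re
  map_add' v w := rfl
  map_smul' c v := by ext i; simp
  invFun x := ⟨WithLp.toLp 2 fun i => (x i : ℂ), fun i => Complex.ofReal_im _⟩
  left_inv v := by
    refine Subtype.ext (PiLp.ext fun i => Complex.ext rfl ?_)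
    exact (v.2 i).symm
  right_inv x := rfl

theorem finrank_realSubspace : Module.finrank ℝ (realSubspace n) = n := by
  rw [(realSubspaceEquiv n).finrank_eq]
  simp

theorem finrank_linSpace_complex : Module.finrank ℝ (LinSpace ℂ n) = 2 * n := by
  rw [(WithLp.linearEquiv 2 ℝ (Fin n → ℂ)).finrank_eq]
  simp [Module.finrank_pi_fintype, mul_comm]

theorem isHalfLagrangian_realSubspace : IsHalfLagrangian (realSubspace n) := by
  refine ⟨by rw [finrank_realSubspace, finrank_linSpace_complex], ℝ ∙ Complex.I, ?_, ?_, ?_⟩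
  · rw [Submodule.span_singleton_le_iff_mem, mem_imPart]
    simp [Complex.inner]
  · rw [finrank_span_singleton Complex.I_ne_zero]
    simp
  · intro u hu _ c hc c' hc'
    obtain ⟨t, rfl⟩ := Submodule.mem_span_singleton.1 hu
    rw [PiLp.inner_apply]
    refine Finset.sum_eq_zero fun i _ => ?_
    simp [Complex.inner, hc i, hc' i]

/-- A Lagrangian subspace of `ℂⁿ` has an orthonormal basis for the hermitian product. -/
theorem IsHalfLagrangian.exists_herm_basis {C : Submodule ℝ (LinSpace ℂ n)}
    (hC : IsHalfLagrangian C) :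
    ∃ c : Fin n → LinSpace ℂ n, (∀ k, c k ∈ C) ∧
      ∀ k l, herm (c k) (c l) = if k = l then 1 else 0 := by
  obtain ⟨L, hL, hLd, hu⟩ := hC.exists_orthogonal
  -- `Im ℂ` is a line, so the nonzero subspace `L` is all of it.
  have hI : Complex.I ∈ L := by
    have hne : L ≠ ⊥ := by
      rintro rfl
      simp at hLd
    obtain ⟨u, hu', hu0⟩ := Submodule.exists_mem_ne_zero_of_ne_bot hne
    have hre : u.re = 0 := by simpa [Complex.inner] using mem_imPart.1 (hL hu')
    have him : u.im ≠ 0 := fun h => hu0 (Complex.ext hre h)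
    have := L.smul_mem u.im⁻¹ hu'
    convert this using 1
    apply Complex.ext <;> simp [hre, him]
  have hd : Module.finrank ℝ C = n := by
    have := hC.1
    rw [finrank_linSpace_complex] at this
    omega
  let b := (stdOrthonormalBasis ℝ C).reindex (finCongr hd)
  refine ⟨fun k => b k, fun k => (b k).2, fun k l => Complex.ext ?_ ?_⟩
  · have h1 := orthonormal_iff_ite.1 b.orthonormal k l
    rw [Submodule.coe_inner, inner_eq_inner_one_herm] at h1
    simp only [Complex.inner, map_one, mul_one] at h1
    refine h1.trans ?_
    split_ifs <;> simp
  · have h1 := hu _ hI _ (b k).2 _ (b l).2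
    rw [inner_eq_inner_one_herm, herm_rightMul_left] at h1
    have h2 : (herm (b k : LinSpace ℂ n) (b l)).im = 0 := by
      simpa [Complex.inner] using h1
    refine h2.trans ?_
    split_ifs <;> simp

theorem exists_imageUnder_realSubspace (hn : 1 ≤ n) {C : Submodule ℝ (LinSpace ℂ n)}
    (hC : IsHalfLagrangian C) : ∃ g : twistedGroup ℂ n, imageUnder g (realSubspace n) = C := by
  obtain ⟨c, hc, ho⟩ := hC.exists_herm_basis
  obtain ⟨M, hM⟩ := exists_unitaryHom_stdVec ho
  refine ⟨unitaryEquiv hn M, imageUnder_eq_of_le ?_ fun x hx => ?_⟩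
  · have := hC.1
    rw [finrank_linSpace_complex] at this
    rw [finrank_realSubspace]
    omega
  · rw [unitaryEquiv_val, ← sum_rightMul_stdVec x, map_sum]
    refine sum_mem fun l _ => ?_
    have : x l = (x l).re • (1 : ℂ) := by
      apply Complex.ext <;> simp [hx l]
    rw [this, rightMul_smul, rightMul_one, map_smul, hM]
    exact C.smul_mem _ (hc l)

theorem imageUnder_realSubspace_eq_iff (hn : 1 ≤ n) (M : Matrix.unitaryGroup (Fin n) ℂ) :
    imageUnder (unitaryEquiv hn M) (realSubspace n) = realSubspace n ↔
      M ∈ orthogonalInUnitary n := by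
  constructor
  · intro h k l
    have h1 : unitaryHom M (stdVec ℂ l) ∈ realSubspace n := by
      rw [← h]
      exact apply_mem_imageUnder (stdVec_mem_realSubspace l)
    simpa only [unitaryHom_stdVec] using h1 k
  · intro h
    refine imageUnder_eq_of_le le_rfl fun x hx k => ?_
    rw [unitaryEquiv_val, unitaryHom_apply, Complex.im_sum]
    exact Finset.sum_eq_zero fun l _ => by simp [Complex.mul_im, h k l, hx l]

theorem mem_map_unitaryEquiv (hn : 1 ≤ n) {K : Subgroup (Matrix.unitaryGroup (Fin n) ℂ)}
    {M : Matrix.unitaryGroup (Fin n) ℂ} :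
    unitaryEquiv hn M ∈ K.map (unitaryEquiv hn).toMonoidHom ↔ M ∈ K :=
  ⟨fun ⟨_, hN, h⟩ => (unitaryEquiv hn).injective h ▸ hN, fun h => ⟨M, h, rfl⟩⟩

theorem isHomogeneousSpace_complex (hn : 1 ≤ n) :
    IsHomogeneousSpace ((orthogonalInUnitary n).map (unitaryEquiv hn).toMonoidHom)
      (realSubspace n) := by
  refine isHomogeneousSpace_of_stabilizer hn isHalfLagrangian_realSubspace
    (fun C hC => exists_imageUnder_realSubspace hn hC) fun g => ?_
  obtain ⟨M, rfl⟩ := (unitaryEquiv hn).surjective g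
  rw [imageUnder_realSubspace_eq_iff, mem_map_unitaryEquiv]

/-! ### Orientations -/

/-- The real matrix underlying an element of `O(n)`. -/
def realMatrix (M : Matrix.unitaryGroup (Fin n) ℂ) : Matrix (Fin n) (Fin n) ℝ :=
  Matrix.of fun k l => (M.1 k l).re

theorem det_eq_det_realMatrix {M : Matrix.unitaryGroup (Fin n) ℂ} (hM : M ∈ orthogonalInUnitary n) :
    M.1.det = ((realMatrix M).det : ℂ) := by
  have h : M.1 = Complex.ofRealHom.mapMatrix (realMatrix M) := by
    ext k l
    exact Complex.ext rfl (hM k l)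
  rw [h, ← RingHom.map_det]
  rfl

theorem det_realMatrix {M : Matrix.unitaryGroup (Fin n) ℂ} (hM : M ∈ orthogonalInUnitary n) :
    (realMatrix M).det = 1 ∨ (realMatrix M).det = -1 := by
  have h : star M.1.det * M.1.det = 1 := by
    rw [← Matrix.det_conjTranspose, ← Matrix.det_mul, ← Matrix.star_eq_conjTranspose,
      Unitary.coe_star_mul_self, Matrix.det_one]
  rw [det_eq_det_realMatrix hM] at h
  have h2 : (realMatrix M).det * (realMatrix M).det = 1 := by
    have := congrArg Complex.re h
    simpa using this
  exact mul_self_eq_one_iff.1 h2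

theorem mem_specialOrthogonal_iff {M : Matrix.unitaryGroup (Fin n) ℂ}
    (hM : M ∈ orthogonalInUnitary n) :
    M ∈ specialOrthogonalInUnitary n ↔ (realMatrix M).det = 1 := by
  change _ ∧ M.1.det = 1 ↔ _
  rw [det_eq_det_realMatrix hM, Complex.ofReal_eq_one]
  exact and_iff_right hM

theorem det_realMatrix_mul {M N : Matrix.unitaryGroup (Fin n) ℂ} (hM : M ∈ orthogonalInUnitary n)
    (hN : N ∈ orthogonalInUnitary n) :
    (realMatrix (M * N)).det = (realMatrix M).det * (realMatrix N).det := by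
  have h := det_eq_det_realMatrix (mul_mem hM hN)
  rw [Submonoid.coe_mul, Matrix.det_mul, det_eq_det_realMatrix hM, det_eq_det_realMatrix hN] at h
  exact_mod_cast h.symm

/-- A change of sign in one coordinate; it represents the nontrivial coset of SO(n) in O(n) and
reverses orientations. -/
theorem exists_det_eq_neg_one (hn : 1 ≤ n) :
    ∃ D ∈ orthogonalInUnitary n, (realMatrix D).det = -1 := by
  let d : Fin n → ℂ := fun i => if i = ⟨0, hn⟩ then -1 else 1
  have hd : ∀ i, star (d i) * d i = 1 := fun i => by
    simp only [d]
    split_ifs <;> simp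
  have h1 : star (Matrix.diagonal d) * Matrix.diagonal d = 1 := by
    rw [Matrix.star_eq_conjTranspose, Matrix.diagonal_conjTranspose, Matrix.diagonal_mul_diagonal,
      ← Matrix.diagonal_one]
    exact congrArg _ (funext hd)
  let D : Matrix.unitaryGroup (Fin n) ℂ :=
    ⟨Matrix.diagonal d, Unitary.mem_iff.2 ⟨h1, mul_eq_one_comm.1 h1⟩⟩
  have hD : D ∈ orthogonalInUnitary n := by
    intro i j
    change (Matrix.diagonal d i j).im = 0
    rw [Matrix.diagonal_apply]
    simp only [d]
    split_ifs <;> simp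
  refine ⟨D, hD, ?_⟩
  have h := det_eq_det_realMatrix hD
  have h2 : D.1.det = -1 := by
    change (Matrix.diagonal d).det = -1
    rw [Matrix.det_diagonal]
    simp [d]
  rw [h2] at h
  exact_mod_cast h.symm

theorem relIndex_specialOrthogonal (hn : 1 ≤ n) :
    (specialOrthogonalInUnitary n).relIndex (orthogonalInUnitary n) = 2 := by
  rw [Subgroup.relIndex_eq_two_iff]
  obtain ⟨D, hD, hd⟩ := exists_det_eq_neg_one hn
  refine ⟨D, hD, fun M hM => ?_⟩
  rw [mem_specialOrthogonal_iff hM, mem_specialOrthogonal_iff (mul_mem hM hD),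
    det_realMatrix_mul hM hD, hd]
  rcases det_realMatrix hM with h | h <;> rw [h] <;> norm_num [Xor]

end ComplexCase

/-! ### Oriented Lagrangian subspaces as the quotient U(n)/SO(n). -/

section OrientedCase

open Matrix

variable {n : ℕ}

theorem OrientedLagrangian.form_apply (X : OrientedLagrangian n)
    [Fact (Module.finrank ℝ X.C = n)] (w : Fin n → LinSpace ℂ n) :
    X.form w = X.o.volumeForm fun i => X.C.orthogonalProjectionOnto (w i) := rfl

/-- An orthonormal basis adapted to `o` has volume 1 for `o` and -1 for any other orientation. -/
theorem Orientation.volumeForm_injective {E : Type*} [NormedAddCommGroup E]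
    [InnerProductSpace ℝ E] [Fact (Module.finrank ℝ E = n)] (hn : 0 < n) :
    Function.Injective fun o : Orientation ℝ E (Fin n) => o.volumeForm := by
  intro o o' h
  by_contra hne
  let b := o.finOrthonormalBasis hn Fact.out
  have hb : b.toBasis.orientation = o := Orientation.finOrthonormalBasis_orientation hn _ o
  have h1 := o.volumeForm_robust b hb
  have h2 := o'.volumeForm_robust_neg b (by rwa [hb])
  have h3 : b.toBasis.det = -b.toBasis.det := by rw [← h2, ← h1]; exact h
  have h4 := congrArg (fun f => f b.toBasis) h3
  simp only [AlternatingMap.neg_apply, Module.Basis.det_self] at h4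
  norm_num at h4

/-- On vectors of the subspace the projection does nothing, so the extended form restricts to the
volume form, which determines the orientation. This gives the Hausdorff property of the space of
oriented subspaces. -/
theorem OrientedLagrangian.ext_of_form (hn : 1 ≤ n) {X Y : OrientedLagrangian n}
    (hC : X.C = Y.C) (hf : X.form = Y.form) : X = Y := by
  obtain ⟨C, hX, o⟩ := X
  obtain ⟨D, hY, o'⟩ := Y
  obtain rfl : C = D := hC
  have : Fact (Module.finrank ℝ C = n) := ⟨OrientedLagrangian.finrank_eq ⟨C, hX, o⟩⟩
  have : o = o' := by
    refine Orientation.volumeForm_injective (E := C) hn (AlternatingMap.ext fun v => ?_)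
    have h := congrFun hf fun i => (v i : LinSpace ℂ n)
    have h1 : ∀ i, C.orthogonalProjectionOnto (v i : LinSpace ℂ n) = v i := fun i =>
      Submodule.orthogonalProjectionOnto_mem_subspace_eq_self _
    rw [OrientedLagrangian.form_apply, OrientedLagrangian.form_apply] at h
    simpa only [h1] using h
  rw [this]

theorem OrientedLagrangian.form_neg {C : Submodule ℝ (LinSpace ℂ n)} (hC : IsHalfLagrangian C)
    (o : Orientation ℝ C (Fin n)) :
    OrientedLagrangian.form ⟨C, hC, -o⟩ = -OrientedLagrangian.form ⟨C, hC, o⟩ := by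
  have : Fact (Module.finrank ℝ C = n) := ⟨OrientedLagrangian.finrank_eq ⟨C, hC, o⟩⟩
  have h := Orientation.volumeForm_neg_orientation (E := C) o
  ext w
  exact congrArg (fun f => f fun i => C.orthogonalProjectionOnto (w i)) h

theorem OrientedLagrangian.t2Space (hn : 1 ≤ n) : T2Space (OrientedLagrangian n) :=
  T2Space.of_injective_continuous
    (f := fun X : OrientedLagrangian n => (X.C.starProjection, X.form))
    (fun _ _ h => OrientedLagrangian.ext_of_form hn
      (starProjection_injective (congrArg Prod.fst h)) (congrArg Prod.snd h))
    continuous_induced_dom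

instance fact_finrank_realSubspace : Fact (Module.finrank ℝ (realSubspace n) = n) :=
  ⟨finrank_realSubspace⟩

/-- The isometry from `C` onto `g C` induced by `g`. -/
noncomputable def restrictImage (g : twistedGroup ℂ n) (C : Submodule ℝ (LinSpace ℂ n)) :
    C ≃ₗᵢ[ℝ] imageUnder g C :=
  LinearIsometryEquiv.submoduleMap C g.1

theorem restrictImage_apply (g : twistedGroup ℂ n) (C : Submodule ℝ (LinSpace ℂ n)) (x : C) :
    (restrictImage g C x : LinSpace ℂ n) = g.1 x := rfl

theorem restrictImage_symm_projection (g : twistedGroup ℂ n) (C : Submodule ℝ (LinSpace ℂ n))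
    (w : LinSpace ℂ n) :
    (restrictImage g C).symm ((imageUnder g C).orthogonalProjectionOnto w) =
      C.orthogonalProjectionOnto (g⁻¹.1 w) := by
  rw [LinearIsometryEquiv.symm_apply_eq]
  refine Subtype.ext ?_
  rw [restrictImage_apply, Submodule.coe_orthogonalProjectionOnto_apply,
    Submodule.coe_orthogonalProjectionOnto_apply, starProjection_imageUnder]
  rfl

/-- The oriented Lagrangian subspace `g (ℝⁿ, o)`. -/
noncomputable def orientedImage (hn : 1 ≤ n) (o : Orientation ℝ (realSubspace n) (Fin n))
    (g : twistedGroup ℂ n) : OrientedLagrangian n where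
  C := imageUnder g (realSubspace n)
  lagrangian := isHalfLagrangian_realSubspace.imageUnder hn g
  o := Orientation.map (Fin n) (restrictImage g (realSubspace n)).toLinearEquiv o

theorem form_orientedImage (hn : 1 ≤ n) (o : Orientation ℝ (realSubspace n) (Fin n))
    (g : twistedGroup ℂ n) (w : Fin n → LinSpace ℂ n) :
    (orientedImage hn o g).form w =
      o.volumeForm fun i => (realSubspace n).orthogonalProjectionOnto (g⁻¹.1 (w i)) := by
  have : Fact (Module.finrank ℝ (orientedImage hn o g).C = n) := ⟨OrientedLagrangian.finrank_eq _⟩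
  have : Fact (Module.finrank ℝ (imageUnder g (realSubspace n)) = n) := this
  have h := Orientation.volumeForm_map (E := realSubspace n) (F := imageUnder g (realSubspace n)) o
    (restrictImage g (realSubspace n))
    fun i => (imageUnder g (realSubspace n)).orthogonalProjectionOnto (w i)
  have h2 : (fun i => (realSubspace n).orthogonalProjectionOnto (g⁻¹.1 (w i))) =
      (restrictImage g (realSubspace n)).symm ∘
        fun i => (imageUnder g (realSubspace n)).orthogonalProjectionOnto (w i) :=
    funext fun i => (restrictImage_symm_projection _ _ _).symm
  rw [h2]
  exact h

theorem continuous_orientedImage (hn : 1 ≤ n) (o : Orientation ℝ (realSubspace n) (Fin n)) :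
    Continuous (orientedImage hn o) := by
  refine continuous_induced_rng.2 ?_
  refine (continuous_starProjection_imageUnder (realSubspace n)).prodMk
    (continuous_pi fun w => ?_)
  simp_rw [form_orientedImage]
  have h : Continuous fun m : Fin n → realSubspace n =>
      Orientation.volumeForm (E := realSubspace n) o m :=
    -- Hadamard's inequality bounds the volume form by the product of the norms, which makes it
    -- continuous.
    (AlternatingMap.mkContinuous (E := realSubspace n)
      (Orientation.volumeForm (E := realSubspace n) o) 1 fun m => by
        rw [one_mul]
        exact Orientation.abs_volumeForm_apply_le (E := realSubspace n) o m).coe_continuous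
  refine h.comp (continuous_pi fun i => ?_)
  exact (ContinuousLinearMap.continuous _).comp
    ((ContinuousLinearMap.apply ℝ _ (w i)).continuous.comp continuous_twistedCLM_inv)

/-- The volume form of `ℝⁿ` is multiplied by the determinant under a real matrix. -/
theorem volumeForm_orthogonal (o : Orientation ℝ (realSubspace n) (Fin n))
    {M : Matrix.unitaryGroup (Fin n) ℂ} (hM : M ∈ orthogonalInUnitary n)
    {x y : Fin n → realSubspace n} (h : ∀ i, (y i : LinSpace ℂ n) = unitaryHom M (x i)) :
    o.volumeForm y = (realMatrix M).det * o.volumeForm x := by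
  let b : Module.Basis (Fin n) ℝ (realSubspace n) := .ofEquivFun (realSubspaceEquiv n)
  -- Alternating forms of top degree are multiples of the determinant in the standard basis, so the
  -- value of `c` is irrelevant to the ratio.
  obtain ⟨c, hc⟩ : ∃ c : ℝ, Orientation.volumeForm (E := realSubspace n) o = c • b.det :=
    ⟨_, AlternatingMap.eq_smul_basis_det b (Orientation.volumeForm (E := realSubspace n) o)⟩
  rw [hc, AlternatingMap.smul_apply,
    AlternatingMap.smul_apply, Module.Basis.det_apply, Module.Basis.det_apply]
  have h1 : b.toMatrix y = realMatrix M * b.toMatrix x := by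
    ext k i
    have hb : ∀ z : Fin n → realSubspace n, ∀ k i, b.toMatrix z k i = ((z i).1 k).re :=
      fun z k i => rfl
    rw [Matrix.mul_apply, hb, h, unitaryHom_apply, Complex.re_sum]
    refine Finset.sum_congr rfl fun l _ => ?_
    rw [hb, Complex.mul_re, (hM k l : _ = (0 : ℝ)), zero_mul, sub_zero]
    rfl
  rw [h1, Matrix.det_mul, smul_eq_mul, smul_eq_mul]
  ring

/-- An isometry preserving ℝⁿ commutes with the orthogonal projection onto it. -/
theorem projection_unitaryHom {M : Matrix.unitaryGroup (Fin n) ℂ}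
    (hn : 1 ≤ n) (hM : M ∈ orthogonalInUnitary n) (w : LinSpace ℂ n) :
    ((realSubspace n).orthogonalProjectionOnto (unitaryHom M w) : LinSpace ℂ n) =
      unitaryHom M ((realSubspace n).orthogonalProjectionOnto w) := by
  have h := (imageUnder_realSubspace_eq_iff hn M).2 hM
  have h2 := starProjection_imageUnder (unitaryEquiv hn M) (realSubspace n)
  rw [h] at h2
  rw [Submodule.coe_orthogonalProjectionOnto_apply, Submodule.coe_orthogonalProjectionOnto_apply]
  conv_lhs => rw [h2]
  have h3 : twistedCLM (unitaryEquiv hn M)⁻¹ (unitaryHom M w) = w :=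
    LinearIsometryEquiv.symm_apply_apply (unitaryEquiv hn M).1 w
  rw [ContinuousLinearMap.comp_apply, ContinuousLinearMap.comp_apply, h3]
  rfl

/-- The form of `g` reads vectors through `g⁻¹`, that of `g M` through `M⁻¹ g⁻¹`, and these differ
by the real matrix `M`. The determinant thus decides whether `g` and `g M` induce the same
orientation. -/
theorem form_orientedImage_mul (hn : 1 ≤ n) (o : Orientation ℝ (realSubspace n) (Fin n))
    (g : twistedGroup ℂ n) {M : Matrix.unitaryGroup (Fin n) ℂ}
    (hM : M ∈ orthogonalInUnitary n) :
    (orientedImage hn o g).form =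
      (realMatrix M).det • (orientedImage hn o (g * unitaryEquiv hn M)).form := by
  ext w
  rw [Pi.smul_apply, smul_eq_mul, form_orientedImage, form_orientedImage]
  refine volumeForm_orthogonal o hM fun i => ?_
  rw [← projection_unitaryHom hn hM]
  have : unitaryHom M ((g * unitaryEquiv hn M)⁻¹.1 (w i)) = g⁻¹.1 (w i) := by
    rw [_root_.mul_inv_rev]
    exact LinearIsometryEquiv.apply_symm_apply (unitaryEquiv hn M).1 _
  rw [this]

/-- Evaluation on the image of an oriented orthonormal basis gives ±1. Nonvanishing excludes
determinant -1 when two oriented images coincide. -/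
theorem form_orientedImage_ne_zero (hn : 1 ≤ n) (o : Orientation ℝ (realSubspace n) (Fin n))
    (g : twistedGroup ℂ n) : (orientedImage hn o g).form ≠ 0 := by
  intro h
  let b := Orientation.finOrthonormalBasis (E := realSubspace n) hn Fact.out o
  have h1 := congrFun h fun i => g.1 (b i)
  rw [form_orientedImage, Pi.zero_apply] at h1
  have h2 : ∀ i, (realSubspace n).orthogonalProjectionOnto (g⁻¹.1 (g.1 (b i))) = b i := fun i => by
    have : g⁻¹.1 (g.1 (b i)) = b i := LinearIsometryEquiv.symm_apply_apply g.1 _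
    rw [this]
    exact Submodule.orthogonalProjectionOnto_mem_subspace_eq_self _
  simp_rw [h2] at h1
  have h3 := Orientation.volumeForm_robust' (E := realSubspace n) o b b
  rw [h1] at h3
  have h4 : b.toBasis.det b = 1 := by
    rw [← b.coe_toBasis]
    exact b.toBasis.det_self
  rw [h4] at h3
  norm_num at h3

theorem orientedImage_eq_iff (hn : 1 ≤ n) (o : Orientation ℝ (realSubspace n) (Fin n))
    (g h : twistedGroup ℂ n) : orientedImage hn o g = orientedImage hn o h ↔
      g⁻¹ * h ∈ (specialOrthogonalInUnitary n).map (unitaryEquiv hn).toMonoidHom := by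
  obtain ⟨M, hM⟩ := (unitaryEquiv hn).surjective (g⁻¹ * h)
  have hh : h = g * unitaryEquiv hn M := by rw [hM, mul_inv_cancel_left]
  rw [← hM, mem_map_unitaryEquiv]
  constructor
  · intro e
    have hC : imageUnder g (realSubspace n) = imageUnder h (realSubspace n) :=
      congrArg OrientedLagrangian.C e
    rw [imageUnder_eq_imageUnder_iff, ← hM, imageUnder_realSubspace_eq_iff] at hC
    rw [mem_specialOrthogonal_iff hC]
    have hf := form_orientedImage_mul hn o g hC
    rw [← hh, ← e] at hf
    refine (det_realMatrix hC).resolve_right fun h1 => ?_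
    rw [h1, neg_one_smul, self_eq_neg] at hf
    exact form_orientedImage_ne_zero hn o g hf
  · intro hS
    have hC : M ∈ orthogonalInUnitary n := hS.1
    refine OrientedLagrangian.ext_of_form hn ?_ ?_
    · change imageUnder g (realSubspace n) = imageUnder h (realSubspace n)
      rwa [imageUnder_eq_imageUnder_iff, ← hM, imageUnder_realSubspace_eq_iff]
    · rw [form_orientedImage_mul hn o g hC, ← hh, (mem_specialOrthogonal_iff hC).1 hS, one_smul]

/-- If `g` reaches the subspace with the wrong orientation, composing first with a real matrix of
determinant -1 corrects it without moving the subspace. -/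
theorem orientedImage_surjective (hn : 1 ≤ n) (o : Orientation ℝ (realSubspace n) (Fin n)) :
    Function.Surjective (orientedImage hn o) := by
  intro X
  obtain ⟨g, hg⟩ := exists_imageUnder_realSubspace hn X.lagrangian
  obtain ⟨C, hC, o'⟩ := X
  obtain rfl : imageUnder g (realSubspace n) = C := hg
  have hd : Module.finrank ℝ (imageUnder g (realSubspace n)) = n :=
    OrientedLagrangian.finrank_eq ⟨_, hC, o'⟩
  have : Fact (Module.finrank ℝ (imageUnder g (realSubspace n)) = n) := ⟨hd⟩
  let o₁ : Orientation ℝ (imageUnder g (realSubspace n)) (Fin n) := (orientedImage hn o g).o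
  rcases Orientation.eq_or_eq_neg o' o₁ (by rw [Fintype.card_fin]; exact hd.symm) with rfl | rfl
  · exact ⟨g, rfl⟩
  · obtain ⟨D, hD, hD1⟩ := exists_det_eq_neg_one hn
    refine ⟨g * unitaryEquiv hn D, OrientedLagrangian.ext_of_form hn ?_ ?_⟩
    · change imageUnder _ _ = imageUnder _ _
      rw [imageUnder_mul, (imageUnder_realSubspace_eq_iff hn D).2 hD]
    · have h1 := form_orientedImage_mul hn o g hD
      rw [hD1, neg_one_smul, ← neg_eq_iff_eq_neg] at h1
      rw [← h1, OrientedLagrangian.form_neg hC]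
      rfl

theorem exists_orientedLagrangian_homeomorph (hn : 1 ≤ n)
    (o : Orientation ℝ (realSubspace n) (Fin n)) :
    ∃ h : (twistedGroup ℂ n ⧸ (specialOrthogonalInUnitary n).map (unitaryEquiv hn).toMonoidHom) ≃ₜ
        OrientedLagrangian n,
      ∀ g : twistedGroup ℂ n, ∃ f : realSubspace n ≃ₗ[ℝ] (h g).C,
        (∀ x, (f x : LinSpace ℂ n) = g.1 x) ∧ (h g).o = Orientation.map (Fin n) f o := by
  have := OrientedLagrangian.t2Space hn
  obtain ⟨h, hh⟩ := exists_quotient_homeomorph _ (orientedImage hn o)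
    (continuous_orientedImage hn o) (orientedImage_surjective hn o) (orientedImage_eq_iff hn o)
  refine ⟨h, fun g => ?_⟩
  rw [hh g]
  exact ⟨(restrictImage g (realSubspace n)).toLinearEquiv, fun x => rfl, rfl⟩

end OrientedCase

/-! ### The twist as a function of the group element. -/

section Twist

variable {A : Type} [NormedAddCommGroup A] [InnerProductSpace ℝ A] [Mul A] [One A] {n : ℕ}

/-- The isometry `θ` of `𝔸` associated with an element of the twisted group. -/
noncomputable def twist (g : twistedGroup A n) : A ≃ₗᵢ[ℝ] A := g.2.choose

theorem det_twist (g : twistedGroup A n) :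
    LinearMap.det ((twist g).toLinearEquiv : A →ₗ[ℝ] A) = 1 := g.2.choose_spec.1

theorem apply_rightMul (g : twistedGroup A n) (v : LinSpace A n) (x : A) :
    g.1 (rightMul v x) = rightMul (g.1 v) (twist g x) := g.2.choose_spec.2 v x

variable [IsCompositionAlgebra A]

/-- The twist is obtained by choice, but a nonzero vector can be cancelled, so it is unique. All its
algebraic properties follow from this uniqueness. -/
theorem twist_eq (hn : 1 ≤ n) (g : twistedGroup A n) {x y : A}
    (h : ∀ v, g.1 (rightMul v x) = rightMul (g.1 v) y) : twist g x = y := by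
  have : Nontrivial (LinSpace A n) := nontrivial_linSpace hn
  obtain ⟨v, hv⟩ := exists_ne (0 : LinSpace A n)
  refine rightMul_left_cancel (v := g.1 v) (by simpa using hv) ?_
  rw [← h, apply_rightMul]

theorem twist_map_one (hn : 1 ≤ n) (g : twistedGroup A n) : twist g 1 = 1 :=
  twist_eq hn g fun v => by rw [rightMul_one, rightMul_one]

theorem twist_mul (hn : 1 ≤ n) (g h : twistedGroup A n) (x : A) :
    twist (g * h) x = twist g (twist h x) :=
  twist_eq hn _ fun v => by
    change g.1 (h.1 _) = rightMul (g.1 (h.1 v)) _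
    rw [apply_rightMul, apply_rightMul]

theorem twist_inv (hn : 1 ≤ n) (g : twistedGroup A n) (x : A) :
    twist g (twist g⁻¹ x) = x := by
  rw [← twist_mul hn, mul_inv_cancel]
  exact twist_eq hn _ fun v => rfl

theorem twist_inv' (hn : 1 ≤ n) (g : twistedGroup A n) (x : A) :
    twist g⁻¹ (twist g x) = x := by
  rw [← twist_mul hn, inv_mul_cancel]
  exact twist_eq hn _ fun v => rfl

theorem twist_imPart (hn : 1 ≤ n) (g : twistedGroup A n) {x : A} (hx : x ∈ imPart A) :
    twist g x ∈ imPart A := twist_mem_imPart (twist_map_one hn g) hx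

theorem imageUnder_rightMul_mem {g : twistedGroup A n} {C D : Submodule ℝ (LinSpace A n)}
    (h : imageUnder g C = D) {x : A} (hx : ∀ c ∈ C, rightMul c x ∈ C) :
    ∀ c ∈ D, rightMul c (twist g x) ∈ D := by
  subst h
  rintro _ ⟨c, hc, rfl⟩
  exact ⟨rightMul c x, hx c hc, apply_rightMul g c x⟩

end Twist

section LinearIsometryDet

theorem LinearIsometry.det_mul_self {E : Type*} [NormedAddCommGroup E] [InnerProductSpace ℝ E]
    [FiniteDimensional ℝ E] (f : E →ₗᵢ[ℝ] E) :
    LinearMap.det f.toLinearMap * LinearMap.det f.toLinearMap = 1 := by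
  have h := f.normDet_eq_one
  rw [LinearMap.normDet_eq_abs_det] at h
  rw [← abs_mul_abs_self, h, one_mul]

end LinearIsometryDet

/-! ### Quaternions -/

section QuaternionAlgebra

/-- The quaternion `i`. -/
abbrev quatI : ℍ[ℝ] := ((Complex.I : ℂ) : ℍ[ℝ])

@[simp] theorem quatJ_re : quatJ.re = 0 := rfl
@[simp] theorem quatJ_imI : quatJ.imI = 0 := rfl
@[simp] theorem quatJ_imJ : quatJ.imJ = 1 := rfl
@[simp] theorem quatJ_imK : quatJ.imK = 0 := rfl

theorem quatI_mul_quatI : quatI * quatI = -1 := by ext <;> simp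
theorem quatJ_mul_quatJ : quatJ * quatJ = -1 := by ext <;> simp
theorem quatJ_mul_quatI : quatJ * quatI = -(quatI * quatJ) := by ext <;> simp
theorem star_quatJ : star quatJ = -quatJ := by ext <;> simp

theorem norm_quatI : ‖quatI‖ = 1 := by
  have : ‖quatI‖ * ‖quatI‖ = 1 := by
    rw [← Quaternion.normSq_eq_norm_mul_self, Quaternion.normSq_def']
    simp
  nlinarith [norm_nonneg quatI]

theorem mem_imPart_quaternion {x : ℍ[ℝ]} : x ∈ imPart ℍ[ℝ] ↔ x.re = 0 := by
  rw [mem_imPart, Quaternion.inner_def]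
  simp

theorem mem_unitary_of_norm {x : ℍ[ℝ]} (hx : ‖x‖ = 1) : x ∈ unitary ℍ[ℝ] := by
  have h : star x * x = 1 := by
    rw [Quaternion.star_mul_self, Quaternion.normSq_eq_norm_mul_self, hx]
    simp
  exact Unitary.mem_iff.2 ⟨h, mul_eq_one_comm.1 h⟩

theorem UnitQuaternions.norm_eq_one (β : UnitQuaternions) : ‖(β : ℍ[ℝ])‖ = 1 :=
  CStarRing.norm_coe_unitary β

theorem quaternion_decomp (x : ℍ[ℝ]) :
    x = x.re • 1 + x.imI • quatI + x.imJ • quatJ + x.imK • (quatI * quatJ) := by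
  ext <;> simp

/-- An intertwining relation `y q = q x` with `q ≠ 0` is conjugation by a unit quaternion. -/
theorem exists_unit_of_intertwining {q : ℍ[ℝ]} (hq : q ≠ 0) :
    ∃ β : UnitQuaternions, ∀ x y, y * q = q * x → y = β * x * star (β : ℍ[ℝ]) := by
  have hn : ‖q‖ ≠ 0 := norm_ne_zero_iff.2 hq
  have hu := mem_unitary_of_norm (x := ‖q‖⁻¹ • q) (by rw [norm_smul]; simp [hn])
  refine ⟨⟨‖q‖⁻¹ • q, hu⟩, fun x y h => ?_⟩
  have h1 : y * (‖q‖⁻¹ • q) = (‖q‖⁻¹ • q) * x := by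
    rw [mul_smul_comm, h, smul_mul_assoc]
  change y = (‖q‖⁻¹ • q) * x * star (‖q‖⁻¹ • q)
  rw [← h1, mul_assoc, (Unitary.mem_iff.1 hu).2, mul_one]

/-- Every automorphism of the quaternions is inner. -/
theorem exists_conj_of_mul_hom (θ : ℍ[ℝ] →ₗ[ℝ] ℍ[ℝ]) (h1 : θ 1 = 1)
    (hm : ∀ x y, θ (x * y) = θ x * θ y) :
    ∃ β : UnitQuaternions, ∀ x, θ x = β * x * star (β : ℍ[ℝ]) := by
  set i := quatI
  set j := quatJ
  set I := θ i with hIdef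
  set J := θ j with hJdef
  have hi : i * i = -1 := quatI_mul_quatI
  have hj : j * j = -1 := quatJ_mul_quatJ
  have hji : j * i = -(i * j) := quatJ_mul_quatI
  have hI : I * I = -1 := by rw [hIdef, ← hm, hi, map_neg, h1]
  have hJ : J * J = -1 := by rw [hJdef, ← hm, hj, map_neg, h1]
  have hJI : J * I = -(I * J) := by rw [hIdef, hJdef, ← hm, ← hm, hji, map_neg]
  -- The averaging operator x ↦ ∑ θ(e) x e⁻¹ over e = 1, i, j, ij. Its values intertwine right
  -- multiplication by y with left multiplication by θ(y).
  let Q : ℍ[ℝ] → ℍ[ℝ] := fun x => x - I * x * i - J * x * j - I * J * x * (i * j)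
  have hQi : ∀ x, I * Q x = Q x * i := fun x => by
    simp only [Q]
    linear_combination (norm := noncomm_ring) -hI * x * i - hI * J * x * (i * j)
      + I * x * hi + J * x * hji + I * J * x * i * hji - I * J * x * hi * j
  have hQj : ∀ x, J * Q x = Q x * j := fun x => by
    simp only [Q]
    linear_combination (norm := noncomm_ring) -hJI * x * i - hJ * x * j - hJI * J * x * i * j
      + I * hJ * x * i * j + J * x * hj + I * J * x * i * hj
  -- A second averaging, ∑ Q(f) f⁻¹: since ∑ f y f⁻¹ = 4 Re y, only the term e = 1 of `Q` survives.
  -- Hence `Q` is not identically zero.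
  have hsum : Q 1 - Q i * i - Q j * j - Q (i * j) * (i * j) = (4 : ℕ) • 1 := by
    simp only [Q]
    have ei : ∀ x, i * (i * x) = -x := fun x => by rw [← mul_assoc, hi, neg_one_mul]
    have eji : ∀ x, j * (i * x) = -(i * (j * x)) := fun x => by
      rw [← mul_assoc, hji, neg_mul, mul_assoc]
    simp only [sub_mul, mul_assoc, mul_one, eji, hji, ei, hi, hj, mul_neg, neg_mul, neg_neg]
    noncomm_ring
  obtain ⟨x, hx⟩ : ∃ x, Q x ≠ 0 := by
    by_contra hcon
    push Not at hcon
    rw [hcon, hcon, hcon, hcon, ← Nat.cast_smul_eq_nsmul ℝ] at hsum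
    simpa using congrArg (fun q : ℍ[ℝ] => q.re) hsum
  obtain ⟨β, hβ⟩ := exists_unit_of_intertwining hx
  refine ⟨β, fun y => hβ _ _ ?_⟩
  have hy := quaternion_decomp y
  have h2 : θ y = y.re • 1 + y.imI • I + y.imJ • J + y.imK • (I * J) := by
    conv_lhs => rw [hy]
    simp only [map_add, map_smul, h1, hm]
    rfl
  rw [h2]
  conv_rhs => rw [hy]
  simp only [add_mul, mul_add, smul_mul_assoc, mul_smul_comm, one_mul, mul_one]
  rw [hQi, hQj, mul_assoc I J, hQj, ← mul_assoc I, hQi, mul_assoc]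

/-- As w² = i² = -1, the quaternion q = 1 - wi satisfies wq = w + i = qi. It vanishes only for w =
-i, where j conjugates instead. -/
theorem exists_conj_quatI {w : ℍ[ℝ]} (hw : w ∈ imPart ℍ[ℝ]) (hn : ‖w‖ = 1) :
    ∃ β : UnitQuaternions, (β : ℍ[ℝ]) * quatI * star (β : ℍ[ℝ]) = w := by
  have hw2 : w * w = -1 := by
    have h1 : star w = -w := by
      ext <;> simp [mem_imPart_quaternion.1 hw]
    have h2 : star w * w = 1 := (Unitary.mem_iff.1 (mem_unitary_of_norm hn)).1
    rw [h1, neg_mul] at h2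
    rw [← h2, neg_neg]
  rcases eq_or_ne (1 - w * quatI) 0 with h0 | h0
  · refine ⟨quaternionJ, ?_⟩
    change quatJ * quatI * star quatJ = w
    have : w = -quatI := by
      linear_combination (norm := noncomm_ring) h0 * quatI + w * quatI_mul_quatI
    rw [this, star_quatJ, quatJ_mul_quatI, neg_mul_neg, mul_assoc, quatJ_mul_quatJ]
    simp
  · obtain ⟨β, hβ⟩ := exists_unit_of_intertwining h0
    refine ⟨β, (hβ _ _ ?_).symm⟩
    linear_combination (norm := noncomm_ring) -hw2 * quatI + w * quatI_mul_quatI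

/-- A quaternion commuting with `i` and `j` is real. -/
theorem eq_coe_re_of_commute {x : ℍ[ℝ]} (hi : x * quatI = quatI * x) (hj : x * quatJ = quatJ * x) :
    x = (x.re : ℍ[ℝ]) := by
  have h1 := congrArg (fun q : ℍ[ℝ] => q.imJ) hi
  have h2 := congrArg (fun q : ℍ[ℝ] => q.imK) hi
  have h3 := congrArg (fun q : ℍ[ℝ] => q.imK) hj
  simp at h1 h2 h3
  ext <;> simp <;> linarith

/-- The central unit quaternions are `±1`. -/
theorem eq_one_or_neg_one_of_commute {β : UnitQuaternions}
    (h : ∀ x, (β : ℍ[ℝ]) * x = x * β) : (β : ℍ[ℝ]) = 1 ∨ (β : ℍ[ℝ]) = -1 := by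
  have h1 := eq_coe_re_of_commute (h quatI) (h quatJ)
  have h2 : ‖(β : ℍ[ℝ])‖ = 1 := β.norm_eq_one
  rw [h1, Quaternion.norm_coe, Real.norm_eq_abs] at h2
  rcases (abs_eq zero_le_one).1 h2 with h3 | h3 <;> rw [h1, h3] <;> simp

/-- Conjugation by a unit quaternion. -/
noncomputable def conjIsometry (β : UnitQuaternions) : ℍ[ℝ] ≃ₗᵢ[ℝ] ℍ[ℝ] :=
  (⟨LinearMap.mulLeft ℝ (β : ℍ[ℝ]) ∘ₗ LinearMap.mulRight ℝ (star (β : ℍ[ℝ])), fun x => by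
    change ‖(β : ℍ[ℝ]) * (x * star (β : ℍ[ℝ]))‖ = ‖x‖
    rw [norm_mul, norm_mul, norm_star, β.norm_eq_one, mul_one, one_mul]⟩ :
      ℍ[ℝ] →ₗᵢ[ℝ] ℍ[ℝ]).toLinearIsometryEquiv rfl

theorem conjIsometry_apply (β : UnitQuaternions) (x : ℍ[ℝ]) :
    conjIsometry β x = β * x * star (β : ℍ[ℝ]) := (mul_assoc _ _ _).symm

/-- Right multiplication by β* is left multiplication by β conjugated by the involution `star`. The
determinant is therefore a product of two squares of determinants ±1. -/
theorem det_conjIsometry (β : UnitQuaternions) :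
    LinearMap.det ((conjIsometry β).toLinearEquiv : ℍ[ℝ] →ₗ[ℝ] ℍ[ℝ]) = 1 := by
  let s : ℍ[ℝ] →ₗ[ℝ] ℍ[ℝ] :=
    { toFun := star, map_add' := star_add, map_smul' := fun c x => by simp }
  have hs : s ∘ₗ s = LinearMap.id := LinearMap.ext star_star
  have hR : LinearMap.mulRight ℝ (star (β : ℍ[ℝ])) = s ∘ₗ LinearMap.mulLeft ℝ (β : ℍ[ℝ]) ∘ₗ s := by
    ext1 x
    change x * star (β : ℍ[ℝ]) = star ((β : ℍ[ℝ]) * star x)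
    rw [star_mul, star_star]
  let L : ℍ[ℝ] →ₗᵢ[ℝ] ℍ[ℝ] := ⟨LinearMap.mulLeft ℝ (β : ℍ[ℝ]), fun x => by
    change ‖(β : ℍ[ℝ]) * x‖ = ‖x‖
    rw [norm_mul, β.norm_eq_one, one_mul]⟩
  have hL := L.det_mul_self
  have hss : LinearMap.det s * LinearMap.det s = 1 := by
    rw [← LinearMap.det_comp, hs, LinearMap.det_id]
  change LinearMap.det (L.toLinearMap ∘ₗ LinearMap.mulRight ℝ (star (β : ℍ[ℝ]))) = 1
  rw [hR]
  change LinearMap.det (L.toLinearMap ∘ₗ s ∘ₗ L.toLinearMap ∘ₗ s) = 1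
  rw [LinearMap.det_comp, LinearMap.det_comp, LinearMap.det_comp]
  linear_combination hL * (LinearMap.det s * LinearMap.det s) + hss

/-! ### The group `Sp(n) Sp(1)` -/

variable {n : ℕ}

/-- Right multiplication by the conjugate of a unit quaternion. -/
noncomputable def rightUnitHom : UnitQuaternions →* (LinSpace ℍ[ℝ] n ≃ₗᵢ[ℝ] LinSpace ℍ[ℝ] n) where
  toFun β :=
    (⟨(rightMulₗ (A := ℍ[ℝ])).flip (star (β : ℍ[ℝ])), fun v => by
      change ‖rightMul v (star (β : ℍ[ℝ]))‖ = ‖v‖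
      rw [norm_rightMul, norm_star, β.norm_eq_one, mul_one]⟩ :
      LinSpace ℍ[ℝ] n →ₗᵢ[ℝ] LinSpace ℍ[ℝ] n).toLinearIsometryEquiv rfl
  map_one' := by
    ext v : 1
    change rightMul v (star (1 : ℍ[ℝ])) = v
    rw [star_one, rightMul_one]
  map_mul' β γ := by
    ext v k : 2
    change v k * star ((β : ℍ[ℝ]) * (γ : ℍ[ℝ])) = v k * star (γ : ℍ[ℝ]) * star (β : ℍ[ℝ])
    rw [star_mul, mul_assoc]

theorem rightUnitHom_apply (β : UnitQuaternions) (v : LinSpace ℍ[ℝ] n) :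
    rightUnitHom β v = rightMul v (star (β : ℍ[ℝ])) := rfl

theorem rightMul_rightMul (v : LinSpace ℍ[ℝ] n) (x y : ℍ[ℝ]) :
    rightMul (rightMul v x) y = rightMul v (x * y) := by
  ext k : 1
  exact mul_assoc _ _ _

theorem unitaryHom_mul_rightUnitHom_rightMul (p : SpGroup n × UnitQuaternions)
    (v : LinSpace ℍ[ℝ] n) (x : ℍ[ℝ]) :
    (unitaryHom p.1 * rightUnitHom p.2 : LinSpace ℍ[ℝ] n ≃ₗᵢ[ℝ] LinSpace ℍ[ℝ] n) (rightMul v x) =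
      rightMul ((unitaryHom p.1 * rightUnitHom p.2 : LinSpace ℍ[ℝ] n ≃ₗᵢ[ℝ] LinSpace ℍ[ℝ] n) v)
        (conjIsometry p.2 x) := by
  change unitaryHom p.1 (rightUnitHom p.2 (rightMul v x)) =
    rightMul (unitaryHom p.1 (rightUnitHom p.2 v)) _
  rw [← unitaryHom_rightMul, rightUnitHom_apply, rightUnitHom_apply, rightMul_rightMul,
    rightMul_rightMul, conjIsometry_apply, ← mul_assoc, ← mul_assoc,
    Unitary.coe_star_mul_self, one_mul]

/-- The homomorphism `(α, β) ↦ (v ↦ α v β*)`. -/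
noncomputable def spHom : SpGroup n × UnitQuaternions →* twistedGroup ℍ[ℝ] n where
  toFun p := ⟨unitaryHom p.1 * rightUnitHom p.2, conjIsometry p.2, det_conjIsometry p.2,
    unitaryHom_mul_rightUnitHom_rightMul p⟩
  map_one' := Subtype.ext (by
    change unitaryHom 1 * rightUnitHom 1 = 1
    rw [map_one, map_one, mul_one])
  map_mul' p q := Subtype.ext (by
    change unitaryHom (p.1 * q.1) * rightUnitHom (p.2 * q.2) =
      (unitaryHom p.1 * rightUnitHom p.2) * (unitaryHom q.1 * rightUnitHom q.2)
    have h : rightUnitHom p.2 * unitaryHom q.1 = unitaryHom q.1 * rightUnitHom p.2 := by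
      ext v : 1
      exact (unitaryHom_rightMul _ _ _).symm
    rw [map_mul, map_mul, mul_assoc, mul_assoc, ← mul_assoc (rightUnitHom p.2), h, mul_assoc])

theorem spHom_apply (p : SpGroup n × UnitQuaternions) (v : LinSpace ℍ[ℝ] n) :
    (spHom p).1 v = rightMul (unitaryHom p.1 v) (star (p.2 : ℍ[ℝ])) := by
  rw [← unitaryHom_rightMul]
  rfl

theorem twist_spHom (hn : 1 ≤ n) (p : SpGroup n × UnitQuaternions) (x : ℍ[ℝ]) :
    twist (spHom p) x = p.2 * x * star (p.2 : ℍ[ℝ]) := by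
  rw [← conjIsometry_apply]
  exact twist_eq hn _ fun v => unitaryHom_mul_rightUnitHom_rightMul p v x

theorem continuous_spHom : Continuous (spHom : SpGroup n × UnitQuaternions →* twistedGroup ℍ[ℝ] n) := by
  refine twistedGroup.continuous_iff.2 fun v => ?_
  have h0 : ∀ k l, Continuous fun p : SpGroup n × UnitQuaternions => p.1.1 k l := by
    have h : Continuous fun p : SpGroup n × UnitQuaternions => p.1 := continuous_fst
    have h' : Continuous fun p : SpGroup n × UnitQuaternions =>
      (p.1 : Matrix (Fin n) (Fin n) ℍ[ℝ]) := h.subtype_val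
    exact fun k l => (continuous_apply_apply k l).comp h'
  have h1 : Continuous fun p : SpGroup n × UnitQuaternions => unitaryHom p.1 v :=
    continuous_unitaryHom_apply (X := SpGroup n × UnitQuaternions) (f := fun p => p.1) h0 v
  simp_rw [spHom_apply]
  refine (PiLp.continuous_toLp 2 _).comp (continuous_pi fun k => ?_)
  exact ((PiLp.continuous_apply 2 _ k).comp h1).mul
    (continuous_star.comp (continuous_subtype_val.comp continuous_snd))

theorem twist_map_mul (hn : 1 ≤ n) (g : twistedGroup ℍ[ℝ] n) (x y : ℍ[ℝ]) :
    twist g (x * y) = twist g x * twist g y :=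
  twist_eq hn g fun v => by
    rw [← rightMul_rightMul, apply_rightMul, apply_rightMul, rightMul_rightMul]

/-- The twist is multiplicative, hence conjugation by some β. Multiplying `g` on the right by β
untwists it, and an isometry commuting with right multiplication is a matrix of Sp(n). -/
theorem spHom_surjective (hn : 1 ≤ n) :
    Function.Surjective (spHom : SpGroup n × UnitQuaternions →* twistedGroup ℍ[ℝ] n) := by
  intro g
  obtain ⟨β, hβ⟩ := exists_conj_of_mul_hom ((twist g).toLinearEquiv : ℍ[ℝ] →ₗ[ℝ] ℍ[ℝ])
    (twist_map_one hn g) (twist_map_mul hn g)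
  have hβ' : ∀ x, twist g x = β * x * star (β : ℍ[ℝ]) := hβ
  obtain ⟨M, hM⟩ := exists_unitaryHom_eq (φ := rightUnitHom β⁻¹ * g.1) fun v x => by
    change rightMul (g.1 (rightMul v x)) (star (star (β : ℍ[ℝ]))) =
      rightMul (rightMul (g.1 v) (star (star (β : ℍ[ℝ])))) x
    rw [apply_rightMul, star_star, rightMul_rightMul, rightMul_rightMul, hβ', mul_assoc,
      Unitary.coe_star_mul_self, mul_one]
  refine ⟨(M, β), Subtype.ext ?_⟩
  change unitaryHom M * rightUnitHom β = g.1
  ext v : 1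
  change unitaryHom M (rightMul v (star (β : ℍ[ℝ]))) = g.1 v
  rw [unitaryHom_rightMul, hM]
  change rightMul (rightMul (g.1 v) (star (star (β : ℍ[ℝ])))) (star (β : ℍ[ℝ])) = g.1 v
  rw [rightMul_rightMul, star_star, (Unitary.mem_iff.1 β.2).2, rightMul_one]

/-- A trivial twist makes β central, hence ±1; the images of the basis vectors then force the matrix
to be the scalar β. -/
theorem mem_ker_spHom (hn : 1 ≤ n) (p : SpGroup n × UnitQuaternions) :
    p ∈ (spHom (n := n)).ker ↔
      p = 1 ∨ ((p.1 : Matrix (Fin n) (Fin n) ℍ[ℝ]) = -1 ∧ (p.2 : ℍ[ℝ]) = -1) := by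
  have key : p ∈ (spHom (n := n)).ker ↔
      ∀ v : LinSpace ℍ[ℝ] n, rightMul (unitaryHom p.1 v) (star (p.2 : ℍ[ℝ])) = v := by
    rw [MonoidHom.mem_ker, Subtype.ext_iff, LinearIsometryEquiv.ext_iff]
    simp_rw [spHom_apply]
    rfl
  constructor
  · intro h
    have h0 := key.1 h
    have h1 : ∀ x, (p.2 : ℍ[ℝ]) * x * star (p.2 : ℍ[ℝ]) = x := fun x => by
      rw [← twist_spHom hn, MonoidHom.mem_ker.1 h]
      exact twist_eq hn _ fun v => rfl
    have hM : ∀ k l, p.1.1 k l = if k = l then (p.2 : ℍ[ℝ]) else 0 := fun k l => by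
      have h2 := congrArg (fun v : LinSpace ℍ[ℝ] n => v k * (p.2 : ℍ[ℝ])) (h0 (stdVec ℍ[ℝ] l))
      simp only [rightMul_apply, mul_assoc, Unitary.coe_star_mul_self, mul_one,
        unitaryHom_stdVec, stdVec_apply] at h2
      rw [h2]
      split_ifs <;> simp
    rcases eq_one_or_neg_one_of_commute (β := p.2) (fun x => by
      conv_rhs => rw [← h1 x]
      rw [mul_assoc, Unitary.coe_star_mul_self, mul_one]) with h3 | h3
    · left
      refine Prod.ext (Subtype.ext (Matrix.ext fun k l => ?_)) (Subtype.ext h3)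
      rw [hM, h3]
      exact (Matrix.one_apply).symm
    · right
      refine ⟨Matrix.ext fun k l => ?_, h3⟩
      rw [hM, h3, Matrix.neg_apply, Matrix.one_apply]
      split_ifs <;> simp
  · rintro (rfl | ⟨h1, h2⟩)
    · exact one_mem _
    · refine key.2 fun v => ?_
      ext k : 1
      rw [rightMul_apply, unitaryHom_apply, h1, h2]
      simp [Matrix.one_apply]

end QuaternionAlgebra

/-! ### Products of two right multiplications preserving a Lagrangian subspace. -/

section RightMultiplications

variable {A : Type} [NormedAddCommGroup A] [InnerProductSpace ℝ A] [Mul A] [One A]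
  [IsCompositionAlgebra A] [FiniteDimensional ℝ A] {n : ℕ}

/-- If `C` has half the dimension, `C u ⟂ C`, `C u' ⟂ C` and `R_{u'}² = -1`, then `(C u) u' ⊂ C`. -/
theorem rightMul_rightMul_mem {C : Submodule ℝ (LinSpace A n)}
    (hd : 2 * Module.finrank ℝ C = Module.finrank ℝ (LinSpace A n)) {u u' : A}
    (hu : ∀ c ∈ C, ∀ c' ∈ C, inner ℝ (rightMul c u) c' = 0)
    (hu' : ∀ c ∈ C, ∀ c' ∈ C, inner ℝ (rightMul c u') c' = 0)
    (hsq : ∀ v : LinSpace A n, rightMul (rightMul v u') u' = -v) {c : LinSpace A n} (hc : c ∈ C) :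
    rightMul (rightMul c u) u' ∈ C := by
  let R : LinSpace A n →ₗ[ℝ] LinSpace A n := (rightMulₗ (A := A)).flip u'
  have hRR : ∀ v, rightMul (R v) u' = -v := hsq
  have hinj : Function.Injective R := fun v w h => by
    have := hRR v
    rw [h, hRR] at this
    exact (neg_injective this).symm
  -- `C` has half the dimension, so the image of `C` fills its whole orthogonal complement. Thus `c
  -- u`, being orthogonal to `C`, equals `x u'` with `x` in `C`, and `(x u') u' = -x`.
  have hmap : C.map R = Cᗮ := by
    refine Submodule.eq_of_le_of_finrank_le ?_ ?_
    · rintro _ ⟨x, hx, rfl⟩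
      rw [Submodule.mem_orthogonal]
      intro y hy
      rw [real_inner_comm]
      exact hu' x hx y hy
    · have h1 := C.finrank_add_finrank_orthogonal
      have h2 := (Submodule.equivMapOfInjective R hinj C).finrank_eq
      omega
  have h1 : rightMul c u ∈ Cᗮ := by
    rw [Submodule.mem_orthogonal]
    intro y hy
    rw [real_inner_comm]
    exact hu c hc y hy
  rw [← hmap] at h1
  obtain ⟨x, hx, hx'⟩ := h1
  rw [← hx', hRR]
  exact C.neg_mem hx

end RightMultiplications

/-! ### Lagrangian subspaces of ℍⁿ: normal form and transitivity. -/

section QuaternionicLagrangian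

variable {n : ℕ}

/-- The coordinates of `ℂⁿ ⊂ ℍⁿ`. -/
noncomputable def complexSubspaceEquiv (n : ℕ) :
    complexSubspace n ≃ₗ[ℝ] (Fin n → ℝ) × (Fin n → ℝ) where
  toFun v := (fun i => (v.1 i).re, fun i => (v.1 i).imI)
  map_add' v w := rfl
  map_smul' c v := by ext i <;> simp
  invFun x := ⟨WithLp.toLp 2 fun i => ⟨x.1 i, x.2 i, 0, 0⟩, fun i => ⟨rfl, rfl⟩⟩
  left_inv v := by
    refine Subtype.ext (PiLp.ext fun i => QuaternionAlgebra.ext rfl rfl ?_ ?_)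
    · exact (v.2 i).1.symm
    · exact (v.2 i).2.symm
  right_inv x := rfl

theorem finrank_complexSubspace : Module.finrank ℝ (complexSubspace n) = 2 * n := by
  rw [(complexSubspaceEquiv n).finrank_eq]
  simp [two_mul]

theorem finrank_linSpace_quaternion : Module.finrank ℝ (LinSpace ℍ[ℝ] n) = 4 * n := by
  rw [(WithLp.linearEquiv 2 ℝ (Fin n → ℍ[ℝ])).finrank_eq]
  simp [Module.finrank_pi_fintype, mul_comm, Quaternion.finrank_eq_four]

theorem isHalfLagrangian_complexSubspace : IsHalfLagrangian (complexSubspace n) := by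
  refine ⟨by rw [finrank_complexSubspace, finrank_linSpace_quaternion]; ring,
    Submodule.span ℝ (Set.range ![quatJ, quatI * quatJ]), ?_, ?_, ?_⟩
  · rw [Submodule.span_le]
    rintro _ ⟨a, rfl⟩
    refine mem_imPart_quaternion.2 ?_
    fin_cases a <;> simp
  · rw [finrank_span_eq_card, Fintype.card_fin, Quaternion.finrank_eq_four]
    rw [LinearIndependent.pair_iff]
    intro s t h
    have h1 := congrArg (fun q : ℍ[ℝ] => q.imJ) h
    have h2 := congrArg (fun q : ℍ[ℝ] => q.imK) h
    simp at h1 h2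
    exact ⟨h1, h2⟩
  · intro u hu hu1 c hc c' hc'
    clear hu1
    have h : u.re = 0 ∧ u.imI = 0 := by
      induction hu using Submodule.span_induction with
      | mem x hx =>
        obtain ⟨a, rfl⟩ := hx
        fin_cases a <;> simp
      | zero => simp
      | add x y _ _ hx hy => simp [hx.1, hx.2, hy.1, hy.2]
      | smul a x _ hx => simp [hx.1, hx.2]
    rw [PiLp.inner_apply]
    refine Finset.sum_eq_zero fun i _ => ?_
    rw [rightMul_apply, Quaternion.inner_def]
    simp [h.1, h.2, (hc i).1, (hc i).2, (hc' i).1, (hc' i).2]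

/-- A Lagrangian subspace of `ℍⁿ` is a complex subspace for some unit imaginary quaternion. -/
theorem IsHalfLagrangian.exists_polarization {C : Submodule ℝ (LinSpace ℍ[ℝ] n)}
    (hC : IsHalfLagrangian C) :
    ∃ w ∈ imPart ℍ[ℝ], ‖w‖ = 1 ∧ ∀ c ∈ C, rightMul c w ∈ C := by
  obtain ⟨L, hL, hLd, hu⟩ := hC.exists_orthogonal
  rw [Quaternion.finrank_eq_four] at hLd
  have hd : Module.finrank ℝ L = 2 := by omega
  let b := (stdOrthonormalBasis ℝ L).reindex (finCongr hd)
  have hnorm : ∀ a, ‖(b a : ℍ[ℝ])‖ = 1 := fun a => b.orthonormal.1 a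
  have h01 : inner ℝ (b 0 : ℍ[ℝ]) (b 1 : ℍ[ℝ]) = 0 := b.orthonormal.2 (by decide)
  have hre : ∀ a, (b a : ℍ[ℝ]).re = 0 := fun a => mem_imPart_quaternion.1 (hL (b a).2)
  have hstar : ∀ a, star (b a : ℍ[ℝ]) = -(b a : ℍ[ℝ]) := fun a => by
    ext <;> simp [hre a]
  -- For orthonormal imaginary quaternions the product is again imaginary of norm 1. Each factor
  -- carries `C` to its complement, so the product preserves `C`.
  refine ⟨(b 0 : ℍ[ℝ]) * (b 1 : ℍ[ℝ]), ?_, ?_, ?_⟩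
  · rw [Quaternion.inner_def, hstar, mul_neg] at h01
    have h02 : -((b 0 : ℍ[ℝ]) * (b 1 : ℍ[ℝ])).re = 0 := h01
    exact mem_imPart_quaternion.2 (neg_eq_zero.1 h02)
  · rw [norm_mul, hnorm, hnorm, one_mul]
  · intro c hc
    have h1 : (b 1 : ℍ[ℝ]) * (b 1 : ℍ[ℝ]) = -1 := by
      have := (Unitary.mem_iff.1 (mem_unitary_of_norm (hnorm 1))).1
      rw [hstar, neg_mul] at this
      rw [← this, neg_neg]
    rw [← rightMul_rightMul]
    exact rightMul_rightMul_mem hC.1 (hu _ (b 0).2) (hu _ (b 1).2)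
      (fun v => by rw [rightMul_rightMul, h1, rightMul_neg, rightMul_one]) hc

/-- If `C` is Lagrangian and `i`-complex then `C j` is orthogonal to `C`. -/
theorem IsHalfLagrangian.inner_rightMul_quatJ {C : Submodule ℝ (LinSpace ℍ[ℝ] n)}
    (hC : IsHalfLagrangian C) (hi : ∀ c ∈ C, rightMul c quatI ∈ C) :
    ∀ c ∈ C, ∀ c' ∈ C, inner ℝ (rightMul c quatJ) c' = 0 := by
  obtain ⟨L, hL, hLd, hu⟩ := hC.exists_orthogonal
  rw [Quaternion.finrank_eq_four] at hLd
  have hne : L ≠ ⊥ := by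
    rintro rfl
    simp at hLd
  obtain ⟨u, huL, hu0⟩ := Submodule.exists_mem_ne_zero_of_ne_bot hne
  intro c hc c' hc'
  rcases eq_or_ne c 0 with rfl | hc0
  · have : rightMul (0 : LinSpace ℍ[ℝ] n) quatJ = 0 := by ext k : 1; simp
    rw [this, inner_zero_left]
  have hre : u.re = 0 := mem_imPart_quaternion.1 (hL huL)
  -- Tested on `c` and `c i`, both in `C`, the condition says that `u` is orthogonal to i; so `u`
  -- lies in the span of j and ij.
  have hI : u.imI = 0 := by
    have h := hu u huL c hc _ (hi c hc)
    rw [inner_rightMul_same] at h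
    have h2 : inner ℝ u quatI = 0 := by
      refine (mul_eq_zero.1 h).resolve_left ?_
      simpa using hc0
    rw [Quaternion.inner_def] at h2
    simpa using h2
  have hs : u.imJ ^ 2 + u.imK ^ 2 ≠ 0 := by
    intro h
    refine hu0 (QuaternionAlgebra.ext hre hI ?_ ?_)
    · change u.imJ = 0
      nlinarith [sq_nonneg u.imJ, sq_nonneg u.imK]
    · change u.imK = 0
      nlinarith [sq_nonneg u.imJ, sq_nonneg u.imK]
  -- The complex factor is chosen so that its product with `u` is a positive multiple of j; it may
  -- be absorbed in `c` because `C` is i-complex.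
  have h1 := hu u huL (u.imJ • c - u.imK • rightMul c quatI)
    (C.sub_mem (C.smul_mem _ hc) (C.smul_mem _ (hi c hc))) c' hc'
  have h2 : rightMul (u.imJ • c - u.imK • rightMul c quatI) u =
      (u.imJ ^ 2 + u.imK ^ 2) • rightMul c quatJ := by
    have h3 : (u.imJ • 1 - u.imK • quatI) * u = (u.imJ ^ 2 + u.imK ^ 2) • quatJ := by
      ext <;> simp [hre, hI] <;> ring
    rw [← rightMul_smul (u.imJ ^ 2 + u.imK ^ 2) c quatJ, ← h3, ← rightMul_rightMul, rightMul_sub, rightMul_smul, rightMul_smul,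
      rightMul_one]
  rw [h2, inner_smul_left] at h1
  exact (mul_eq_zero.1 h1).resolve_left (by simpa using hs)

/-- Up to sign, the four real components of `herm v w` are the inner products of `v` with w, wi, wj
and wij. -/
theorem herm_eq_of_components {v w : LinSpace ℍ[ℝ] n} {r : ℝ}
    (h1 : inner ℝ v w = r) (hi : inner ℝ v (rightMul w quatI) = 0)
    (hj : inner ℝ v (rightMul w quatJ) = 0)
    (hk : inner ℝ v (rightMul (rightMul w quatI) quatJ) = 0) : herm v w = (r : ℍ[ℝ]) := by
  rw [inner_eq_inner_one_herm, Quaternion.inner_def] at h1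
  rw [inner_rightMul_eq, Quaternion.inner_def] at hi hj
  rw [rightMul_rightMul, inner_rightMul_eq, Quaternion.inner_def] at hk
  simp at h1 hi hj hk
  ext <;> simp [h1, hi, hj, hk]

/-- An `i`-complex subspace `C` of real dimension `2m` with `C j ⟂ C` has an orthonormal basis. -/
theorem exists_herm_basis_quaternion (m : ℕ) : ∀ C : Submodule ℝ (LinSpace ℍ[ℝ] n),
    Module.finrank ℝ C = 2 * m → (∀ c ∈ C, rightMul c quatI ∈ C) →
    (∀ c ∈ C, ∀ c' ∈ C, inner ℝ (rightMul c quatJ) c' = 0) →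
    ∃ c : Fin m → LinSpace ℍ[ℝ] n, (∀ k, c k ∈ C) ∧
      ∀ k l, herm (c k) (c l) = if k = l then 1 else 0 := by
  induction m with
  | zero => exact fun C _ _ _ => ⟨Fin.elim0, fun k => k.elim0, fun k => k.elim0⟩
  | succ m ih =>
    intro C hd hi hj
    have hne : C ≠ ⊥ := by
      rintro rfl
      simp at hd
    obtain ⟨x, hx, hx0⟩ := Submodule.exists_mem_ne_zero_of_ne_bot hne
    have hxn : ‖x‖ ≠ 0 := norm_ne_zero_iff.2 hx0
    obtain ⟨a, ha, han⟩ : ∃ a ∈ C, ‖a‖ = 1 :=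
      ⟨‖x‖⁻¹ • x, C.smul_mem _ hx, by rw [norm_smul]; simp [hxn]⟩
    have hskew : ∀ v w : LinSpace ℍ[ℝ] n,
        inner ℝ (rightMul v quatI) w = -inner ℝ v (rightMul w quatI) :=
      inner_rightMul_left_of_imPart (mem_imPart_quaternion.2 (by simp))
    have hskewJ : ∀ v w : LinSpace ℍ[ℝ] n,
        inner ℝ (rightMul v quatJ) w = -inner ℝ v (rightMul w quatJ) :=
      inner_rightMul_left_of_imPart (mem_imPart_quaternion.2 (by simp))
    have hj' : ∀ c ∈ C, ∀ c' ∈ C, inner ℝ c (rightMul c' quatJ) = 0 := fun c hc c' hc' => by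
      rw [← neg_eq_zero, ← hskewJ, hj c hc c' hc']
    have hself : ∀ v : LinSpace ℍ[ℝ] n, inner ℝ v (rightMul v quatI) = 0 := fun v => by
      have := hskew v v
      rw [real_inner_comm] at this
      linarith
    -- The complex line of a unit vector `a`. Its complement in `C` is again i-complex, of real
    -- dimension smaller by 2, so the induction applies.
    let e : Fin 2 → LinSpace ℍ[ℝ] n := ![a, rightMul a quatI]
    have he : Orthonormal ℝ e := by
      rw [orthonormal_iff_ite]
      intro k l
      fin_cases k <;> fin_cases l
      · simp [e, han]
      · simp [e, hself]
      · simp [e, hskew, hself]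
      · simp [e, norm_rightMul, han, norm_quatI]
    let S := Submodule.span ℝ (Set.range e)
    have hSC : S ≤ C := by
      rw [Submodule.span_le]
      rintro _ ⟨k, rfl⟩
      fin_cases k
      · exact ha
      · exact hi a ha
    have hS : Module.finrank ℝ S = 2 := by
      rw [finrank_span_eq_card he.linearIndependent, Fintype.card_fin]
    have hmem : ∀ c, c ∈ Sᗮ ⊓ C ↔
        c ∈ C ∧ inner ℝ a c = 0 ∧ inner ℝ (rightMul a quatI) c = 0 := fun c => by
      rw [Submodule.mem_inf, Submodule.mem_orthogonal, and_comm]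
      refine and_congr_right fun _ => ⟨fun h => ⟨h _ (Submodule.subset_span ⟨0, rfl⟩),
        h _ (Submodule.subset_span ⟨1, rfl⟩)⟩, fun h u hu => ?_⟩
      induction hu using Submodule.span_induction with
      | mem y hy =>
        obtain ⟨k, rfl⟩ := hy
        fin_cases k
        · exact h.1
        · exact h.2
      | zero => exact inner_zero_left _
      | add y z _ _ hy hz => rw [inner_add_left, hy, hz, add_zero]
      | smul t y _ hy => rw [inner_smul_left, hy, mul_zero]
    have hd' : Module.finrank ℝ (Sᗮ ⊓ C : Submodule ℝ (LinSpace ℍ[ℝ] n)) = 2 * m := by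
      have := Submodule.finrank_add_inf_finrank_orthogonal hSC
      omega
    obtain ⟨c, hc, ho⟩ := ih (Sᗮ ⊓ C) hd'
      (fun c hc => by
        rw [hmem] at hc ⊢
        refine ⟨hi c hc.1, ?_, ?_⟩
        · rw [← neg_eq_zero, ← hskew, hc.2.2]
        · rw [inner_rightMul_rightMul, hc.2.1, mul_zero])
      (fun c hc c' hc' => hj c hc.2 c' hc'.2)
    -- The components along 1 and i vanish by the choice of complement, those along j and ij because
    -- `C j ⟂ C`.
    have h0 : ∀ k, herm a (c k) = 0 := fun k => by
      have h1 := (hmem _).1 (hc k)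
      have := herm_eq_of_components h1.2.1
        (by rw [← neg_eq_zero, ← hskew, h1.2.2]) (hj' a ha _ h1.1)
        (hj' a ha _ (hi _ h1.1))
      rw [this, Quaternion.coe_zero]
    have h1 : herm a a = 1 := by
      have := herm_eq_of_components (v := a) (w := a) (r := 1)
        (by rw [real_inner_self_eq_norm_sq, han, one_pow]) (hself a) (hj' a ha a ha)
        (hj' a ha _ (hi a ha))
      rw [this, Quaternion.coe_one]
    refine ⟨Fin.cons a c, fun k => ?_, fun k l => ?_⟩
    · refine Fin.cases ha (fun k => (hc k).2) k
    · refine Fin.cases (Fin.cases ?_ (fun l => ?_) l) (fun k => Fin.cases ?_ (fun l => ?_) l) k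
      · simpa using h1
      · rw [Fin.cons_zero, Fin.cons_succ, h0, if_neg (Fin.succ_ne_zero l).symm]
      · rw [Fin.cons_zero, Fin.cons_succ, ← star_herm, h0, if_neg (Fin.succ_ne_zero k), star_zero]
      · rw [Fin.cons_succ, Fin.cons_succ, ho]
        simp

theorem rightMul_quatI_mem_complexSubspace {c : LinSpace ℍ[ℝ] n} (hc : c ∈ complexSubspace n) :
    rightMul c quatI ∈ complexSubspace n := by
  intro k
  simp [(hc k).1, (hc k).2]

/-- An element of Sp(1) first turns the unit imaginary quaternion preserving `C` into i. The
resulting subspace contains a quaternionic orthonormal basis, and the matrix with these columns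
carries ℂⁿ onto it. -/
theorem exists_imageUnder_complexSubspace (hn : 1 ≤ n) {C : Submodule ℝ (LinSpace ℍ[ℝ] n)}
    (hC : IsHalfLagrangian C) : ∃ g : twistedGroup ℍ[ℝ] n, imageUnder g (complexSubspace n) = C := by
  obtain ⟨w, hw, hwn, hCw⟩ := hC.exists_polarization
  obtain ⟨β, hβ⟩ := exists_conj_quatI hw hwn
  let g : twistedGroup ℍ[ℝ] n := spHom (1, β)
  have hg : twist g⁻¹ w = quatI := by
    rw [← hβ, ← twist_spHom hn (1, β), twist_inv' hn]
  have hD := hC.imageUnder hn g⁻¹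
  have hDi := imageUnder_rightMul_mem (g := g⁻¹) rfl hCw
  rw [hg] at hDi
  have hd := hD.1
  rw [finrank_linSpace_quaternion] at hd
  obtain ⟨c, hc, ho⟩ := exists_herm_basis_quaternion n (imageUnder g⁻¹ C) (by omega) hDi
    (hD.inner_rightMul_quatJ hDi)
  obtain ⟨M, hM⟩ := exists_unitaryHom_stdVec ho
  refine ⟨g * spHom (M, 1), ?_⟩
  have h1 : imageUnder (spHom (M, 1)) (complexSubspace n) = imageUnder g⁻¹ C := by
    refine imageUnder_eq_of_le (by rw [finrank_complexSubspace]; omega) fun x hx => ?_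
    rw [spHom_apply, OneMemClass.coe_one, star_one, rightMul_one, ← sum_rightMul_stdVec x, map_sum]
    refine sum_mem fun l _ => ?_
    have : x l = (x l).re • (1 : ℍ[ℝ]) + (x l).imI • quatI := by
      ext <;> simp [(hx l).1, (hx l).2]
    rw [this, unitaryHom_rightMul, hM, rightMul_add, rightMul_smul, rightMul_smul, rightMul_one]
    exact Submodule.add_mem _ (Submodule.smul_mem _ _ (hc l))
      (Submodule.smul_mem _ _ (hDi _ (hc l)))
  rw [imageUnder_mul, h1, ← imageUnder_mul, mul_inv_cancel, imageUnder_one]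

/-! ### The stabilizer -/

theorem mem_range_ofComplex {x : ℍ[ℝ]} :
    x ∈ Quaternion.ofComplex.range ↔ x.imJ = 0 ∧ x.imK = 0 := by
  constructor
  · rintro ⟨z, rfl⟩
    exact ⟨rfl, rfl⟩
  · rintro ⟨h1, h2⟩
    exact ⟨⟨x.re, x.imI⟩, QuaternionAlgebra.ext rfl rfl h1.symm h2.symm⟩

theorem stdVec_mem_complexSubspace (l : Fin n) : stdVec ℍ[ℝ] l ∈ complexSubspace n := by
  intro k
  rw [stdVec_apply]
  split_ifs <;> simp

/-- The unit imaginary quaternions preserving `ℂⁿ` are `±i`. -/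
theorem eq_quatI_or_neg (hn : 1 ≤ n) {w : ℍ[ℝ]} (hw : w ∈ imPart ℍ[ℝ]) (h1 : ‖w‖ = 1)
    (h : ∀ c ∈ complexSubspace n, rightMul c w ∈ complexSubspace n) : w = quatI ∨ w = -quatI := by
  have hre := mem_imPart_quaternion.1 hw
  have h2 := h _ (stdVec_mem_complexSubspace ⟨0, hn⟩) ⟨0, hn⟩
  rw [rightMul_apply, stdVec_apply, if_pos rfl, one_mul] at h2
  have h3 : w.imI * w.imI = 1 := by
    have := Quaternion.normSq_eq_norm_mul_self w
    rw [h1, Quaternion.normSq_def', hre, h2.1, h2.2] at this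
    linarith
  rcases mul_self_eq_one_iff.1 h3 with h4 | h4
  · left
    ext <;> simp [hre, h2.1, h2.2, h4]
  · right
    ext <;> simp [hre, h2.1, h2.2, h4]

theorem norm_twist_quatI (g : twistedGroup ℍ[ℝ] n) : ‖twist g quatI‖ = 1 := by
  rw [LinearIsometryEquiv.norm_map, norm_quatI]

theorem quatI_mem_imPart : quatI ∈ imPart ℍ[ℝ] := mem_imPart_quaternion.2 (by simp)

theorem twist_quatI_of_stabilizer (hn : 1 ≤ n) {g : twistedGroup ℍ[ℝ] n}
    (hg : imageUnder g (complexSubspace n) = complexSubspace n) :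
    twist g quatI = quatI ∨ twist g quatI = -quatI :=
  eq_quatI_or_neg hn (twist_imPart hn g quatI_mem_imPart) (norm_twist_quatI g)
    (imageUnder_rightMul_mem hg fun _ hc => rightMul_quatI_mem_complexSubspace hc)

/-- Fixing i under the twist means that β commutes with i, so β is complex. The entries of αβ*, read
off from basis vectors, are then complex exactly when those of α are. -/
theorem mem_unitaryPairs_iff (hn : 1 ≤ n) (p : SpGroup n × UnitQuaternions) :
    p ∈ unitaryPairs n ↔ imageUnder (spHom p) (complexSubspace n) = complexSubspace n ∧
      twist (spHom p) quatI = quatI := by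
  constructor
  · rintro ⟨h1, h2⟩
    obtain ⟨z, hz⟩ := h2
    have hz' : (p.2 : ℍ[ℝ]) = (z : ℍ[ℝ]) := hz.symm
    refine ⟨imageUnder_eq_of_le le_rfl fun x hx k => ?_, ?_⟩
    · rw [← mem_range_ofComplex, spHom_apply, rightMul_apply, unitaryHom_apply]
      refine mul_mem (sum_mem fun l _ => mul_mem (h1 k l) (mem_range_ofComplex.2 (hx l))) ?_
      rw [mem_range_ofComplex, hz']
      simp
    · rw [twist_spHom hn]
      have : (p.2 : ℍ[ℝ]) * quatI = quatI * (p.2 : ℍ[ℝ]) := by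
        rw [hz', ← Quaternion.coeComplex_mul, mul_comm, Quaternion.coeComplex_mul]
      rw [this, mul_assoc, (Unitary.mem_iff.1 p.2.2).2, mul_one]
  · rintro ⟨h1, h2⟩
    have h3 : (p.2 : ℍ[ℝ]) * quatI = quatI * (p.2 : ℍ[ℝ]) := by
      rw [twist_spHom hn] at h2
      conv_rhs => rw [← h2]
      rw [mul_assoc, (Unitary.mem_iff.1 p.2.2).1, mul_one]
    have h4 : (p.2 : ℍ[ℝ]) ∈ Quaternion.ofComplex.range := by
      have e1 := congrArg (fun q : ℍ[ℝ] => q.imJ) h3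
      have e2 := congrArg (fun q : ℍ[ℝ] => q.imK) h3
      simp at e1 e2
      exact mem_range_ofComplex.2 ⟨by linarith, by linarith⟩
    refine ⟨fun k l => ?_, h4⟩
    have h5 : (spHom p).1 (stdVec ℍ[ℝ] l) ∈ complexSubspace n := by
      rw [← h1]
      exact apply_mem_imageUnder (stdVec_mem_complexSubspace l)
    have h6 := mem_range_ofComplex.2 (h5 k)
    rw [spHom_apply, rightMul_apply, unitaryHom_stdVec] at h6
    have h7 := mul_mem h6 h4
    rwa [mul_assoc, (Unitary.mem_iff.1 p.2.2).1, mul_one] at h7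

theorem mem_map_unitaryPairs_iff (hn : 1 ≤ n) (g : twistedGroup ℍ[ℝ] n) :
    g ∈ (unitaryPairs n).map spHom ↔ imageUnder g (complexSubspace n) = complexSubspace n ∧
      twist g quatI = quatI := by
  constructor
  · rintro ⟨p, hp, rfl⟩
    exact (mem_unitaryPairs_iff hn p).1 hp
  · intro h
    obtain ⟨p, rfl⟩ := spHom_surjective hn g
    exact ⟨p, (mem_unitaryPairs_iff hn p).2 h, rfl⟩

/-- The image of `(j, j)`. -/
noncomputable def jElement (n : ℕ) : twistedGroup ℍ[ℝ] n := spHom (scalarJ n, quaternionJ)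

theorem twist_jElement (hn : 1 ≤ n) : twist (jElement n) quatI = -quatI := by
  rw [jElement, twist_spHom hn]
  change quatJ * quatI * star quatJ = -quatI
  rw [star_quatJ, quatJ_mul_quatI, neg_mul_neg, mul_assoc, quatJ_mul_quatJ, mul_neg_one]

theorem imageUnder_jElement : imageUnder (jElement n) (complexSubspace n) = complexSubspace n := by
  refine imageUnder_eq_of_le le_rfl fun x hx k => ?_
  have : (jElement n).1 x k = quatJ * x k * star quatJ := by
    rw [jElement, spHom_apply, rightMul_apply, unitaryHom_apply]
    change (∑ l, Matrix.diagonal (fun _ => quatJ) k l * x l) * star quatJ = _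
    simp [Matrix.diagonal_apply]
  rw [this, star_quatJ]
  simp [(hx k).1, (hx k).2]

theorem twist_mul_jElement (hn : 1 ≤ n) (g : twistedGroup ℍ[ℝ] n) :
    twist (g * jElement n) quatI = -twist g quatI := by
  rw [twist_mul hn, twist_jElement hn, map_neg]

theorem imageUnder_mul_jElement (g : twistedGroup ℍ[ℝ] n) :
    imageUnder (g * jElement n) (complexSubspace n) = imageUnder g (complexSubspace n) := by
  rw [imageUnder_mul, imageUnder_jElement]

/-- The twist of a stabilizing element sends i to ±i. In the case of the sign -, multiplication by
the image of (j, j) leads back to U(n)U(1). -/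
theorem mem_map_extendedUnitaryPairs_iff (hn : 1 ≤ n) (g : twistedGroup ℍ[ℝ] n) :
    imageUnder g (complexSubspace n) = complexSubspace n ↔
      g ∈ (extendedUnitaryPairs n).map spHom := by
  let S : Subgroup (twistedGroup ℍ[ℝ] n) :=
    { carrier := {g | imageUnder g (complexSubspace n) = complexSubspace n}
      mul_mem' := fun {a b} ha hb => by
        change imageUnder (a * b) _ = _
        rw [imageUnder_mul, hb, ha]
      one_mem' := imageUnder_one _
      inv_mem' := fun h => imageUnder_inv_of_eq h }
  have hjj : jElement n ∈ (extendedUnitaryPairs n).map spHom :=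
    ⟨_, Subgroup.mem_sup_right (Subgroup.mem_zpowers _), rfl⟩
  have hle : (unitaryPairs n).map spHom ≤ (extendedUnitaryPairs n).map spHom :=
    Subgroup.map_mono le_sup_left
  constructor
  · intro h
    rcases twist_quatI_of_stabilizer hn h with h1 | h1
    · exact hle ((mem_map_unitaryPairs_iff hn g).2 ⟨h, h1⟩)
    · have h2 : g * jElement n ∈ (unitaryPairs n).map spHom := by
        rw [mem_map_unitaryPairs_iff hn, imageUnder_mul_jElement, twist_mul_jElement hn, h1, neg_neg]
        exact ⟨h, rfl⟩
      exact (Subgroup.mul_mem_cancel_right _ hjj).1 (hle h2)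
  · intro h
    have : (extendedUnitaryPairs n).map spHom ≤ S := by
      rw [Subgroup.map_le_iff_le_comap, extendedUnitaryPairs, sup_le_iff, Subgroup.zpowers_le]
      exact ⟨fun p hp => ((mem_unitaryPairs_iff hn p).1 hp).1, imageUnder_jElement⟩
    exact this h

theorem relIndex_unitaryPairs (hn : 1 ≤ n) :
    ((unitaryPairs n).map spHom).relIndex ((extendedUnitaryPairs n).map spHom) = 2 := by
  rw [Subgroup.relIndex_eq_two_iff]
  refine ⟨jElement n, (mem_map_extendedUnitaryPairs_iff hn _).1 imageUnder_jElement,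
    fun g hg => ?_⟩
  have h := (mem_map_extendedUnitaryPairs_iff hn _).2 hg
  have hne : -quatI ≠ quatI := fun e => by
    have := congrArg (fun q : ℍ[ℝ] => q.imI) e
    norm_num at this
  rw [mem_map_unitaryPairs_iff hn, mem_map_unitaryPairs_iff hn, imageUnder_mul_jElement,
    twist_mul_jElement hn]
  rcases twist_quatI_of_stabilizer hn h with h1 | h1
  · rw [h1]
    exact Or.inr ⟨⟨h, rfl⟩, fun e => hne e.2⟩
  · rw [h1, neg_neg]
    exact Or.inl ⟨⟨h, rfl⟩, fun e => hne e.2⟩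

theorem isHomogeneousSpace_quaternion (hn : 1 ≤ n) :
    IsHomogeneousSpace ((extendedUnitaryPairs n).map spHom) (complexSubspace n) :=
  isHomogeneousSpace_of_stabilizer hn isHalfLagrangian_complexSubspace
    (fun _ hC => exists_imageUnder_complexSubspace hn hC)
    (mem_map_extendedUnitaryPairs_iff hn)

/-! ### Polarized Lagrangian subspaces -/

/-- Choice gives no continuity, but θ_g(x) = herm(g e, g(e x)) for a basis vector e, because `herm
(g e) (g e) = 1`; this expression is visibly continuous in `g`. -/
theorem continuous_twist (hn : 1 ≤ n) (x : ℍ[ℝ]) :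
    Continuous fun g : twistedGroup ℍ[ℝ] n => twist g x := by
  let e : LinSpace ℍ[ℝ] n := stdVec ℍ[ℝ] ⟨0, hn⟩
  have h : ∀ g : twistedGroup ℍ[ℝ] n, twist g x = ∑ k, star (g.1 e k) * g.1 (rightMul e x) k :=
    fun g => by
      have h1 : herm (g.1 e) (g.1 e) = 1 := by
        have h2 : herm e e = 1 := by rw [herm_stdVec, if_pos rfl]
        rw [← h2]
        refine herm_eq_of_inner fun y => ?_
        have h3 := inner_rightMul_same (g.1 e) 1 y
        have h4 := inner_rightMul_same e 1 y
        rw [rightMul_one] at h3 h4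
        rw [h3, h4, LinearIsometryEquiv.norm_map]
      rw [← herm_def, apply_rightMul, herm_rightMul_right, h1, one_mul]
  simp_rw [h]
  refine continuous_finsetSum _ fun k _ => ?_
  exact (continuous_star.comp ((PiLp.continuous_apply 2 _ k).comp
    (twistedGroup.continuous_apply _))).mul
      ((PiLp.continuous_apply 2 _ k).comp (twistedGroup.continuous_apply _))

theorem PolarizedLagrangian.ext_iff {p q : PolarizedLagrangian n} :
    p = q ↔ p.1.1 = q.1.1 ∧ p.1.2 = q.1.2 := by
  rw [← Prod.ext_iff]
  exact Subtype.ext_iff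

instance : T2Space (PolarizedLagrangian n) :=
  T2Space.of_injective_continuous
    (f := fun p : PolarizedLagrangian n => (p.1.1.starProjection, p.1.2))
    (fun p q h => by
      obtain ⟨h1, h2⟩ := Prod.mk.inj h
      exact PolarizedLagrangian.ext_iff.2 ⟨starProjection_injective h1, h2⟩)
    continuous_induced_dom

/-- The pair `(g ℂⁿ, θ_g(i))`. -/
noncomputable def polarizedImage (hn : 1 ≤ n) (g : twistedGroup ℍ[ℝ] n) : PolarizedLagrangian n :=
  ⟨(imageUnder g (complexSubspace n), twist g quatI),
    isHalfLagrangian_complexSubspace.imageUnder hn g, twist_imPart hn g quatI_mem_imPart,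
    norm_twist_quatI g,
    imageUnder_rightMul_mem rfl fun _ hc => rightMul_quatI_mem_complexSubspace hc⟩

theorem continuous_polarizedImage (hn : 1 ≤ n) :
    Continuous (polarizedImage hn : twistedGroup ℍ[ℝ] n → _) :=
  continuous_induced_rng.2
    ((continuous_starProjection_imageUnder (complexSubspace n)).prodMk
      (continuous_twist hn quatI))

/-- Transported back to ℂⁿ, the vector `v` becomes ±i; the sign - is repaired by the image of (j,
j), which preserves ℂⁿ. -/
theorem polarizedImage_surjective (hn : 1 ≤ n) :
    Function.Surjective (polarizedImage hn : twistedGroup ℍ[ℝ] n → _) := by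
  rintro ⟨⟨C, v⟩, hC, hv, hvn, hCv⟩
  dsimp only at hC hv hvn hCv
  obtain ⟨g, rfl⟩ := exists_imageUnder_complexSubspace hn hC
  have h := eq_quatI_or_neg hn (twist_imPart hn g⁻¹ hv)
    (by rw [LinearIsometryEquiv.norm_map, hvn])
    (imageUnder_rightMul_mem (imageUnder_inv_of_eq rfl) hCv)
  rcases h with h | h
  · refine ⟨g, PolarizedLagrangian.ext_iff.2 ⟨rfl, ?_⟩⟩
    change twist g quatI = v
    rw [← h, twist_inv hn]
  · refine ⟨g * jElement n, PolarizedLagrangian.ext_iff.2 ⟨imageUnder_mul_jElement g, ?_⟩⟩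
    change twist (g * jElement n) quatI = v
    rw [twist_mul_jElement hn, ← map_neg, ← h, twist_inv hn]

theorem polarizedImage_eq_iff (hn : 1 ≤ n) (g h : twistedGroup ℍ[ℝ] n) :
    polarizedImage hn g = polarizedImage hn h ↔ g⁻¹ * h ∈ (unitaryPairs n).map spHom := by
  rw [PolarizedLagrangian.ext_iff, mem_map_unitaryPairs_iff hn, ← imageUnder_eq_imageUnder_iff,
    twist_mul hn]
  refine and_congr_right fun _ => ⟨fun e => ?_, fun e => ?_⟩
  · have e' : twist g quatI = twist h quatI := e
    rw [← e', twist_inv' hn]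
  · change twist g quatI = twist h quatI
    rw [← twist_inv hn g (twist h quatI), e]

theorem exists_polarizedLagrangian_homeomorph (hn : 1 ≤ n) :
    ∃ h : (twistedGroup ℍ[ℝ] n ⧸ (unitaryPairs n).map spHom) ≃ₜ PolarizedLagrangian n,
      ∀ g : twistedGroup ℍ[ℝ] n, (h g).1.1 = imageUnder g (complexSubspace n) ∧
        ∀ v : LinSpace ℍ[ℝ] n,
          g.1 (rightMul v ((Complex.I : ℂ) : ℍ[ℝ])) = rightMul (g.1 v) (h g).1.2 := by
  obtain ⟨h, hh⟩ := exists_quotient_homeomorph _ (polarizedImage hn)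
    (continuous_polarizedImage hn) (polarizedImage_surjective hn) (polarizedImage_eq_iff hn)
  refine ⟨h, fun g => ?_⟩
  rw [hh g]
  exact ⟨rfl, fun v => apply_rightMul g v _⟩

end QuaternionicLagrangian

/-! ### Even central elements of a Clifford algebra -/

section CliffordCenter

open CliffordAlgebra

/-- Both sides obey the same recursion under left multiplication by a vector. For even `x` the left
side is a commutator, so commuting with all vectors becomes vanishing of contractions. -/
theorem CliffordAlgebra.ι_mul_sub_involute_mul_ι {R M : Type*} [CommRing R] [AddCommGroup M]
    [Module R M] (Q : QuadraticForm R M) (v : M) (x : CliffordAlgebra Q) :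
    ι Q v * x - involute x * ι Q v = contractLeft (Q.polarBilin v) x := by
  induction x using CliffordAlgebra.left_induction with
  | algebraMap r =>
    rw [AlgHom.commutes, contractLeft_algebraMap, Algebra.commutes, sub_self]
  | add x y hx hy =>
    rw [mul_add, map_add, add_mul, map_add, ← hx, ← hy]
    abel
  | ι_mul x a hx =>
    rw [contractLeft_ι_mul, ← hx, map_mul, involute_ι]
    have h := CliffordAlgebra.ι_mul_ι_add_swap (Q := Q) v a
    rw [Algebra.smul_def]
    change _ = algebraMap R _ (QuadraticMap.polar Q v a) * x - _
    linear_combination (norm := noncomm_ring) h * x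

section Euler

variable {R M : Type*} [Field R] [CharZero R] [AddCommGroup M] [Module R M]
  {ι' : Type*} [Fintype ι'] (b : Module.Basis ι' R M)

/-- The Euler operator of the exterior algebra. -/
noncomputable def eulerOperator : ExteriorAlgebra R M →ₗ[R] ExteriorAlgebra R M :=
  ∑ i, LinearMap.mulLeft R (ExteriorAlgebra.ι R (b i)) ∘ₗ
    contractLeft (Q := (0 : QuadraticForm R M)) (b.coord i)

theorem eulerOperator_apply (x : ExteriorAlgebra R M) :
    eulerOperator b x = ∑ i, ExteriorAlgebra.ι R (b i) *
      contractLeft (Q := (0 : QuadraticForm R M)) (b.coord i) x := by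
  simp [eulerOperator, LinearMap.sum_apply]

/-- A Leibniz rule: the contractions of `a` itself add up to ∑ aᵢ bᵢ = a, and in the other terms two
sign changes cancel. -/
theorem eulerOperator_ι_mul (a : M) (x : ExteriorAlgebra R M) :
    eulerOperator b (ExteriorAlgebra.ι R a * x) =
      ExteriorAlgebra.ι R a * x + ExteriorAlgebra.ι R a * eulerOperator b x := by
  rw [eulerOperator_apply, eulerOperator_apply, Finset.mul_sum]
  have h : ∀ i, ExteriorAlgebra.ι R (b i) * contractLeft (Q := (0 : QuadraticForm R M)) (b.coord i)
      (ExteriorAlgebra.ι R a * x) = ExteriorAlgebra.ι R (b.repr a i • b i) * x +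
        ExteriorAlgebra.ι R a * (ExteriorAlgebra.ι R (b i) *
          contractLeft (Q := (0 : QuadraticForm R M)) (b.coord i) x) := fun i => by
    have h1 := contractLeft_ι_mul (Q := (0 : QuadraticForm R M)) (d := b.coord i) a x
    have h2 := ExteriorAlgebra.ι_add_mul_swap (R := R) a (b i)
    change contractLeft (Q := (0 : QuadraticForm R M)) (b.coord i)
      (ExteriorAlgebra.ι R a * x) = _ at h1
    rw [h1, mul_sub, mul_smul_comm, map_smul, smul_mul_assoc, Module.Basis.coord_apply, sub_eq_add_neg]
    congr 1
    change -(ExteriorAlgebra.ι R (b i) * (ExteriorAlgebra.ι R a * _)) = _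
    linear_combination (norm := noncomm_ring) -h2 *
      contractLeft (Q := (0 : QuadraticForm R M)) (b.coord i) x
  simp_rw [h]
  rw [Finset.sum_add_distrib, ← Finset.sum_mul, ← map_sum, b.sum_repr]

theorem eulerOperator_of_mem (k : ℕ) {x : ExteriorAlgebra R M} (hx : x ∈ ⋀[R]^k M) :
    eulerOperator b x = (k : R) • x := by
  induction hx using Submodule.pow_induction_on_left' with
  | algebraMap r =>
    rw [eulerOperator_apply]
    have h : ∀ i, contractLeft (Q := (0 : QuadraticForm R M)) (b.coord i)
        (algebraMap R (ExteriorAlgebra R M) r) = 0 := fun i =>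
      contractLeft_algebraMap (Q := (0 : QuadraticForm R M)) (b.coord i) r
    simp [h]
  | add x y i hx hy h1 h2 => rw [map_add, h1, h2, smul_add]
  | mem_mul m hm i x hx h =>
    obtain ⟨a, rfl⟩ := hm
    rw [eulerOperator_ι_mul, h, mul_smul_comm]
    push_cast
    rw [add_smul, one_smul, add_comm]

/-- The operator multiplies degree k by k, which is invertible in characteristic zero for k ≠ 0;
only degree zero can be in the kernel. -/
theorem exists_eq_algebraMap_of_eulerOperator {x : ExteriorAlgebra R M}
    (h : eulerOperator b x = 0) : ∃ r : R, x = algebraMap R _ r := by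
  classical
  have h1 : ∀ (y : ExteriorAlgebra R M) (k : ℕ),
      GradedAlgebra.proj (fun i : ℕ => ⋀[R]^i M) k (eulerOperator b y) =
        (k : R) • GradedAlgebra.proj (fun i : ℕ => ⋀[R]^i M) k y := by
    intro y k
    induction y using DirectSum.Decomposition.inductionOn (fun i : ℕ => ⋀[R]^i M) with
    | zero => simp
    | homogeneous m =>
      rename_i i
      rw [eulerOperator_of_mem b i m.2, map_smul]
      rcases eq_or_ne i k with rfl | hne
      · rfl
      · rw [GradedAlgebra.proj_apply, DirectSum.decompose_of_mem_ne (fun i : ℕ => ⋀[R]^i M) m.2 hne, smul_zero, smul_zero]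
    | add m m' h1 h2 => rw [map_add, map_add, map_add, h1, h2, smul_add]
  have h2 : ∀ k : ℕ, k ≠ 0 → GradedAlgebra.proj (fun i : ℕ => ⋀[R]^i M) k x = 0 := fun k hk => by
    have := h1 x k
    rw [h, map_zero, eq_comm, smul_eq_zero] at this
    exact this.resolve_left (by exact_mod_cast hk)
  have h3 : x ∈ ⋀[R]^0 M := by
    rw [← DirectSum.sum_support_decompose (fun i : ℕ => ⋀[R]^i M) x]
    refine sum_mem fun k _ => ?_
    rcases eq_or_ne k 0 with rfl | hk
    · exact Subtype.mem _
    · have := h2 k hk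
      rw [GradedAlgebra.proj_apply] at this
      rw [this]
      exact zero_mem _
  obtain ⟨r, hr⟩ := Submodule.mem_one.1 (by simpa using h3)
  exact ⟨r, hr.symm⟩

end Euler

/-- An even element commuting with all vectors is a scalar, if the form is nondegenerate. -/
theorem CliffordAlgebra.exists_eq_algebraMap_of_commute {R M : Type*} [Field R] [CharZero R]
    [AddCommGroup M] [Module R M] [FiniteDimensional R M] {Q : QuadraticForm R M}
    (hQ : ∀ d : Module.Dual R M, ∃ v, Q.polarBilin v = d) {x : CliffordAlgebra Q}
    (hx : involute x = x) (hc : ∀ v, ι Q v * x = x * ι Q v) : ∃ r : R, x = algebraMap R _ r := by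
  have : Invertible (2 : R) := invertibleOfNonzero two_ne_zero
  have h1 : ∀ d : Module.Dual R M, contractLeft d x = 0 := fun d => by
    obtain ⟨v, rfl⟩ := hQ d
    rw [← CliffordAlgebra.ι_mul_sub_involute_mul_ι, hx, hc, sub_self]
  let b := Module.finBasis R M
  have h2 : eulerOperator b (equivExterior Q x) = 0 := by
    rw [eulerOperator_apply]
    refine Finset.sum_eq_zero fun i _ => ?_
    -- The linear identification with the exterior algebra commutes with contractions, so the Euler
    -- operator kills the image of `x`.
    have h3 : contractLeft (Q := (0 : QuadraticForm R M)) (b.coord i) (equivExterior Q x) =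
        equivExterior Q (contractLeft (b.coord i) x) :=
      (changeForm_contractLeft (h := changeForm.associated_neg_proof) _ _).symm
    rw [h3, h1, map_zero, mul_zero]
  obtain ⟨r, hr⟩ := exists_eq_algebraMap_of_eulerOperator b h2
  refine ⟨r, (equivExterior Q).injective ?_⟩
  rw [hr]
  exact (changeForm_algebraMap (h := changeForm.associated_neg_proof) r).symm

end CliffordCenter

/-! ### The octonions as a composition algebra -/

section Octonions

theorem Octonion.ext {x y : Octonion} (h1 : x.fst = y.fst) (h2 : x.snd = y.snd) : x = y :=
  WithLp.ofLp_injective 2 (Prod.ext h1 h2)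

theorem Octonion.norm_sq (x : Octonion) :
    ‖x‖ ^ 2 = Quaternion.normSq x.fst + Quaternion.normSq x.snd := by
  rw [WithLp.prod_norm_sq_eq_of_L2, sq, sq, ← Quaternion.normSq_eq_norm_mul_self,
    ← Quaternion.normSq_eq_norm_mul_self]

instance : IsCompositionAlgebra Octonion where
  mul_add x y z := by
    apply Octonion.ext
    · simp only [Octonion.mul_fst, WithLp.add_fst, WithLp.add_snd]
      noncomm_ring
    · simp only [Octonion.mul_snd, WithLp.add_fst, WithLp.add_snd]
      noncomm_ring
  add_mul x y z := by
    apply Octonion.ext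
    · simp only [Octonion.mul_fst, WithLp.add_fst, WithLp.add_snd, star_add]
      noncomm_ring
    · simp only [Octonion.mul_snd, WithLp.add_fst, WithLp.add_snd, star_add]
      noncomm_ring
  mul_smul c x y := by
    apply Octonion.ext
    · simp [Octonion.mul_fst, smul_sub]
    · simp [Octonion.mul_snd, smul_add]
  smul_mul c x y := by
    apply Octonion.ext
    · simp [Octonion.mul_fst, smul_sub]
    · simp [Octonion.mul_snd, smul_add]
  mul_one x := by
    apply Octonion.ext
    · simp [Octonion.mul_fst, Octonion.one_fst, Octonion.one_snd]
    · simp [Octonion.mul_snd, Octonion.one_fst, Octonion.one_snd]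
  norm_mul x y := by
    -- In real coordinates this is the eight-square identity.
    rw [← sq_eq_sq₀ (norm_nonneg _) (by positivity), mul_pow, Octonion.norm_sq, Octonion.norm_sq,
      Octonion.norm_sq, Octonion.mul_fst, Octonion.mul_snd]
    simp only [Quaternion.normSq_def', Quaternion.re_mul, Quaternion.imI_mul, Quaternion.imJ_mul,
      Quaternion.imK_mul, Quaternion.re_star, Quaternion.imI_star, Quaternion.imJ_star,
      Quaternion.imK_star, Quaternion.re_sub, Quaternion.imI_sub, Quaternion.imJ_sub,
      Quaternion.imK_sub, Quaternion.re_add, Quaternion.imI_add, Quaternion.imJ_add,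
      Quaternion.imK_add]
    ring
  norm_one := by
    rw [← sq_eq_sq₀ (norm_nonneg _) (by positivity), Octonion.norm_sq]
    simp [Octonion.one_fst, Octonion.one_snd]

theorem Octonion.one_mul (x : Octonion) : 1 * x = x := by
  apply Octonion.ext
  · simp [Octonion.mul_fst, Octonion.one_fst, Octonion.one_snd]
  · simp [Octonion.mul_snd, Octonion.one_fst, Octonion.one_snd]

theorem Octonion.mul_mul_self {u : Octonion} (hu : u ∈ imPart Octonion) (v : Octonion) :
    v * u * u = -(‖u‖ ^ 2) • v := by
  have := LinearMap.congr_fun (rightMulHom_sq ⟨u, hu⟩) v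
  rwa [imForm_apply] at this

/-- The Clifford relation, by polarizing the square of right multiplication. -/
theorem Octonion.mul_mul_add_mul_mul {u w : Octonion} (hu : u ∈ imPart Octonion)
    (hw : w ∈ imPart Octonion) (v : Octonion) :
    v * u * w + v * w * u = -(2 * inner ℝ u w : ℝ) • v := by
  have h := Octonion.mul_mul_self (add_mem hu hw) v
  rw [norm_add_sq_real, IsCompositionAlgebra.mul_add, IsCompositionAlgebra.mul_add,
    IsCompositionAlgebra.add_mul, IsCompositionAlgebra.add_mul, Octonion.mul_mul_self hu,
    Octonion.mul_mul_self hw] at h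
  linear_combination (norm := module) h

theorem IsCompositionAlgebra.sub_mem_imPart {A : Type} [NormedAddCommGroup A]
    [InnerProductSpace ℝ A] [Mul A] [One A] [IsCompositionAlgebra A] (x : A) :
    x - (inner ℝ 1 x : ℝ) • (1 : A) ∈ imPart A := by
  rw [mem_imPart, inner_sub_right, inner_smul_right, real_inner_self_eq_norm_sq,
    IsCompositionAlgebra.norm_one]
  ring

theorem Octonion.finrank : Module.finrank ℝ Octonion = 8 := by
  rw [(WithLp.linearEquiv 2 ℝ (ℍ[ℝ] × ℍ[ℝ])).finrank_eq, Module.finrank_prod,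
    Quaternion.finrank_eq_four]

/-! ### The group `G_𝕆(1)` acting on `𝕆` -/

/-- The identification of `𝕆` with `𝕆¹`. -/
noncomputable def octonionVec : Octonion ≃ₗᵢ[ℝ] LinSpace Octonion 1 where
  toFun x := WithLp.toLp 2 fun _ => x
  invFun v := v 0
  map_add' x y := rfl
  map_smul' c x := rfl
  left_inv x := rfl
  right_inv v := by ext i; rw [Fin.fin_one_eq_zero i]
  norm_map' x := by
    rw [← sq_eq_sq₀ (norm_nonneg _) (norm_nonneg _), PiLp.norm_sq_eq_of_L2,
      Fin.sum_univ_one]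
    rfl

/-- The action of `G_𝕆(1)` on `𝕆`. -/
noncomputable def octonionAct : twistedGroup Octonion 1 →* (Octonion ≃ₗᵢ[ℝ] Octonion) where
  toFun g := (octonionVec.trans g.1).trans octonionVec.symm
  map_one' := by ext x; rfl
  map_mul' g h := by
    ext1 x
    change octonionVec.symm (g.1 (h.1 _)) =
      octonionVec.symm (g.1 (octonionVec (octonionVec.symm (h.1 _))))
    rw [LinearIsometryEquiv.apply_symm_apply]

theorem octonionVec_octonionAct (g : twistedGroup Octonion 1) (x : Octonion) :
    octonionVec (octonionAct g x) = g.1 (octonionVec x) :=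
  octonionVec.apply_symm_apply _

theorem apply_eq_octonionAct (g : twistedGroup Octonion 1) (v : LinSpace Octonion 1) (k : Fin 1) :
    g.1 v k = octonionAct g (v k) := by
  rw [Fin.fin_one_eq_zero k]
  change _ = (g.1 (octonionVec (octonionVec.symm v))) 0
  rw [LinearIsometryEquiv.apply_symm_apply]

theorem octonionAct_mul (g : twistedGroup Octonion 1) (x y : Octonion) :
    octonionAct g (x * y) = octonionAct g x * twist g y :=
  congrArg octonionVec.symm (apply_rightMul g (octonionVec x) y)

theorem octonionAct_injective : Function.Injective octonionAct := fun g h hgh => by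
  apply Subtype.ext
  ext1 v
  ext k
  rw [apply_eq_octonionAct, apply_eq_octonionAct, hgh]

theorem twist_eq_of_octonionAct {g : twistedGroup Octonion 1} {x y : Octonion}
    (h : ∀ v, octonionAct g (v * x) = octonionAct g v * y) : twist g x = y :=
  twist_eq le_rfl g fun v => by
    ext k
    rw [rightMul_apply, apply_eq_octonionAct, apply_eq_octonionAct]
    exact h _

/-- The element of `G_𝕆(1)` given by a pair of isometries `f`, `θ` with `f(vx) = f(v) θ(x)`. -/
noncomputable def twistedGroup.ofOctonion (f θ : Octonion ≃ₗᵢ[ℝ] Octonion)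
    (hθ : LinearMap.det (θ.toLinearEquiv : Octonion →ₗ[ℝ] Octonion) = 1)
    (h : ∀ v x, f (v * x) = f v * θ x) : twistedGroup Octonion 1 :=
  ⟨(octonionVec.symm.trans f).trans octonionVec, θ, hθ, fun v x => by
    ext k
    exact h _ x⟩

theorem octonionAct_ofOctonion (f θ : Octonion ≃ₗᵢ[ℝ] Octonion)
    (hθ : LinearMap.det (θ.toLinearEquiv : Octonion →ₗ[ℝ] Octonion) = 1)
    (h : ∀ v x, f (v * x) = f v * θ x) (x : Octonion) :
    octonionAct (twistedGroup.ofOctonion f θ hθ h) x = f x := rfl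

/-- Right multiplication by a unit octonion is an isometry. -/
noncomputable def Octonion.rightMulIsometry (u : Octonion) (hu : ‖u‖ = 1) :
    Octonion ≃ₗᵢ[ℝ] Octonion :=
  (⟨{ toFun := fun y => y * u
      map_add' := fun x y => IsCompositionAlgebra.add_mul x y u
      map_smul' := fun c x => IsCompositionAlgebra.smul_mul c x u }, fun x => by
    change ‖x * u‖ = ‖x‖
    rw [IsCompositionAlgebra.norm_mul, hu, mul_one]⟩ :
      Octonion →ₗᵢ[ℝ] Octonion).toLinearIsometryEquiv rfl

theorem det_reflection_trans_reflection {E : Type*} [NormedAddCommGroup E] [InnerProductSpace ℝ E]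
    [FiniteDimensional ℝ E] {u v : E} (hu : u ≠ 0) (hv : v ≠ 0) :
    LinearMap.det (((ℝ ∙ u).reflection.trans (ℝ ∙ v).reflection).toLinearEquiv : E →ₗ[ℝ] E) = 1 := by
  have h (w : E) (hw : w ≠ 0) : LinearMap.det ((ℝ ∙ w).reflection.toLinearEquiv : E →ₗ[ℝ] E) =
      (-1) ^ (Module.finrank ℝ E - 1) := by
    rw [Submodule.det_reflection]
    congr 1
    have := (ℝ ∙ w).finrank_add_finrank_orthogonal
    rw [finrank_span_singleton hw] at this
    omega
  change LinearMap.det (((ℝ ∙ v).reflection.toLinearEquiv : E →ₗ[ℝ] E) ∘ₗ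
    ((ℝ ∙ u).reflection.toLinearEquiv : E →ₗ[ℝ] E)) = 1
  rw [LinearMap.det_comp, h u hu, h v hv, ← mul_pow]
  simp

/-- The element of `G_𝕆(1)` given by right multiplication by a unit imaginary octonion. -/
theorem exists_rightMul_octonion {u : Octonion} (hu : u ∈ imPart Octonion) (hn : ‖u‖ = 1) :
    ∃ g : twistedGroup Octonion 1, (∀ y, octonionAct g y = y * u) ∧
      ∀ x ∈ imPart Octonion, twist g x = (2 * inner ℝ u x : ℝ) • u - x := by
  have hu0 : u ≠ 0 := fun h => by simp [h] at hn
  have h11 := IsCompositionAlgebra.norm_one (A := Octonion)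
  have h10 : (1 : Octonion) ≠ 0 := fun h => by simp [h] at h11
  have h1u : inner ℝ 1 u = 0 := mem_imPart.1 hu
  -- The Clifford relation dictates the twist: it fixes 1 and `u` and is -1 on their orthogonal
  -- complement, of even dimension 6, whence determinant 1.
  let θ := ((ℝ ∙ u).reflection.trans (ℝ ∙ (1 : Octonion)).reflection).trans
    (LinearIsometryEquiv.neg ℝ)
  have hdet : LinearMap.det (θ.toLinearEquiv : Octonion →ₗ[ℝ] Octonion) = 1 := by
    have h : (θ.toLinearEquiv : Octonion →ₗ[ℝ] Octonion) = (-1 : ℝ) •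
        (((ℝ ∙ u).reflection.trans (ℝ ∙ (1 : Octonion)).reflection).toLinearEquiv :
          Octonion →ₗ[ℝ] Octonion) := LinearMap.ext fun x => (neg_one_smul ℝ _).symm
    rw [h, LinearMap.det_smul, det_reflection_trans_reflection hu0 h10, Octonion.finrank]
    norm_num
  have hθ (x : Octonion) : θ x = (2 * inner ℝ 1 x : ℝ) • 1 + (2 * inner ℝ u x : ℝ) • u - x := by
    change -(ℝ ∙ (1 : Octonion)).reflection ((ℝ ∙ u).reflection x) = _
    rw [Submodule.reflection_singleton_apply, Submodule.reflection_singleton_apply, hn, h11,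
      inner_sub_right, inner_smul_right_eq_smul, inner_smul_right, h1u]
    simp only [RCLike.ofReal_real_eq_id, id_eq, one_pow, div_one, two_smul, two_mul, add_smul]
    module
  have h (v x : Octonion) : v * x * u = v * u * θ x := by
    have hw := IsCompositionAlgebra.sub_mem_imPart x
    set a : ℝ := inner ℝ 1 x with ha
    have hx : x = a • 1 + (x - a • (1 : Octonion)) := by abel
    have h := Octonion.mul_mul_add_mul_mul hu hw v
    have hi : inner ℝ u (x - a • (1 : Octonion)) = (inner ℝ u x : ℝ) := by
      rw [inner_sub_right, inner_smul_right, real_inner_comm 1 u, h1u]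
      ring
    have e1 : v * x = a • v + v * (x - a • (1 : Octonion)) := by
      conv_lhs => rw [hx]
      rw [IsCompositionAlgebra.mul_add, IsCompositionAlgebra.mul_smul, IsCompositionAlgebra.mul_one]
    have e2 : v * u * x = a • (v * u) + v * u * (x - a • (1 : Octonion)) := by
      conv_lhs => rw [hx]
      rw [IsCompositionAlgebra.mul_add, IsCompositionAlgebra.mul_smul, IsCompositionAlgebra.mul_one]
    have e3 : v * u * θ x = (2 * a) • (v * u) + (2 * inner ℝ u x : ℝ) • (v * u * u) - v * u * x := by
      have := map_sub (LinearMap.mk₂ ℝ (fun a b : Octonion => a * b) IsCompositionAlgebra.add_mul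
        IsCompositionAlgebra.smul_mul IsCompositionAlgebra.mul_add IsCompositionAlgebra.mul_smul
          (v * u)) ((2 * a) • 1 + (2 * inner ℝ u x : ℝ) • u) x
      simp only [LinearMap.mk₂_apply] at this
      rw [hθ, this, IsCompositionAlgebra.mul_add, IsCompositionAlgebra.mul_smul,
        IsCompositionAlgebra.mul_smul, IsCompositionAlgebra.mul_one]
    rw [hi] at h
    rw [e3, e1, IsCompositionAlgebra.add_mul, IsCompositionAlgebra.smul_mul, e2,
      Octonion.mul_mul_self hu, hn]
    linear_combination (norm := module) h
  refine ⟨twistedGroup.ofOctonion (Octonion.rightMulIsometry u hn) θ hdet h, fun y => rfl,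
    fun x hx => ?_⟩
  rw [twist_eq_of_octonionAct (y := θ x) fun v => h v x, hθ, mem_imPart.1 hx]
  simp

end Octonions

/-! ### The group `Spin(7)` -/

section SpinSeven

/-- Such a map commutes with all right multiplications, so it is left multiplication by a = ψ(1)
with a(vx) = (av)x. Testing v in ℍ ⊕ 0 against x in 0 ⊕ ℍ, noncommutativity of ℍ kills the second
component of a and makes the first one central; being a unit, a is ±1. -/
theorem octonionAct_of_twist_eq_id {ψ : twistedGroup Octonion 1}
    (h : ∀ x ∈ imPart Octonion, twist ψ x = x) :
    (∀ y, octonionAct ψ y = y) ∨ ∀ y, octonionAct ψ y = -y := by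
  have ht (x : Octonion) : twist ψ x = x := by
    have h1 := h _ (IsCompositionAlgebra.sub_mem_imPart x)
    rw [map_sub, map_smul, twist_map_one le_rfl] at h1
    exact sub_left_injective h1
  have ha (v x : Octonion) : octonionAct ψ (v * x) = octonionAct ψ v * x := by
    rw [octonionAct_mul, ht]
  set a := octonionAct ψ 1 with ha1
  have hm (y : Octonion) : octonionAct ψ y = a * y := by rw [ha1, ← ha, Octonion.one_mul]
  have key (v d : ℍ[ℝ]) : star v * d * star a.snd = d * (star a.snd * star v) ∧
      star a.fst * (star v * d) = star v * star a.fst * d := by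
    have h1 := ha (WithLp.toLp 2 (v, 0)) (WithLp.toLp 2 (0, d))
    rw [hm, hm] at h1
    have h2 := congrArg WithLp.fst h1
    have h3 := congrArg WithLp.snd h1
    simp only [Octonion.mul_fst, Octonion.mul_snd] at h2 h3
    constructor
    · simpa using h2
    · simpa using h3
  have hb : a.snd = 0 := by
    have h1 := (key quatI quatJ).1
    have h2 := (key quatI 1).1
    rw [one_mul, mul_one] at h2
    rw [← h2, ← mul_assoc, ← sub_eq_zero, ← sub_mul, mul_eq_zero] at h1
    rcases h1 with h1 | h1
    · exfalso
      have := congrArg (fun x : ℍ[ℝ] => x.imK) h1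
      simp at this
      norm_num at this
    · simpa using h1
  have hn : ‖a.fst‖ = 1 := by
    have h1 : ‖a‖ = 1 := by
      rw [ha1, LinearIsometryEquiv.norm_map, IsCompositionAlgebra.norm_one]
    have h2 := Octonion.norm_sq a
    rw [h1, hb, map_zero, add_zero, Quaternion.normSq_eq_norm_mul_self] at h2
    nlinarith [norm_nonneg a.fst]
  have hc := eq_one_or_neg_one_of_commute (β := ⟨a.fst, mem_unitary_of_norm hn⟩) fun x => by
    have h1 := (key x 1).2
    rw [mul_one, mul_one] at h1
    simpa using congrArg star h1.symm
  rcases hc with hc | hc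
  · left
    intro y
    rw [hm, show a = 1 from Octonion.ext hc hb, Octonion.one_mul]
  · right
    intro y
    change a.fst = -1 at hc
    rw [hm]
    apply Octonion.ext
    · simp [Octonion.mul_fst, hc, hb]
    · simp [Octonion.mul_snd, hc, hb]

theorem spinRep_ι (u : imPart Octonion) (y : Octonion) :
    spinRep (CliffordAlgebra.ι imForm u) y = y * (u : Octonion) := by
  rw [spinRep, CliffordAlgebra.lift_ι_apply, rightMulHom_apply]

theorem ι_mul_ι_of_norm_eq_one {u : imPart Octonion} (hu : ‖(u : Octonion)‖ = 1) :
    CliffordAlgebra.ι imForm u * CliffordAlgebra.ι imForm u = -1 := by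
  rw [CliffordAlgebra.ι_sq_scalar, imForm_apply, hu]
  simp

theorem ι_mem_pinGroup {u : imPart Octonion} (hu : ‖(u : Octonion)‖ = 1) :
    CliffordAlgebra.ι imForm u ∈ pinGroup imForm := by
  have h := ι_mul_ι_of_norm_eq_one hu
  refine pinGroup.mem_iff.2 ⟨⟨⟨CliffordAlgebra.ι imForm u, -CliffordAlgebra.ι imForm u,
    by rw [mul_neg, h, neg_neg], by rw [neg_mul, h, neg_neg]⟩, ?_, rfl⟩, ?_⟩
  · exact Subgroup.subset_closure ⟨u, rfl⟩
  · rw [Unitary.mem_iff, CliffordAlgebra.star_ι, neg_mul, mul_neg, h, neg_neg]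
    exact ⟨rfl, rfl⟩

/-- Every isometry of `Im 𝕆` is, up to sign, the twist of a product of imaginary units. -/
theorem exists_pin_of_isometry (T : imPart Octonion ≃ₗᵢ[ℝ] imPart Octonion) :
    ∃ (k : ℕ) (s : CliffordAlgebra imForm) (g : twistedGroup Octonion 1),
      s ∈ pinGroup imForm ∧ s ∈ CliffordAlgebra.evenOdd imForm k ∧
      (∀ y, spinRep s y = octonionAct g y) ∧
      ∀ x : imPart Octonion, twist g x = (-1 : ℝ) ^ k • (T x : Octonion) := by
  obtain ⟨l, -, rfl⟩ := LinearIsometryEquiv.reflections_generate_dim T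
  -- By Cartan-Dieudonné the isometry is a product of hyperplane reflections, and each one is
  -- realized by one more factor R_u.
  induction l with
  | nil =>
    refine ⟨0, 1, 1, one_mem _, ?_, fun y => by simp, fun x => ?_⟩
    · rw [Nat.cast_zero, ← CliffordAlgebra.even_toSubmodule]
      exact one_mem (CliffordAlgebra.even imForm)
    · rw [pow_zero, one_smul]
      exact twist_eq_of_octonionAct fun v => rfl
  | cons v l ih =>
    obtain ⟨k, s, g, hs, hk, hg, ht⟩ := ih
    -- The list of reflections may contain the zero vector, whose reflection is the identity.
    rcases eq_or_ne v 0 with rfl | hv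
    · refine ⟨k, s, g, hs, hk, hg, fun x => ?_⟩
      rw [ht, List.map_cons, List.prod_cons]
      congr 2
      rw [LinearIsometryEquiv.coe_mul, Function.comp_apply, Submodule.reflection_orthogonal_apply,
        Submodule.reflection_singleton_apply]
      simp
    · set u := ‖v‖⁻¹ • v with hu
      have hu1 : ‖u‖ = 1 := norm_smul_inv_norm (𝕜 := ℝ) hv
      obtain ⟨r, hr, hr'⟩ := exists_rightMul_octonion u.2 hu1
      refine ⟨k + 1, CliffordAlgebra.ι imForm u * s, r * g, mul_mem (ι_mem_pinGroup hu1) hs, ?_,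
        fun y => ?_, fun x => ?_⟩
      · rw [Nat.cast_succ, add_comm]
        exact CliffordAlgebra.evenOdd_mul_le _ _ _
          (Submodule.mul_mem_mul (CliffordAlgebra.ι_mem_evenOdd_one _ u) hk)
      · rw [map_mul, map_mul, Module.End.mul_apply, LinearIsometryEquiv.coe_mul,
          Function.comp_apply, hr, spinRep_ι, hg]
      -- The twist of R_u is minus the reflection in the hyperplane orthogonal to `v`; the minus
      -- sign raises the exponent of -1 by one.
      · rw [twist_mul le_rfl, ht, map_smul, hr' _ (Subtype.prop _), List.map_cons, List.prod_cons,
          pow_succ, mul_smul ((-1 : ℝ) ^ k)]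
        refine congrArg _ ?_
        rw [neg_one_smul, LinearIsometryEquiv.coe_mul, Function.comp_apply]
        set z := (List.map (fun v => (ℝ ∙ v)ᗮ.reflection) l).prod x
        rw [Submodule.reflection_orthogonal_apply, Submodule.reflection_singleton_apply]
        have hi : inner ℝ (u : Octonion) (z : Octonion) = ‖v‖⁻¹ * inner ℝ v z := by
          change inner ℝ u z = _
          rw [hu, real_inner_smul_left]
        rw [hi, hu]
        push_cast
        rw [neg_neg, smul_smul, two_smul, ← add_smul]
        congr 2
        simp only [RCLike.ofReal_real_eq_id, id_eq]
        field_simp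
        ring

/-- The Clifford element -1 is the square of a unit vector, hence an even product of vectors. -/
theorem exists_octonionAct_neg : ∃ s ∈ spinGroup imForm, ∃ g : twistedGroup Octonion 1,
    (∀ y, octonionAct g y = -y) ∧ ∀ y, spinRep s y = -y := by
  have h1 : ‖(WithLp.toLp 2 (0, 1) : Octonion)‖ = 1 := by
    rw [← sq_eq_sq₀ (norm_nonneg _) (by positivity), Octonion.norm_sq]
    simp
  have hm : (WithLp.toLp 2 (0, 1) : Octonion) ∈ imPart Octonion := by
    rw [mem_imPart, WithLp.prod_inner_apply]
    change inner ℝ (1 : ℍ[ℝ]) 0 + inner ℝ (0 : ℍ[ℝ]) 1 = (0 : ℝ)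
    simp
  obtain ⟨g, hg, -⟩ := exists_rightMul_octonion hm h1
  have hι := ι_mul_ι_of_norm_eq_one (u := ⟨_, hm⟩) h1
  refine ⟨-1, ?_, g * g, fun y => ?_, fun y => ?_⟩
  · rw [← hι]
    refine ⟨mul_mem (ι_mem_pinGroup h1) (ι_mem_pinGroup h1), ?_⟩
    rw [hι]
    exact (CliffordAlgebra.even imForm).neg_mem (one_mem _)
  · rw [map_mul, LinearIsometryEquiv.coe_mul, Function.comp_apply, hg, hg,
      Octonion.mul_mul_self hm, h1]
    simp
  · simp

/-- The representation respects `star` because `star` negates vectors and R_u is skew adjoint.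
Elements with s* s = 1 therefore act isometrically. -/
theorem inner_spinRep (s : CliffordAlgebra imForm) : ∀ y z : Octonion,
    inner ℝ (spinRep s y) z = inner ℝ y (spinRep (star s) z) := by
  induction s using CliffordAlgebra.induction with
  | algebraMap r =>
    intro y z
    rw [CliffordAlgebra.star_algebraMap, AlgHom.commutes, Module.algebraMap_end_apply,
      Module.algebraMap_end_apply, real_inner_smul_left, real_inner_smul_right]
  | ι u =>
    intro y z
    rw [CliffordAlgebra.star_ι, map_neg, LinearMap.neg_apply, spinRep_ι, spinRep_ι, inner_neg_right]
    have := inner_rightMul_left_of_imPart u.2 (octonionVec y) (octonionVec z)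
    rwa [show rightMul (octonionVec y) (u : Octonion) = octonionVec (y * u) from rfl,
      show rightMul (octonionVec z) (u : Octonion) = octonionVec (z * u) from rfl,
      LinearIsometryEquiv.inner_map_map, LinearIsometryEquiv.inner_map_map] at this
  | mul a b ha hb =>
    intro y z
    rw [star_mul, map_mul, map_mul, Module.End.mul_apply, Module.End.mul_apply, ha, hb]
  | add a b ha hb =>
    intro y z
    rw [star_add, map_add, map_add, LinearMap.add_apply, LinearMap.add_apply, inner_add_left,
      inner_add_right, ha, hb]

/-- The generators are invertible vectors v, acting as ‖v‖ times R_u with u = v/‖v‖; the property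
passes to products and inverses. -/
theorem spinRep_lipschitzGroup {x : (CliffordAlgebra imForm)ˣ} (hx : x ∈ lipschitzGroup imForm) :
    ∃ c : ℝ, 0 < c ∧ ∃ g : twistedGroup Octonion 1, ∀ y, spinRep x y = c • octonionAct g y := by
  induction hx using Subgroup.closure_induction with
  | mem x hx =>
    obtain ⟨v, hv⟩ := hx
    have hv0 : v ≠ 0 := by
      rintro rfl
      have h := congrArg (fun s => spinRep s (1 : Octonion)) x.mul_inv
      simp only [← hv, map_zero, zero_mul, map_one, LinearMap.zero_apply, Module.End.one_apply] at h
      have h1 := IsCompositionAlgebra.norm_one (A := Octonion)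
      simp [← h] at h1
    have hn : ‖v‖ ≠ 0 := norm_ne_zero_iff.2 hv0
    obtain ⟨r, hr, -⟩ := exists_rightMul_octonion (‖v‖⁻¹ • v).2 
      (show ‖‖v‖⁻¹ • v‖ = 1 from norm_smul_inv_norm (𝕜 := ℝ) hv0)
    refine ⟨‖v‖, norm_pos_iff.2 hv0, r, fun y => ?_⟩
    rw [← hv, spinRep_ι, hr, Submodule.coe_smul, IsCompositionAlgebra.mul_smul, smul_smul,
      mul_inv_cancel₀ hn, one_smul]
  | one => exact ⟨1, one_pos, 1, fun y => by simp⟩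
  | mul x y _ _ hx hy =>
    obtain ⟨c, hc, g, hg⟩ := hx
    obtain ⟨d, hd, h, hh⟩ := hy
    refine ⟨c * d, mul_pos hc hd, g * h, fun z => ?_⟩
    rw [Units.val_mul, map_mul, Module.End.mul_apply, hh, map_smul, hg, map_mul, mul_comm,
      mul_smul]
    rfl
  | inv x _ hx =>
    obtain ⟨c, hc, g, hg⟩ := hx
    refine ⟨c⁻¹, inv_pos.2 hc, g⁻¹, fun y => ?_⟩
    have h : spinRep x (c⁻¹ • octonionAct g⁻¹ y) = y := by
      rw [hg, map_smul, smul_smul, mul_inv_cancel₀ hc.ne', one_smul, map_inv]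
      exact (octonionAct g).apply_symm_apply y
    conv_lhs => rw [← h]
    rw [← Module.End.mul_apply, ← map_mul, Units.inv_mul, map_one, Module.End.one_apply]

theorem exists_octonionAct_eq_spinRep (s : SpinSeven) :
    ∃ g : twistedGroup Octonion 1, ∀ y, octonionAct g y = spinRep (s : CliffordAlgebra imForm) y := by
  obtain ⟨⟨⟨x, hx, hxs⟩, hu⟩, -⟩ := s.2
  obtain ⟨c, hc, g, hg⟩ := spinRep_lipschitzGroup hx
  change (x : CliffordAlgebra imForm) = s at hxs
  rw [hxs] at hg
  refine ⟨g, fun y => ?_⟩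
  -- A spin element is unitary, so it preserves the norm of 1 and the positive factor is 1.
  suffices c = 1 by rw [hg, this, one_smul]
  have h := inner_spinRep s 1 (spinRep s 1)
  rw [← Module.End.mul_apply, ← map_mul, (Unitary.mem_iff.1 hu).1, map_one spinRep, Module.End.one_apply,
    real_inner_self_eq_norm_sq, real_inner_self_eq_norm_sq, hg, norm_smul,
    LinearIsometryEquiv.norm_map, IsCompositionAlgebra.norm_one, mul_one, one_pow,
    Real.norm_of_nonneg hc.le] at h
  nlinarith

/-- The spin representation as a homomorphism to `G_𝕆(1)`. -/
noncomputable def spinHom : SpinSeven →* twistedGroup Octonion 1 where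
  toFun s := (exists_octonionAct_eq_spinRep s).choose
  map_one' := octonionAct_injective (LinearIsometryEquiv.ext fun y => by
    rw [(exists_octonionAct_eq_spinRep 1).choose_spec]
    simp)
  map_mul' s t := octonionAct_injective (LinearIsometryEquiv.ext fun y => by
    rw [(exists_octonionAct_eq_spinRep _).choose_spec, map_mul, LinearIsometryEquiv.coe_mul,
      Function.comp_apply, (exists_octonionAct_eq_spinRep _).choose_spec,
      (exists_octonionAct_eq_spinRep _).choose_spec, Submonoid.coe_mul, map_mul,
      Module.End.mul_apply])

theorem octonionAct_spinHom (s : SpinSeven) (y : Octonion) :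
    octonionAct (spinHom s) y = spinRep (s : CliffordAlgebra imForm) y :=
  (exists_octonionAct_eq_spinRep s).choose_spec y

theorem exists_polarBilin_imForm_eq (d : Module.Dual ℝ (imPart Octonion)) :
    ∃ v, imForm.polarBilin v = d := by
  -- The polar form of -|u|² is -2⟨u, v⟩, whence the factor -1/2 on the Riesz vector.
  refine ⟨(-1 / 2 : ℝ) • (InnerProductSpace.toDual ℝ (imPart Octonion)).symm
    (LinearMap.toContinuousLinearMap d), LinearMap.ext fun w => ?_⟩
  set v := (InnerProductSpace.toDual ℝ (imPart Octonion)).symm (LinearMap.toContinuousLinearMap d)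
    with hv
  have h : inner ℝ v w = d w := by
    rw [hv, InnerProductSpace.toDual_symm_apply]
    rfl
  rw [map_smul, LinearMap.smul_apply, QuadraticMap.polarBilin_apply_apply, QuadraticMap.polar,
    imForm_apply, imForm_apply, imForm_apply]
  change (-1 / 2 : ℝ) • (-‖v + w‖ ^ 2 - -‖v‖ ^ 2 - -‖w‖ ^ 2) = _
  rw [norm_add_sq_real, h, smul_eq_mul]
  ring

/-- Conjugation by `s` sends a vector v to a vector w. If `s` acts trivially, applying both sides to
the octonion 1 gives w = v, so `s` commutes with all vectors. Being even it is a scalar, and the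
scalar is 1. -/
theorem spinHom_injective : Function.Injective spinHom := by
  refine (injective_iff_map_eq_one spinHom).2 fun s hs => ?_
  have h1 : spinRep (s : CliffordAlgebra imForm) = 1 := LinearMap.ext fun y => by
    rw [← octonionAct_spinHom, hs, map_one]
    rfl
  let : Invertible (2 : ℝ) := invertibleOfNonzero two_ne_zero
  have hc (v : imPart Octonion) : CliffordAlgebra.ι imForm v * s = s * CliffordAlgebra.ι imForm v := by
    obtain ⟨w, hw⟩ := spinGroup.conjAct_smul_ι_mem_range_ι (x := spinGroup.toUnits s) s.2 v
    rw [ConjAct.units_smul_def, ConjAct.ofConjAct_toConjAct] at hw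
    have hw2 : CliffordAlgebra.ι imForm w * s = s * CliffordAlgebra.ι imForm v := by
      rw [hw]
      exact Units.inv_mul_cancel_right _ (spinGroup.toUnits s)
    have h2 := congrArg (fun a => spinRep a (1 : Octonion)) hw2
    simp only [map_mul, h1, one_mul, mul_one, spinRep_ι, Octonion.one_mul] at h2
    rwa [Subtype.ext h2] at hw2
  obtain ⟨r, hr⟩ := CliffordAlgebra.exists_eq_algebraMap_of_commute exists_polarBilin_imForm_eq
    (spinGroup.involute_eq s.2) hc
  apply Subtype.ext
  rw [hr, AlgHom.commutes] at h1
  have h3 := congrArg (fun f : Module.End ℝ Octonion => f 1) h1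
  simp only [Module.algebraMap_end_apply, Module.End.one_apply] at h3
  have h4 : (r - 1) • (1 : Octonion) = 0 := by rw [sub_smul, h3, one_smul, sub_self]
  have h10 : (1 : Octonion) ≠ 0 := fun h => by
    simpa [h] using IsCompositionAlgebra.norm_one (A := Octonion)
  rw [hr, sub_eq_zero.1 ((smul_eq_zero.1 h4).resolve_right h10), map_one]
  rfl

/-- Fixing 1 and negating the seven imaginary dimensions has determinant -1. This is where θ ∈ SO(𝕆)
enters, to exclude odd products of vectors. -/
theorem not_twist_eq_neg {h : twistedGroup Octonion 1}
    (hh : ∀ x ∈ imPart Octonion, twist h x = -x) : False := by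
  have h11 := IsCompositionAlgebra.norm_one (A := Octonion)
  have h10 : (1 : Octonion) ≠ 0 := fun h => by simp [h] at h11
  have he : twist h = (ℝ ∙ (1 : Octonion)).reflection := by
    ext1 x
    have h1 := hh _ (IsCompositionAlgebra.sub_mem_imPart x)
    rw [map_sub, map_smul, twist_map_one le_rfl, neg_sub, sub_eq_iff_eq_add] at h1
    rw [h1, Submodule.reflection_singleton_apply, h11]
    simp only [RCLike.ofReal_real_eq_id, id_eq, one_pow, div_one, two_smul]
    abel
  have hd := det_twist h
  rw [he, Submodule.det_reflection] at hd
  have hf := (ℝ ∙ (1 : Octonion)).finrank_add_finrank_orthogonal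
  rw [finrank_span_singleton h10, Octonion.finrank] at hf
  rw [show Module.finrank ℝ (ℝ ∙ (1 : Octonion))ᗮ = 7 by omega] at hd
  norm_num at hd

/-- The isometry of `Im 𝔸` induced by an element of the twisted group. -/
noncomputable def twistIm (g : twistedGroup Octonion 1) :
    imPart Octonion ≃ₗᵢ[ℝ] imPart Octonion :=
  (⟨(twist g).toLinearEquiv.toLinearMap.restrict fun _ hx => twist_imPart le_rfl g hx,
    fun x => (twist g).norm_map x⟩ :
      imPart Octonion →ₗᵢ[ℝ] imPart Octonion).toLinearIsometryEquiv rfl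

theorem twistIm_apply (g : twistedGroup Octonion 1) (x : imPart Octonion) :
    (twistIm g x : Octonion) = twist g x := rfl

/-- A product of k unit vectors has the same twist on Im 𝕆 as `g₀`, up to (-1)^k. For even k the two
elements differ by ±1, and both signs come from Spin(7); for odd k their quotient would have twist
-1. -/
theorem spinHom_surjective : Function.Surjective spinHom := by
  intro g₀
  obtain ⟨k, s, g, hs, hk, hg, ht⟩ := exists_pin_of_isometry (twistIm g₀)
  rcases Nat.even_or_odd k with he | ho
  · have hs' : s ∈ spinGroup imForm := by
      refine ⟨hs, ?_⟩
      rw [he.natCast_zmod_two, ← CliffordAlgebra.even_toSubmodule] at hk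
      exact hk
    have hψ : ∀ x ∈ imPart Octonion, twist (g⁻¹ * g₀) x = x := fun x hx => by
      have := ht ⟨x, hx⟩
      rw [he.neg_one_pow, one_smul, twistIm_apply] at this
      rw [twist_mul le_rfl, ← this, twist_inv' le_rfl]
    have hm (y : Octonion) : octonionAct g₀ y = octonionAct g (octonionAct (g⁻¹ * g₀) y) := by
      conv_lhs => rw [← mul_inv_cancel_left g g₀, map_mul]
      rfl
    rcases octonionAct_of_twist_eq_id hψ with h | h
    · refine ⟨⟨s, hs'⟩, octonionAct_injective (LinearIsometryEquiv.ext fun y => ?_)⟩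
      rw [octonionAct_spinHom, hm, h, hg]
    · obtain ⟨t, ht, -, -, ht'⟩ := exists_octonionAct_neg
      refine ⟨⟨s, hs'⟩ * ⟨t, ht⟩, octonionAct_injective (LinearIsometryEquiv.ext fun y => ?_)⟩
      rw [octonionAct_spinHom, hm, h, Submonoid.coe_mul, map_mul, Module.End.mul_apply, ht', hg]
  · refine (not_twist_eq_neg (h := g * g₀⁻¹) fun x hx => ?_).elim
    have := ht ⟨_, twist_imPart le_rfl g₀⁻¹ hx⟩
    rw [ho.neg_one_pow, neg_one_smul, twistIm_apply] at this
    rw [twist_mul le_rfl, this]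
    change -twist g₀ (twist g₀⁻¹ x) = -x
    rw [twist_inv le_rfl]

/-- The isomorphism of `Spin(7)` with `G_𝕆(1)`. -/
noncomputable def spinEquiv : SpinSeven ≃* twistedGroup Octonion 1 :=
  MulEquiv.ofBijective spinHom ⟨spinHom_injective, spinHom_surjective⟩

theorem spinEquiv_apply (s : SpinSeven) (v : LinSpace Octonion 1) (k : Fin 1) :
    (spinEquiv s).1 v k = spinRep (s : CliffordAlgebra imForm) (v k) :=
  (apply_eq_octonionAct _ _ _).trans (octonionAct_spinHom s _)

end SpinSeven

/-! ### The homomorphism `Sp(1)³ → G_𝕆(1)` -/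

section QuaternionTriples

/-- Every unit quaternion is the square of a unit quaternion, namely of 1 + β normalized, or of i
when β = -1. So the determinant is the square of ±1. -/
theorem det_mulLeft_unitQuaternion (β : UnitQuaternions) :
    LinearMap.det (LinearMap.mulLeft ℝ (β : ℍ[ℝ])) = 1 := by
  have hsq (γ : ℍ[ℝ]) (hγ : ‖γ‖ = 1) : LinearMap.det (LinearMap.mulLeft ℝ (γ * γ)) = 1 := by
    let L : ℍ[ℝ] →ₗᵢ[ℝ] ℍ[ℝ] := ⟨LinearMap.mulLeft ℝ γ, fun x => by
      change ‖γ * x‖ = ‖x‖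
      rw [norm_mul, hγ, one_mul]⟩
    rw [LinearMap.mulLeft_mul, LinearMap.det_comp]
    exact L.det_mul_self
  by_cases h : 1 + (β : ℍ[ℝ]) = 0
  · rw [eq_neg_of_add_eq_zero_right h, ← quatI_mul_quatI]
    exact hsq _ norm_quatI
  · have hn : ‖1 + (β : ℍ[ℝ])‖ ≠ 0 := norm_ne_zero_iff.2 h
    have h1 : (1 + (β : ℍ[ℝ])) * (1 + (β : ℍ[ℝ])) =
        (‖1 + (β : ℍ[ℝ])‖ * ‖1 + (β : ℍ[ℝ])‖) • (β : ℍ[ℝ]) := by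
      rw [← Quaternion.normSq_eq_norm_mul_self, ← Quaternion.coe_mul_eq_smul,
        ← Quaternion.self_mul_star, mul_assoc]
      congr 1
      rw [star_add, star_one, add_mul, one_mul, Unitary.coe_star_mul_self, add_comm]
    have h2 : (β : ℍ[ℝ]) = (‖1 + (β : ℍ[ℝ])‖⁻¹ • (1 + (β : ℍ[ℝ]))) *
        (‖1 + (β : ℍ[ℝ])‖⁻¹ • (1 + (β : ℍ[ℝ]))) := by
      rw [smul_mul_smul_comm, h1, smul_smul, mul_mul_mul_comm, inv_mul_cancel₀ hn, one_mul,
        one_smul]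
    rw [h2]
    exact hsq _ (norm_smul_inv_norm (𝕜 := ℝ) h)

theorem norm_mul_mul_star (p q : UnitQuaternions) (x : ℍ[ℝ]) :
    ‖(p : ℍ[ℝ]) * x * star (q : ℍ[ℝ])‖ = ‖x‖ := by
  rw [norm_mul, norm_mul, norm_star, p.norm_eq_one, q.norm_eq_one, mul_one, one_mul]

/-- The map `x ↦ p x q*` of `ℍ`. -/
noncomputable def mulMulStarₗ (p q : UnitQuaternions) : ℍ[ℝ] →ₗ[ℝ] ℍ[ℝ] :=
  LinearMap.mulRight ℝ (star (q : ℍ[ℝ])) ∘ₗ LinearMap.mulLeft ℝ (p : ℍ[ℝ])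

theorem det_mulMulStarₗ (p q : UnitQuaternions) : LinearMap.det (mulMulStarₗ p q) = 1 := by
  have h : mulMulStarₗ p q = ((conjIsometry q).toLinearEquiv : ℍ[ℝ] →ₗ[ℝ] ℍ[ℝ]) ∘ₗ
      LinearMap.mulLeft ℝ ((q⁻¹ * p : UnitQuaternions) : ℍ[ℝ]) := by
    ext1 x
    change (p : ℍ[ℝ]) * x * star (q : ℍ[ℝ]) = conjIsometry q ((star (q : ℍ[ℝ]) * p) * x)
    rw [conjIsometry_apply, ← mul_assoc, ← mul_assoc, (Unitary.mem_iff.1 q.2).2, one_mul]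
  rw [h, LinearMap.det_comp, det_conjIsometry, det_mulLeft_unitQuaternion, one_mul]

/-- The isometry `(a, b) ↦ (p a q*, r b s*)` of `𝕆 = ℍ ⊕ ℍ`. -/
noncomputable def octonionProdIsometry (p q r s : UnitQuaternions) : Octonion ≃ₗᵢ[ℝ] Octonion :=
  (⟨(WithLp.linearEquiv 2 ℝ (ℍ[ℝ] × ℍ[ℝ])).symm.conj
      ((mulMulStarₗ p q).prodMap (mulMulStarₗ r s)), fun x => by
    rw [← sq_eq_sq₀ (norm_nonneg _) (norm_nonneg _), WithLp.prod_norm_sq_eq_of_L2,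
      WithLp.prod_norm_sq_eq_of_L2]
    change ‖(p : ℍ[ℝ]) * x.fst * star (q : ℍ[ℝ])‖ ^ 2 + ‖(r : ℍ[ℝ]) * x.snd * star (s : ℍ[ℝ])‖ ^ 2 = _
    rw [norm_mul_mul_star, norm_mul_mul_star]⟩ : Octonion →ₗᵢ[ℝ] Octonion).toLinearIsometryEquiv rfl

@[simp] theorem Octonion.toLp_fst (a b : ℍ[ℝ]) : (WithLp.toLp 2 (a, b) : Octonion).fst = a := rfl

@[simp] theorem Octonion.toLp_snd (a b : ℍ[ℝ]) : (WithLp.toLp 2 (a, b) : Octonion).snd = b := rfl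

theorem octonionProdIsometry_apply (p q r s : UnitQuaternions) (x : Octonion) :
    octonionProdIsometry p q r s x =
      WithLp.toLp 2 (p * x.fst * star (q : ℍ[ℝ]), r * x.snd * star (s : ℍ[ℝ])) := rfl

theorem det_octonionProdIsometry (p q r s : UnitQuaternions) :
    LinearMap.det ((octonionProdIsometry p q r s).toLinearEquiv : Octonion →ₗ[ℝ] Octonion) = 1 := by
  change LinearMap.det ((WithLp.linearEquiv 2 ℝ (ℍ[ℝ] × ℍ[ℝ])).symm.conj
    ((mulMulStarₗ p q).prodMap (mulMulStarₗ r s))) = 1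
  rw [LinearEquiv.conj_apply, LinearMap.comp_assoc, LinearMap.det_conj, LinearMap.det_prodMap, det_mulMulStarₗ,
    det_mulMulStarₗ, one_mul]

/-- Expanding the product, the inner factors q*q, p*p and r*r cancel exactly when the twist is (c,
d) ↦ (q c q*, p d r*). -/
theorem octonionProdIsometry_mul (p q r : UnitQuaternions) (v x : Octonion) :
    octonionProdIsometry p q q r (v * x) =
      octonionProdIsometry p q q r v * octonionProdIsometry q q p r x := by
  have hc (u : UnitQuaternions) (z : ℍ[ℝ]) : star (u : ℍ[ℝ]) * ((u : ℍ[ℝ]) * z) = z := by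
    rw [← mul_assoc, Unitary.coe_star_mul_self, one_mul]
  simp only [octonionProdIsometry_apply]
  apply Octonion.ext
  · simp only [Octonion.mul_fst, Octonion.mul_snd, Octonion.toLp_fst, Octonion.toLp_snd,
      star_mul, star_star, mul_sub, sub_mul,
      mul_assoc, hc]
  · simp only [Octonion.mul_fst, Octonion.mul_snd, Octonion.toLp_fst, Octonion.toLp_snd,
      star_mul, star_star, mul_add, add_mul,
      mul_assoc, hc]

/-- The homomorphism `(p, q, r) ↦ ((a, b) ↦ (p a q*, q b r*))`. -/
noncomputable def tripleHom :
    UnitQuaternions × UnitQuaternions × UnitQuaternions →* twistedGroup Octonion 1 where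
  toFun t := twistedGroup.ofOctonion (octonionProdIsometry t.1 t.2.1 t.2.1 t.2.2)
    (octonionProdIsometry t.2.1 t.2.1 t.1 t.2.2) (det_octonionProdIsometry _ _ _ _)
    (octonionProdIsometry_mul _ _ _)
  map_one' := octonionAct_injective (LinearIsometryEquiv.ext fun x => by
    rw [octonionAct_ofOctonion, octonionProdIsometry_apply]
    apply Octonion.ext <;> simp)
  map_mul' t u := octonionAct_injective (LinearIsometryEquiv.ext fun x => by
    rw [map_mul, LinearIsometryEquiv.coe_mul, Function.comp_apply, octonionAct_ofOctonion,
      octonionAct_ofOctonion, octonionAct_ofOctonion]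
    simp only [octonionProdIsometry_apply, Prod.fst_mul, Prod.snd_mul, Submonoid.coe_mul, star_mul,
      Octonion.toLp_fst, Octonion.toLp_snd, mul_assoc])

theorem octonionAct_tripleHom (t : UnitQuaternions × UnitQuaternions × UnitQuaternions)
    (x : Octonion) : octonionAct (tripleHom t) x = WithLp.toLp 2
      ((t.1 : ℍ[ℝ]) * x.fst * star (t.2.1 : ℍ[ℝ]), (t.2.1 : ℍ[ℝ]) * x.snd * star (t.2.2 : ℍ[ℝ])) :=
  rfl

theorem tripleHom_apply (t : UnitQuaternions × UnitQuaternions × UnitQuaternions)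
    (v : LinSpace Octonion 1) (k : Fin 1) : (tripleHom t).1 v k = WithLp.toLp 2
      ((t.1 : ℍ[ℝ]) * (v k).fst * star (t.2.1 : ℍ[ℝ]),
        (t.2.1 : ℍ[ℝ]) * (v k).snd * star (t.2.2 : ℍ[ℝ])) :=
  apply_eq_octonionAct _ _ _

theorem continuous_tripleHom : Continuous tripleHom := by
  refine twistedGroup.continuous_iff.2 fun v =>
    (PiLp.continuous_toLp 2 _).comp (continuous_pi fun k => ?_)
  refine (WithLp.prod_continuous_toLp 2 _ _).comp (Continuous.prodMk ?_ ?_)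
  · exact ((continuous_subtype_val.comp continuous_fst).mul continuous_const).mul
      (continuous_star.comp (continuous_subtype_val.comp (continuous_fst.comp continuous_snd)))
  · exact ((continuous_subtype_val.comp (continuous_fst.comp continuous_snd)).mul
      continuous_const).mul
      (continuous_star.comp (continuous_subtype_val.comp (continuous_snd.comp continuous_snd)))

theorem mem_ker_tripleHom (t : UnitQuaternions × UnitQuaternions × UnitQuaternions) :
    t ∈ tripleHom.ker ↔ t = 1 ∨
      ((t.1 : ℍ[ℝ]) = -1 ∧ (t.2.1 : ℍ[ℝ]) = -1 ∧ (t.2.2 : ℍ[ℝ]) = -1) := by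
  obtain ⟨p, q, r⟩ := t
  rw [MonoidHom.mem_ker]
  constructor
  · intro h
    have hx (a b : ℍ[ℝ]) : (p : ℍ[ℝ]) * a * star (q : ℍ[ℝ]) = a ∧
        (q : ℍ[ℝ]) * b * star (r : ℍ[ℝ]) = b := by
      have h1 := octonionAct_tripleHom (p, q, r) (WithLp.toLp 2 (a, b))
      rw [h, map_one] at h1
      exact ⟨(congrArg WithLp.fst h1).symm, (congrArg WithLp.snd h1).symm⟩
    have hc {u w : UnitQuaternions} {z : ℍ[ℝ]} (h : (u : ℍ[ℝ]) * z * star (w : ℍ[ℝ]) = z) :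
        (u : ℍ[ℝ]) * z = z * w := by
      conv_rhs => rw [← h]
      rw [mul_assoc _ _ (w : ℍ[ℝ]), Unitary.coe_star_mul_self, mul_one]
    have hpq : (p : ℍ[ℝ]) = q := by simpa using hc (hx 1 1).1
    have hqr : (q : ℍ[ℝ]) = r := by simpa using hc (hx 1 1).2
    rcases eq_one_or_neg_one_of_commute (β := p) fun x => by
      have := hc (hx x 1).1
      rwa [← hpq] at this with h | h
    · left
      exact Prod.ext (Subtype.ext h) (Prod.ext (Subtype.ext (hpq.symm.trans h))
        (Subtype.ext (hqr.symm.trans (hpq.symm.trans h))))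
    · exact .inr ⟨h, hpq.symm.trans h, hqr.symm.trans (hpq.symm.trans h)⟩
  · rintro (h | ⟨h1, h2, h3⟩)
    · rw [h, map_one]
    · refine octonionAct_injective (LinearIsometryEquiv.ext fun x => ?_)
      rw [octonionAct_tripleHom, map_one]
      simp only at h1 h2 h3
      rw [h1, h2, h3]
      apply Octonion.ext <;> simp

end QuaternionTriples

/-! ### Half Lagrangian subspaces of `𝕆` -/

section OctonionicLagrangian

/-- `0 ⊕ ℍ` as a subspace of `𝕆`. -/
noncomputable def octonionSndSubspace : Submodule ℝ Octonion :=
  LinearMap.ker (WithLp.fstₗ 2 ℝ ℍ[ℝ] ℍ[ℝ])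

theorem mem_octonionSndSubspace {x : Octonion} : x ∈ octonionSndSubspace ↔ x.fst = 0 := Iff.rfl

theorem octonionSndSubspace_le_imPart : octonionSndSubspace ≤ imPart Octonion := fun x hx => by
  rw [mem_octonionSndSubspace] at hx
  rw [mem_imPart, WithLp.prod_inner_apply]
  change inner ℝ (1 : ℍ[ℝ]) x.fst + inner ℝ (0 : ℍ[ℝ]) x.snd = (0 : ℝ)
  rw [hx]
  simp

theorem finrank_octonionSndSubspace : Module.finrank ℝ octonionSndSubspace = 4 := by
  have h := (WithLp.fstₗ 2 ℝ ℍ[ℝ] ℍ[ℝ]).finrank_range_add_finrank_ker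
  rw [LinearMap.range_eq_top.2 fun a => ⟨WithLp.toLp 2 (a, 0), rfl⟩, finrank_top,
    Quaternion.finrank_eq_four, Octonion.finrank] at h
  change 4 + Module.finrank ℝ octonionSndSubspace = 8 at h
  omega

theorem finrank_linSpace_octonion : Module.finrank ℝ (LinSpace Octonion 1) = 8 := by
  rw [← octonionVec.toLinearEquiv.finrank_eq, Octonion.finrank]

theorem mem_quaternionSubspace {x : Octonion} :
    octonionVec x ∈ quaternionSubspace ↔ x.snd = 0 :=
  ⟨fun h => h 0, fun h _ => h⟩

theorem quaternionSubspace_eq : quaternionSubspace = (LinearMap.ker (WithLp.sndₗ 2 ℝ ℍ[ℝ] ℍ[ℝ])).map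
    (octonionVec.toLinearEquiv : Octonion →ₗ[ℝ] LinSpace Octonion 1) := by
  ext v
  constructor
  · intro h
    exact ⟨v 0, h 0, octonionVec.apply_symm_apply v⟩
  · rintro ⟨x, hx, rfl⟩
    exact mem_quaternionSubspace.2 hx

theorem finrank_quaternionSubspace : Module.finrank ℝ quaternionSubspace = 4 := by
  rw [quaternionSubspace_eq, LinearEquiv.finrank_map_eq]
  have h := (WithLp.sndₗ 2 ℝ ℍ[ℝ] ℍ[ℝ]).finrank_range_add_finrank_ker
  rw [LinearMap.range_eq_top.2 fun a => ⟨WithLp.toLp 2 (0, a), rfl⟩, finrank_top,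
    Quaternion.finrank_eq_four, Octonion.finrank] at h
  change 4 + Module.finrank ℝ (LinearMap.ker (WithLp.sndₗ 2 ℝ ℍ[ℝ] ℍ[ℝ])) = 8 at h
  change Module.finrank ℝ (LinearMap.ker (WithLp.sndₗ 2 ℝ ℍ[ℝ] ℍ[ℝ])) = 4
  omega

theorem inner_eq_zero_of_snd_of_fst {x y : Octonion} (hx : x.snd = 0) (hy : y.fst = 0) :
    inner ℝ x y = (0 : ℝ) := by
  rw [WithLp.prod_inner_apply]
  change inner ℝ x.fst y.fst + inner ℝ x.snd y.snd = (0 : ℝ)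
  rw [hx, hy]
  simp

theorem isHalfLagrangian_quaternionSubspace : IsHalfLagrangian quaternionSubspace := by
  refine ⟨by rw [finrank_quaternionSubspace, finrank_linSpace_octonion], octonionSndSubspace,
    octonionSndSubspace_le_imPart, by rw [finrank_octonionSndSubspace, Octonion.finrank], ?_⟩
  intro u hu _ c hc c' hc'
  rw [mem_octonionSndSubspace] at hu
  rw [PiLp.inner_apply, Fin.sum_univ_one, real_inner_comm]
  refine inner_eq_zero_of_snd_of_fst (hc' 0) ?_
  rw [rightMul_apply, Octonion.mul_fst, hu, show (c 0).snd = 0 from hc 0]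
  simp

/-- The subspaces `C` of half the dimension with `C u ⟂ C` for all `u ∈ 0 ⊕ ℍ` are `ℍ ⊕ 0` and
`0 ⊕ ℍ`. -/
theorem eq_or_eq_of_inner_rightMul_eq_zero {C : Submodule ℝ (LinSpace Octonion 1)}
    (hd : Module.finrank ℝ C = 4)
    (hC : ∀ u ∈ octonionSndSubspace, ∀ c ∈ C, ∀ c' ∈ C, inner ℝ (rightMul c u) c' = 0) :
    C = quaternionSubspace ∨ C = octonionSndSubspace.map
      (octonionVec.toLinearEquiv : Octonion →ₗ[ℝ] LinSpace Octonion 1) := by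
  have hone : (WithLp.toLp 2 (0, 1) : Octonion) ∈ octonionSndSubspace := rfl
  have hn : ‖(WithLp.toLp 2 (0, 1) : Octonion)‖ = 1 := by
    rw [← sq_eq_sq₀ (norm_nonneg _) (by positivity), Octonion.norm_sq]
    simp
  -- Right multiplication by (0, e*) followed by that by (0, 1) is (a, b) ↦ -(ea, be), and such a
  -- composite preserves `C`.
  have h1 (e : ℍ[ℝ]) {x : Octonion} (hx : octonionVec x ∈ C) :
      octonionVec (WithLp.toLp 2 (e * x.fst, x.snd * e)) ∈ C := by
    have h := rightMul_rightMul_mem (by rw [hd, finrank_linSpace_octonion])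
      (hC (WithLp.toLp 2 (0, star e)) rfl) (hC _ hone) (fun v => by
        ext k
        rw [rightMul_apply, rightMul_apply,
          Octonion.mul_mul_self (octonionSndSubspace_le_imPart hone), hn]
        simp) hx
    have h2 : rightMul (rightMul (octonionVec x) (WithLp.toLp 2 (0, star e)))
        (WithLp.toLp 2 (0, 1)) = -octonionVec (WithLp.toLp 2 (e * x.fst, x.snd * e)) := by
      rw [← map_neg]
      ext k
      rw [rightMul_apply, rightMul_apply]
      change x * _ * _ = _
      apply Octonion.ext
      · simp [Octonion.mul_fst, Octonion.mul_snd]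
        rfl
      · simp [Octonion.mul_fst, Octonion.mul_snd]
        rfl
    rw [h2] at h
    exact neg_mem_iff.1 h
  have hfst {x : Octonion} (hx : octonionVec x ∈ C) (e : ℍ[ℝ]) :
      octonionVec (WithLp.toLp 2 (e * x.fst, 0)) ∈ C := by
    -- Acting with ij, or with i and then j, agrees on the second component but not on the first.
    -- The difference isolates the first component, and this identity normalizes it.
    have hk : quatI * quatJ * (quatI * quatJ - quatJ * quatI) = (-2 : ℝ) • 1 := by
      ext <;> simp
      norm_num
    have h2 := C.sub_mem (h1 (quatI * quatJ) hx) (h1 quatJ (h1 quatI hx))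
    rw [← map_sub] at h2
    have h3 := h1 (((-1 / 2 : ℝ) • e) * (quatI * quatJ)) h2
    convert h3 using 2
    apply Octonion.ext
    · simp only [Octonion.toLp_fst, Octonion.toLp_snd, WithLp.sub_fst]
      rw [← mul_assoc quatJ, ← sub_mul, ← mul_assoc, mul_assoc _ (quatI * quatJ), hk, mul_smul_comm,
        mul_one, smul_smul]
      norm_num
    · simp only [Octonion.toLp_fst, Octonion.toLp_snd, WithLp.sub_snd]
      rw [mul_assoc x.snd, sub_self, zero_mul]
  -- One nonzero first component generates all of ℍ ⊕ 0 under left multiplications; in either case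
  -- dimension 4 gives equality.
  by_cases h : ∃ x, octonionVec x ∈ C ∧ x.fst ≠ 0
  · left
    obtain ⟨x, hx, hx0⟩ := h
    refine (Submodule.eq_of_le_of_finrank_le (fun v hv => ?_)
      (by rw [hd, finrank_quaternionSubspace])).symm
    have h2 := hfst hx ((v 0).fst * x.fst⁻¹)
    rw [inv_mul_cancel_right₀ hx0] at h2
    convert h2
    rw [← octonionVec.symm_apply_eq]
    exact Octonion.ext rfl (hv 0)
  · right
    push Not at h
    refine Submodule.eq_of_le_of_finrank_le (fun v hv => ?_)
      (by rw [hd, LinearEquiv.finrank_map_eq, finrank_octonionSndSubspace])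
    exact ⟨v 0, h _ (by rwa [show octonionVec (v 0) = v from octonionVec.apply_symm_apply v]),
      octonionVec.apply_symm_apply v⟩

/-- Isometries act transitively on the subspaces of a given dimension. -/
theorem exists_isometry_map_le {E : Type*} [NormedAddCommGroup E] [InnerProductSpace ℝ E]
    [FiniteDimensional ℝ E] {S S' : Submodule ℝ E}
    (h : Module.finrank ℝ S = Module.finrank ℝ S') : ∃ T : E ≃ₗᵢ[ℝ] E, ∀ x ∈ S, T x ∈ S' := by
  -- Matching orthonormal bases gives an isometry of `S` onto `S'`, which extends to the whole
  -- space.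
  let e := (stdOrthonormalBasis ℝ S).equiv (stdOrthonormalBasis ℝ S') (finCongr h)
  let f := S'.subtypeₗᵢ.comp e.toLinearIsometry
  refine ⟨f.extend.toLinearIsometryEquiv rfl, fun x hx => ?_⟩
  change f.extend x ∈ S'
  rw [show f.extend x = f ⟨x, hx⟩ from f.extend_apply ⟨x, hx⟩]
  exact (e ⟨x, hx⟩).2

/-- Twists realize all isometries of Im 𝕆 up to sign, and a sign does not move a subspace. -/
theorem exists_twist_mem {L : Submodule ℝ Octonion} (hL : L ≤ imPart Octonion)
    (hd : Module.finrank ℝ L = 4) :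
    ∃ g : twistedGroup Octonion 1, ∀ u ∈ octonionSndSubspace, twist g u ∈ L := by
  obtain ⟨T, hT⟩ := exists_isometry_map_le
    (S := octonionSndSubspace.comap (imPart Octonion).subtype)
    (S' := L.comap (imPart Octonion).subtype) (by
      rw [(Submodule.comapSubtypeEquivOfLe octonionSndSubspace_le_imPart).finrank_eq,
        (Submodule.comapSubtypeEquivOfLe hL).finrank_eq, hd, finrank_octonionSndSubspace])
  obtain ⟨k, s, g, -, -, -, hg⟩ := exists_pin_of_isometry T
  refine ⟨g, fun u hu => ?_⟩
  rw [show twist g u = _ from hg ⟨u, octonionSndSubspace_le_imPart hu⟩]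
  exact L.smul_mem _ (hT ⟨u, octonionSndSubspace_le_imPart hu⟩ hu)

theorem exists_imageUnder_quaternionSubspace_eq_map :
    ∃ g : twistedGroup Octonion 1, imageUnder g quaternionSubspace = octonionSndSubspace.map
      (octonionVec.toLinearEquiv : Octonion →ₗ[ℝ] LinSpace Octonion 1) := by
  have hone : (WithLp.toLp 2 (0, 1) : Octonion) ∈ octonionSndSubspace := rfl
  have hn : ‖(WithLp.toLp 2 (0, 1) : Octonion)‖ = 1 := by
    rw [← sq_eq_sq₀ (norm_nonneg _) (by positivity), Octonion.norm_sq]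
    simp
  obtain ⟨g, hg, -⟩ := exists_rightMul_octonion (octonionSndSubspace_le_imPart hone) hn
  refine ⟨g, imageUnder_eq_of_le ?_ fun v hv => ⟨octonionAct g (v 0), ?_, ?_⟩⟩
  · rw [LinearEquiv.finrank_map_eq, finrank_octonionSndSubspace, finrank_quaternionSubspace]
  · change (octonionAct g (v 0)).fst = 0
    rw [hg, Octonion.mul_fst, show (v 0).snd = 0 from hv 0]
    simp
  · ext k
    rw [apply_eq_octonionAct, Fin.fin_one_eq_zero k]
    rfl

/-- After a twist takes 0 ⊕ ℍ to `L`, the pulled back subspace is ℍ ⊕ 0 or 0 ⊕ ℍ, and the second is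
an image of the first. -/
theorem exists_imageUnder_quaternionSubspace_eq {C : Submodule ℝ (LinSpace Octonion 1)}
    (hC : IsHalfLagrangian C) : ∃ g, imageUnder g quaternionSubspace = C := by
  obtain ⟨L, hL, hLd, hu⟩ := hC.exists_orthogonal
  rw [Octonion.finrank] at hLd
  obtain ⟨g, hg⟩ := exists_twist_mem hL (by omega)
  have hd := hC.1
  rw [finrank_linSpace_octonion] at hd
  have hgg : imageUnder g (imageUnder g⁻¹ C) = C := by
    rw [← imageUnder_mul, mul_inv_cancel, imageUnder_one]
  have hmem {c : LinSpace Octonion 1} (hc : c ∈ imageUnder g⁻¹ C) : g.1 c ∈ C := by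
    rw [← hgg]
    exact apply_mem_imageUnder hc
  have h := eq_or_eq_of_inner_rightMul_eq_zero (C := imageUnder g⁻¹ C) (by
      rw [imageUnder, LinearEquiv.finrank_map_eq]
      omega) fun u hu0 c hc c' hc' => by
    rw [← g.1.inner_map_map, apply_rightMul]
    exact hu _ (hg u hu0) _ (hmem hc) _ (hmem hc')
  rcases h with h | h
  · exact ⟨g, by rw [← h, hgg]⟩
  · obtain ⟨h', hh'⟩ := exists_imageUnder_quaternionSubspace_eq_map
    exact ⟨g * h', by rw [imageUnder_mul, hh', ← h, hgg]⟩

/-- A stabilizing element preserves ℍ ⊕ 0 and its complement, acting by P and Q, and its twist acts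
on ℍ ⊕ 0 by R. The relations P(ac) = P(a)R(c) and Q(cb) = R(c)Q(b) make R an automorphism of ℍ,
hence conjugation by some q, and express P and Q through q, P(1) and Q(1). -/
theorem imageUnder_quaternionSubspace_eq_iff (g : twistedGroup Octonion 1) :
    imageUnder g quaternionSubspace = quaternionSubspace ↔ g ∈ tripleHom.range := by
  constructor
  · intro h
    have hsnd {x : Octonion} (hx : x.snd = 0) : (octonionAct g x).snd = 0 := by
      rw [← mem_quaternionSubspace, octonionVec_octonionAct, ← h]
      exact apply_mem_imageUnder (mem_quaternionSubspace.2 hx)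
    have hfst {y : Octonion} (hy : y.fst = 0) : (octonionAct g y).fst = 0 := by
      have h1 : octonionVec (WithLp.toLp 2 ((octonionAct g y).fst, 0)) ∈ quaternionSubspace :=
        mem_quaternionSubspace.2 rfl
      rw [← h] at h1
      obtain ⟨v, hv, hv'⟩ := h1
      have h2 : octonionAct g (v 0) = WithLp.toLp 2 ((octonionAct g y).fst, 0) := by
        rw [← apply_eq_octonionAct]
        exact congrFun (congrArg WithLp.ofLp hv') 0
      have h3 := inner_eq_zero_of_snd_of_fst (hv 0) hy
      rw [← (octonionAct g).inner_map_map, h2, WithLp.prod_inner_apply] at h3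
      change inner ℝ (octonionAct g y).fst (octonionAct g y).fst +
        inner ℝ (0 : ℍ[ℝ]) (octonionAct g y).snd = (0 : ℝ) at h3
      rwa [inner_zero_left, add_zero, inner_self_eq_zero] at h3
    have hmul (v x : Octonion) := octonionAct_mul g v x
    set P : ℍ[ℝ] → ℍ[ℝ] := fun a => (octonionAct g (WithLp.toLp 2 (a, 0))).fst with hP
    set Q : ℍ[ℝ] → ℍ[ℝ] := fun b => (octonionAct g (WithLp.toLp 2 (0, b))).snd with hQ
    have hPe (a : ℍ[ℝ]) : octonionAct g (WithLp.toLp 2 (a, 0)) = WithLp.toLp 2 (P a, 0) :=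
      Octonion.ext rfl (hsnd rfl)
    have hQe (b : ℍ[ℝ]) : octonionAct g (WithLp.toLp 2 (0, b)) = WithLp.toLp 2 (0, Q b) :=
      Octonion.ext (hfst rfl) rfl
    have hPn : ‖P 1‖ = 1 := by
      have h1 := (octonionAct g).norm_map 1
      rw [show (1 : Octonion) = WithLp.toLp 2 (1, 0) from rfl, hPe,
        ← sq_eq_sq₀ (norm_nonneg _) (norm_nonneg _), Octonion.norm_sq, Octonion.norm_sq] at h1
      simp only [Octonion.toLp_fst, Octonion.toLp_snd, map_zero, map_one, add_zero,
        Quaternion.normSq_eq_norm_mul_self] at h1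
      nlinarith [norm_nonneg (P 1)]
    have hQn : ‖Q 1‖ = 1 := by
      have h1 := (octonionAct g).norm_map (WithLp.toLp 2 (0, 1))
      rw [hQe, ← sq_eq_sq₀ (norm_nonneg _) (norm_nonneg _), Octonion.norm_sq,
        Octonion.norm_sq] at h1
      simp only [Octonion.toLp_fst, Octonion.toLp_snd, map_zero, map_one, zero_add,
        Quaternion.normSq_eq_norm_mul_self] at h1
      nlinarith [norm_nonneg (Q 1)]
    have hP0 : P 1 ≠ 0 := fun h => by simp [h] at hPn
    let R : ℍ[ℝ] →ₗ[ℝ] ℍ[ℝ] :=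
      { toFun := fun c => (twist g (WithLp.toLp 2 (c, 0))).fst
        map_add' := fun c d => by
          rw [← WithLp.add_fst, ← map_add, ← WithLp.toLp_add, Prod.mk_add_mk, add_zero]
        map_smul' := fun r c => by
          rw [RingHom.id_apply, ← WithLp.smul_fst, ← map_smul, ← WithLp.toLp_smul, Prod.smul_mk,
            smul_zero] }
    have hac (a c : ℍ[ℝ]) : (WithLp.toLp 2 (a, 0) : Octonion) * WithLp.toLp 2 (c, 0) =
        WithLp.toLp 2 (a * c, 0) := by
      apply Octonion.ext <;> simp [Octonion.mul_fst, Octonion.mul_snd]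
    have hbc (b c : ℍ[ℝ]) : (WithLp.toLp 2 (0, b) : Octonion) * WithLp.toLp 2 (c, 0) =
        WithLp.toLp 2 (0, c * b) := by
      apply Octonion.ext <;> simp [Octonion.mul_fst, Octonion.mul_snd]
    have hRe (c : ℍ[ℝ]) : twist g (WithLp.toLp 2 (c, 0)) = WithLp.toLp 2 (R c, 0) := by
      refine Octonion.ext rfl ?_
      have h1 := hmul (WithLp.toLp 2 (1, 0)) (WithLp.toLp 2 (c, 0))
      rw [hac, hPe, hPe] at h1
      have h2 := congrArg WithLp.snd h1
      rw [Octonion.mul_snd] at h2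
      simp only [Octonion.toLp_fst, Octonion.toLp_snd, mul_zero, add_zero] at h2
      exact (mul_eq_zero.1 h2.symm).resolve_left (star_ne_zero.2 hP0)
    have hPR (a c : ℍ[ℝ]) : P (a * c) = P a * R c := by
      have h1 := hmul (WithLp.toLp 2 (a, 0)) (WithLp.toLp 2 (c, 0))
      rw [hac, hPe, hPe, hRe, hac] at h1
      exact congrArg WithLp.fst h1
    have hQR (b c : ℍ[ℝ]) : Q (c * b) = R c * Q b := by
      have h1 := hmul (WithLp.toLp 2 (0, b)) (WithLp.toLp 2 (c, 0))
      rw [hbc, hQe, hQe, hRe, hbc] at h1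
      exact congrArg WithLp.snd h1
    obtain ⟨q, hq⟩ := exists_conj_of_mul_hom R
      (congrArg WithLp.fst (twist_map_one le_rfl g)) fun x y => by
        refine mul_left_cancel₀ hP0 ?_
        rw [← hPR, one_mul, hPR, ← mul_assoc, ← hPR 1 x, one_mul]
    -- From P(a) = P(1) q a q* and Q(b) = q b q* Q(1) one reads p = P(1) q and r = Q(1)* q.
    refine ⟨(⟨P 1, mem_unitary_of_norm hPn⟩ * q, q, ⟨Q 1, mem_unitary_of_norm hQn⟩⁻¹ * q),
      octonionAct_injective (LinearIsometryEquiv.ext fun x => ?_)⟩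
    have hx : x = WithLp.toLp 2 (x.fst, 0) + WithLp.toLp 2 (0, x.snd) := by
      apply Octonion.ext <;> simp
    have hx' : octonionAct g x = WithLp.toLp 2 (P x.fst, Q x.snd) := by
      conv_lhs => rw [hx]
      rw [map_add, hPe, hQe]
      apply Octonion.ext <;> simp
    have h1 : P x.fst = P 1 * q * x.fst * star (q : ℍ[ℝ]) := by
      rw [← one_mul x.fst, hPR, hq, one_mul, mul_assoc, mul_assoc, mul_assoc]
    have h2 : Q x.snd = q * x.snd * star (star (Q 1) * q) := by
      rw [← mul_one x.snd, hQR, hq, mul_one, star_mul, star_star, mul_assoc _ _ (Q 1)]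
    rw [hx', h1, h2]
    rfl
  · rintro ⟨t, rfl⟩
    refine imageUnder_eq_of_le le_rfl fun v hv k => ?_
    rw [tripleHom_apply, Octonion.toLp_snd, hv k]
    simp

theorem isHomogeneousSpace_octonion : IsHomogeneousSpace tripleHom.range quaternionSubspace :=
  isHomogeneousSpace_of_stabilizer le_rfl isHalfLagrangian_quaternionSubspace
    (fun _ hC => exists_imageUnder_quaternionSubspace_eq hC) imageUnder_quaternionSubspace_eq_iff

end OctonionicLagrangian

/-! ### Assembly of the three cases. -/

theorem mainTheorem9 :
    -- the complex case
    (∀ n : ℕ, 1 ≤ n →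
      ∃ e : Matrix.unitaryGroup (Fin n) ℂ ≃ₜ* twistedGroup ℂ n,
        (∀ (M : Matrix.unitaryGroup (Fin n) ℂ) (v : LinSpace ℂ n) (k : Fin n),
          (e M).1 v k = ∑ l, M.1 k l * v l) ∧
        IsHomogeneousSpace ((orthogonalInUnitary n).map e.toMonoidHom) (realSubspace n) ∧
        (specialOrthogonalInUnitary n).relIndex (orthogonalInUnitary n) = 2 ∧
        ∀ o : Orientation ℝ (realSubspace n) (Fin n),
          ∃ h : (twistedGroup ℂ n ⧸ (specialOrthogonalInUnitary n).map e.toMonoidHom) ≃ₜ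
              OrientedLagrangian n,
            ∀ g : twistedGroup ℂ n, ∃ f : realSubspace n ≃ₗ[ℝ] (h g).C,
              (∀ x, (f x : LinSpace ℂ n) = g.1 x) ∧ (h g).o = Orientation.map (Fin n) f o) ∧
    -- the quaternionic case
    (∀ n : ℕ, 1 ≤ n →
      ∃ Φ : SpGroup n × UnitQuaternions →* twistedGroup ℍ[ℝ] n,
        Continuous Φ ∧ Function.Surjective Φ ∧
        (∀ p, p ∈ Φ.ker ↔ p = 1 ∨ ((p.1 : Matrix (Fin n) (Fin n) ℍ[ℝ]) = -1 ∧ (p.2 : ℍ[ℝ]) = -1)) ∧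
        (∀ (p : SpGroup n × UnitQuaternions) (v : LinSpace ℍ[ℝ] n) (k : Fin n),
          (Φ p).1 v k = (∑ l, p.1.1 k l * v l) * star (p.2 : ℍ[ℝ])) ∧
        IsHomogeneousSpace ((extendedUnitaryPairs n).map Φ) (complexSubspace n) ∧
        ((unitaryPairs n).map Φ).relIndex ((extendedUnitaryPairs n).map Φ) = 2 ∧
        ∃ h : (twistedGroup ℍ[ℝ] n ⧸ (unitaryPairs n).map Φ) ≃ₜ PolarizedLagrangian n,
          ∀ g : twistedGroup ℍ[ℝ] n, (h g).1.1 = imageUnder g (complexSubspace n) ∧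
            ∀ v : LinSpace ℍ[ℝ] n,
              g.1 (rightMul v ((Complex.I : ℂ) : ℍ[ℝ])) = rightMul (g.1 v) (h g).1.2) ∧
    -- the octonionic case
    (∃ S : SpinSeven ≃* twistedGroup Octonion 1,
      (∀ (s : SpinSeven) (v : LinSpace Octonion 1) (k : Fin 1),
        (S s).1 v k = spinRep (s : CliffordAlgebra imForm) (v k)) ∧
      ∃ Ψ : UnitQuaternions × UnitQuaternions × UnitQuaternions →* twistedGroup Octonion 1,
        Continuous Ψ ∧
        (∀ t, t ∈ Ψ.ker ↔ t = 1 ∨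
          ((t.1 : ℍ[ℝ]) = -1 ∧ (t.2.1 : ℍ[ℝ]) = -1 ∧ (t.2.2 : ℍ[ℝ]) = -1)) ∧
        (∀ (t : UnitQuaternions × UnitQuaternions × UnitQuaternions)
          (v : LinSpace Octonion 1) (k : Fin 1),
          (Ψ t).1 v k = WithLp.toLp 2
            ((t.1 : ℍ[ℝ]) * (v k).fst * star (t.2.1 : ℍ[ℝ]),
              (t.2.1 : ℍ[ℝ]) * (v k).snd * star (t.2.2 : ℍ[ℝ]))) ∧
        IsHomogeneousSpace Ψ.range quaternionSubspace) :=
  ⟨fun _ hn => ⟨unitaryEquiv hn, fun M v k => by rw [unitaryEquiv_val]; rfl,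
      isHomogeneousSpace_complex hn, relIndex_specialOrthogonal hn,
      exists_orientedLagrangian_homeomorph hn⟩,
    fun _ hn => ⟨spHom, continuous_spHom, spHom_surjective hn, mem_ker_spHom hn,
      fun p v k => by rw [spHom_apply]; rfl, isHomogeneousSpace_quaternion hn,
      relIndex_unitaryPairs hn, exists_polarizedLagrangian_homeomorph hn⟩,
    spinEquiv, spinEquiv_apply, tripleHom, continuous_tripleHom, mem_ker_tripleHom,
      tripleHom_apply, isHomogeneousSpace_octonion⟩
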